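/- **Setting.** $G=(V,E)$ is a simple connected network with $n$ nodes, hop diameter $D$ and distinct node identifiers that are polynomially bounded in $n$. The model is CONGEST: synchronous rounds, messages of $O(\log n)$ bits over each edge and in each direction per round, unlimited local computation. A *cluster graph* $\mathcal G$ on $G$ consists of - a partition of $V$ into clusters, each with a leader (whose identifier is the identifier of the cluster) and with a spanning tree in $G$ rooted at the leader; - a loopless multigraph on the set of clusters with integer capacities $\mathrm{cap}$ between $1$ and $\mathrm{poly}(n)$; - a map $\psi$ that sends each edge $\{S,S'\}$ of this multigraph to an edge of $G$ joining $S$ and $S'$. Every edge of $G$ represents at most one edge of $\mathcal G$. In the *distributed representation* of a cluster graph, each node knows the identifier and the size of its cluster and its parent in the cluster tree, and both ends of an edge $\psi(e)$ know that it represents $e$, the clusters that $e$ joins, and the capacity of $e$. Let $\mathcal T$ be a rooted spanning tree of $\mathcal G$. For $e\in\mathcal T$ let $\mathrm{cap}_{\mathcal T}(e)$ be the total capacity of the edges of $\mathcal G$ with exactly one end in the subtree of $\mathcal T$ below $e$. For $\mathcal F\subseteq\mathcal T$, the graph $\mathcal H(\mathcal T,\mathcal F)$ on the set of clusters consists of the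 edges $e\in\mathcal T\setminus\mathcal F$ with capacity $\mathrm{cap}_{\mathcal T}(e)$ and of all edges $e$ of $\mathcal G$ between different components of $\mathcal T\setminus\mathcal F$ with capacity $\mathrm{cap}(e)$; it belongs to $\mathbb H[i]$ if $|\mathcal F|\le i$. Let $\mathcal R\subseteq\mathcal T$ be the random set that contains, independently, the tree edge from each non-root cluster $S$ to its parent with probability $\min\{1,|S|/\sqrt n\}$. A multigraph with capacities $\mathrm{cap}$ is *$\beta$-embeddable* into one with capacities $\mathrm{cap}'$ on the same nodes if one can simultaneously route, for every edge $e=\{u,v\}$ of the first, a flow of $\mathrm{cap}(e)$ units between $u$ and $v$ in the second so that the sum of the absolute values of these flows on each edge $e'$ of the second is at most $\beta\,\mathrm{cap}'(e')$. A *$j$-tree* is the union of a spanning forest with at most $j$ components and a connected multigraph (the core graph) on a set of nodes containing exactly one node of each component. **Statement.** There are a deterministic CONGEST algorithm $A$ and absolute constants $\beta\ge 1$ and $k$ such that for every exponent $\kappa$ (bounding identifiers and capacities by $n^\kappa$) and every $c>0$ there is a constant $C$ for which the following holds for all $G$, $\mathcal G$ and $\mathcal T$ as above, where the cluster trees of $\mathcal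 G$ have depth at most $d$. With probability at least $1-n^{-c}$ over $\mathcal R$, for all $\mathcal F$ with $\mathcal R\subseteq\mathcal F\subseteq\mathcal T$ and all integers $j\ge 1$ with $\mathcal H(\mathcal T,\mathcal F)\in\mathbb H[j/4]$: Suppose that initially each node knows its identifier, its neighbours and its part of the distributed representation of $\mathcal G$, and that both ends of each edge $\psi(e)$ with $e\in\mathcal T$ know that $e\in\mathcal T$, which end of $e$ is the child, whether $e\in\mathcal F$, and $\mathrm{cap}_{\mathcal T}(e)$. Then $A$ terminates at all nodes within $C\,(D+d+\sqrt n)(1+\log n)^k$ rounds, i.e. within $\tilde O(D+d+\sqrt n)$ rounds, and outputs the distributed representation of 1. a new cluster graph on $G$ whose cluster trees have depth at most $d+C\sqrt n\,(1+\log n)^k=d+\tilde O(\sqrt n)$; and 2. a $j$-tree $\mathcal J$ on the set of clusters of $\mathcal G$ such that - $\mathcal H(\mathcal T,\mathcal F)$ is $1$-embeddable into $\mathcal J$ and $\mathcal J$ is $\beta$-embeddable into $\mathcal H(\mathcal T,\mathcal F)$; - each edge $e$ of $\mathcal J$ is represented by its own edge $\{u,v\}$ of $G$, and $u$ and $v$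 know $e$ (its two ends in $\mathcal J$, and whether it is a forest or a core edge) and $\mathrm{cap}_{\mathcal J}(e)$; - the new clusters are the unions of the old clusters in the tree components of $\mathcal J$, and the edges of the new cluster graph are the core edges of $\mathcal J$, with the same capacities and represented by the same edges of $G$. For all valid inputs, including all $\mathcal F\subseteq\mathcal T$, the messages of $A$ have $O(\log n)$ bits, with a constant depending only on $\kappa$ and $c$. -/

import Mathlib

/-! ### Capacitated multigraphs, embeddability, `j`-trees -/

/-- A loopless undirected multigraph with integer edge capacities, on node set `N` and with edges
indexed by `E`.  Edges carry an arbitrary reference orientation `src e → tgt e`, which only fixes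
the sign convention for flows. -/
structure CapGraph (N E : Type) where
  src : E → N
  tgt : E → N
  src_ne_tgt : ∀ e, src e ≠ tgt e
  cap : E → ℕ

namespace CapGraph

variable {N E E' : Type}

/-- Adjacency through edges of `A`; used for connectivity only. -/
def graphOn (Γ : CapGraph N E) (A : Set E) : SimpleGraph N :=
  SimpleGraph.fromRel fun x y => ∃ e ∈ A, Γ.src e = x ∧ Γ.tgt e = y

/-- The edge set `A` contains no cycle (parallel edges count as a cycle): every edge of `A` is a
bridge. -/
def IsForest (Γ : CapGraph N E) (A : Set E) : Prop :=
  ∀ e ∈ A, ¬ (Γ.graphOn (A \ {e})).Reachable (Γ.src e) (Γ.tgt e)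

open Classical in
/-- Net amount leaving node `x` under the signed flow `f`. -/
noncomputable def netOut [Fintype E] (Γ : CapGraph N E) (f : E → ℝ) (x : N) : ℝ :=
  (∑ e with Γ.src e = x, f e) - ∑ e with Γ.tgt e = x, f e

open Classical in
/-- The signed flow `f` routes `a` units from `s` to `t` (capacities are treated separately). -/
def Routes [Fintype E] (Γ : CapGraph N E) (f : E → ℝ) (a : ℝ) (s t : N) : Prop :=
  ∀ x, Γ.netOut f x = (if x = s then a else 0) - (if x = t then a else 0)

/-- `Γ` is `β`-embeddable into `Γ'`: there is a multicommodity flow in `Γ'`, with one commodity per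
edge `e` of `Γ`, routing `cap e` units between the ends of `e`, whose total absolute value on every
edge of `Γ'` is at most `β` times the capacity. -/
def Embeddable [Fintype E] [Fintype E'] (β : ℝ) (Γ : CapGraph N E) (Γ' : CapGraph N E') : Prop :=
  ∃ f : E → E' → ℝ,
    (∀ e, Γ'.Routes (f e) (Γ.cap e) (Γ.src e) (Γ.tgt e)) ∧
    ∀ e', ∑ e, |f e e'| ≤ β * (Γ'.cap e' : ℝ)

/-- `Γ` is a `j`-tree with the given forest edges and core nodes: a spanning forest, each of whose
trees has exactly one core node, together with a connected multigraph on the at most `j` core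
nodes. -/
structure IsJTree (Γ : CapGraph N E) (j : ℕ) (forest : Set E) (core : Finset N) : Prop where
  card_core_le : core.card ≤ j
  isForest : Γ.IsForest forest
  unique_core : ∀ x, ∃! p, p ∈ core ∧ (Γ.graphOn forest).Reachable x p
  core_edge : ∀ e, e ∉ forest → Γ.src e ∈ core ∧ Γ.tgt e ∈ core
  core_nonempty : core.Nonempty
  core_connected : ∀ p ∈ core, ∀ q ∈ core, (Γ.graphOn forestᶜ).Reachable p q

/-! ### Rooted spanning trees and the graph `H(T,F)` -/

/-- A rooted spanning tree of a multigraph, given by parent pointers and parent edges (the root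
is its own parent by convention). -/
structure SpanningTree (Γ : CapGraph N E) where
  root : N
  parent : N → N
  parentEdge : N → Option E
  parent_root : parent root = root
  parentEdge_root : parentEdge root = none
  parentEdge_spec : ∀ c, c ≠ root → ∃ e, parentEdge c = some e ∧
    ((Γ.src e = c ∧ Γ.tgt e = parent c) ∨ (Γ.src e = parent c ∧ Γ.tgt e = c))
  reaches_root : ∀ c, ∃ i, parent^[i] c = root

namespace SpanningTree

variable {Γ : CapGraph N E}

open Classical in
/-- The set of tree edges. -/
noncomputable def edges [Fintype E] (T : SpanningTree Γ) : Finset E :=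
  {e | T.parentEdge (Γ.src e) = some e ∨ T.parentEdge (Γ.tgt e) = some e}

open Classical in
/-- The child endpoint of a tree edge. -/
noncomputable def lower (T : SpanningTree Γ) (e : E) : N :=
  if T.parentEdge (Γ.src e) = some e then Γ.src e else Γ.tgt e

/-- The nodes of the subtree rooted at `c`. -/
def subtree (T : SpanningTree Γ) (c : N) : Set N := {x | ∃ i, T.parent^[i] x = c}

open Classical in
/-- `cap_T(e)` of a tree edge `e`: the total capacity of all edges of `Γ` with exactly one end in
the subtree below `e`, which is the load of `e` when every edge of `Γ` is routed along `T`. -/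
noncomputable def capT [Fintype E] (T : SpanningTree Γ) (e : E) : ℕ :=
  ∑ g with ¬ (Γ.src g ∈ T.subtree (T.lower e) ↔ Γ.tgt g ∈ T.subtree (T.lower e)), Γ.cap g

open Classical in
/-- Edge set of `H(T,F)`: the edges of `T \ F` and all edges between different components of the
forest `T \ F`. -/
noncomputable def edgesH [Fintype E] (T : SpanningTree Γ) (F : Finset E) : Finset E :=
  {e | (e ∈ T.edges ∧ e ∉ F) ∨
    ¬ (Γ.graphOn {g | g ∈ T.edges ∧ g ∉ F}).Reachable (Γ.src e) (Γ.tgt e)}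

open Classical in
/-- The graph `H(T,F)`. -/
noncomputable def graphH [Fintype E] (T : SpanningTree Γ) (F : Finset E) :
    CapGraph N {e // e ∈ T.edgesH F} where
  src e := Γ.src e
  tgt e := Γ.tgt e
  src_ne_tgt e := Γ.src_ne_tgt e
  cap e := if (e : E) ∈ T.edges ∧ (e : E) ∉ F then T.capT e else Γ.cap e

open Classical in
/-- Probability of `event R` when every tree edge `e` is put into `R` independently with
probability `q e`. -/
noncomputable def sampleProb [Fintype E] (T : SpanningTree Γ) (q : E → ℝ)
    (event : Finset E → Prop) : ℝ :=
  ∑ R ∈ T.edges.powerset with event R, (∏ e ∈ R, q e) * ∏ e ∈ T.edges \ R, (1 - q e)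

end SpanningTree

end CapGraph

/-! ### Distributed cluster graphs -/

/-- A weighted distributed cluster graph on the network `G`, with clusters indexed by `N`.  The
cluster tree of a cluster is given by parent pointers towards its leader (a leader is its own parent
by convention); `psi e` is the network edge that represents `e`, oriented as `e` is. -/
structure ClusterGraph {V : Type} (G : SimpleGraph V) (N E : Type) extends CapGraph N E where
  cluster : V → N
  leader : N → V
  cluster_leader : ∀ c, cluster (leader c) = c
  parent : V → V
  parent_leader : ∀ c, parent (leader c) = leader c
  parent_adj : ∀ v, v ≠ leader (cluster v) → G.Adj v (parent v)
  cluster_parent : ∀ v, cluster (parent v) = cluster v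
  reaches_leader : ∀ v, ∃ i, parent^[i] v = leader (cluster v)
  psi : E → V × V
  psi_adj : ∀ e, G.Adj (psi e).1 (psi e).2
  cluster_psi_fst : ∀ e, cluster (psi e).1 = src e
  cluster_psi_snd : ∀ e, cluster (psi e).2 = tgt e

/-- Every network edge represents at most one (multi)edge. -/
def EdgewiseInjective {V E : Type} (psi : E → V × V) : Prop :=
  ∀ e e', s((psi e).1, (psi e).2) = s((psi e').1, (psi e').2) → e = e'

open Classical in
/-- The edge represented by the network edge from `v` to its neighbour with identifier `x`. -/
noncomputable def edgeTowards {V E : Type} (psi : E → V × V) (ident : V → ℕ) (v : V) (x : ℕ) :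
    Option E :=
  if h : ∃ e w, ident w = x ∧ (psi e = (v, w) ∨ psi e = (w, v)) then some h.choose else none

/-- What a node knows about a weighted cluster graph: the identifier and the size of its cluster,
its parent in the cluster tree, and, for each neighbour (named by its identifier) such that the
network edge to it represents an edge of the cluster graph, the identifier of the cluster at the
other end and the capacity. -/
structure ClusterView where
  clusterId : ℕ
  clusterSize : ℕ
  parent : Option ℕ
  edge : ℕ → Option (ℕ × ℕ)

namespace ClusterGraph

variable {V N E : Type} {G : SimpleGraph V}

/-- All cluster trees have depth at most `d`. -/
def DepthLE (𝒢 : ClusterGraph G N E) (d : ℕ) : Prop :=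
  ∀ v, ∃ i ≤ d, 𝒢.parent^[i] v = 𝒢.leader (𝒢.cluster v)

open Classical in
/-- Number of network nodes in cluster `c`. -/
noncomputable def clusterSize [Fintype V] (𝒢 : ClusterGraph G N E) (c : N) : ℕ :=
  (Finset.univ.filter fun v => 𝒢.cluster v = c).card

/-- The identifier of a cluster is the identifier of its leader. -/
def clusterId (𝒢 : ClusterGraph G N E) (ident : V → ℕ) (c : N) : ℕ := ident (𝒢.leader c)

open Classical in
/-- The distributed representation of a weighted cluster graph at node `v`. -/
noncomputable def view [Fintype V] (𝒢 : ClusterGraph G N E) (ident : V → ℕ) (v : V) :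
    ClusterView where
  clusterId := 𝒢.clusterId ident (𝒢.cluster v)
  clusterSize := 𝒢.clusterSize (𝒢.cluster v)
  parent := if v = 𝒢.leader (𝒢.cluster v) then none else some (ident (𝒢.parent v))
  edge x := (edgeTowards 𝒢.psi ident v x).map fun e =>
    (𝒢.clusterId ident (if (𝒢.psi e).1 = v then 𝒢.tgt e else 𝒢.src e), 𝒢.cap e)

/-- The sampling probability `min {1, |c| / √n}` of the tree edge from `c` to its parent. -/
noncomputable def sampleRate [Fintype V] (𝒢 : ClusterGraph G N E)
    (T : 𝒢.toCapGraph.SpanningTree) (e : E) : ℝ :=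
  min 1 ((𝒢.clusterSize (T.lower e) : ℝ) / √(Fintype.card V : ℝ))

end ClusterGraph

/-! ### The CONGEST model -/

/-- A deterministic synchronous message passing algorithm.  Nodes address their neighbours by
identifier; a message is a natural number (its size is its binary length), `0` meaning silence.  A
node stops as soon as `output` of its state is defined. -/
structure CongestAlgorithm (In Out : Type) where
  State : Type
  start : In → State
  send : State → ℕ → ℕ
  receive : State → (ℕ → ℕ) → State
  output : State → Option Out

namespace CongestAlgorithm

variable {In Out V : Type}

/-- The message from `v` to `w` when the node states are `σ`; stopped nodes are silent. -/
def message (A : CongestAlgorithm In Out) (ident : V → ℕ) (σ : V → A.State) (v w : V) : ℕ :=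
  if (A.output (σ v)).isSome then 0 else A.send (σ v) (ident w)

open Classical in
/-- The messages arriving at `v`, indexed by the identifiers of the senders. -/
noncomputable def inbox (A : CongestAlgorithm In Out) (G : SimpleGraph V) (ident : V → ℕ)
    (σ : V → A.State) (v : V) (x : ℕ) : ℕ :=
  if h : ∃ w, G.Adj v w ∧ ident w = x then A.message ident σ h.choose v else 0

/-- One synchronous round; the state of a stopped node is final. -/
noncomputable def round (A : CongestAlgorithm In Out) (G : SimpleGraph V) (ident : V → ℕ)
    (σ : V → A.State) (v : V) : A.State :=
  if (A.output (σ v)).isSome then σ v else A.receive (σ v) (A.inbox G ident σ v)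

/-- The states after `t` rounds. -/
noncomputable def run (A : CongestAlgorithm In Out) (G : SimpleGraph V) (ident : V → ℕ)
    (input : V → In) (t : ℕ) : V → A.State :=
  (A.round G ident)^[t] fun v => A.start (input v)

/-- On this network and input, no message ever exceeds `b` bits. -/
def UsesBandwidth (A : CongestAlgorithm In Out) (G : SimpleGraph V) (ident : V → ℕ)
    (input : V → In) (b : ℕ) : Prop :=
  ∀ t v w, G.Adj v w → (A.message ident (A.run G ident input t) v w).size ≤ b

/-- After `t` rounds every node has stopped, with the prescribed output. -/
def Computes (A : CongestAlgorithm In Out) (G : SimpleGraph V) (ident : V → ℕ)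
    (input : V → In) (result : V → Out) (t : ℕ) : Prop :=
  ∀ v, A.output (A.run G ident input t v) = some (result v)

end CongestAlgorithm

/-! ### Input and output of the `j`-tree construction -/

/-- What an endpoint of the network edge representing a tree edge `e` knows about `e`: whether its
own cluster is the child, whether `e ∈ F`, and `cap_T(e)`. -/
structure TreeEdgeView where
  isChild : Bool
  inF : Bool
  capT : ℕ

/-- The initial knowledge of a node: its identifier, those of its neighbours, its view of the
cluster graph, and its view of `T`, `F` and `cap_T`, indexed by neighbours. -/
structure JTreeInput where
  id : ℕ
  nbrs : Finset ℕ
  clusters : ClusterView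
  tree : ℕ → Option TreeEdgeView

/-- What an endpoint of the network edge representing an edge `e` of `J` knows about `e`: the
identifiers of the two ends of `e` (clusters of the old cluster graph), the one on its own side
first, whether `e` is a forest or a core edge, and the capacity of `e` in `J`. -/
structure JEdgeView where
  near : ℕ
  far : ℕ
  isForest : Bool
  cap : ℕ

/-- The output of a node: its view of the new cluster graph and, indexed by neighbours, of the
edges of `J`. -/
structure JTreeOutput where
  clusters : ClusterView
  jEdge : ℕ → Option JEdgeView

open Classical in
/-- The distributed input `(𝒢, T, F)`. -/
noncomputable def jTreeInput {V N E : Type} [Fintype V] [Fintype E] {G : SimpleGraph V}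
    (𝒢 : ClusterGraph G N E) (ident : V → ℕ) (T : 𝒢.toCapGraph.SpanningTree) (F : Finset E)
    (v : V) : JTreeInput where
  id := ident v
  nbrs := (Finset.univ.filter fun w => G.Adj v w).image ident
  clusters := 𝒢.view ident v
  tree x := (edgeTowards 𝒢.psi ident v x).bind fun e =>
    if e ∈ T.edges then
      some ⟨decide (T.lower e = 𝒢.cluster v), decide (e ∈ F), T.capT e⟩
    else none

/-- A `j`-tree `J` on the clusters of `𝒢`, represented on the network `G`, together with the cluster
graph whose clusters are induced by the tree components of `J` (they are indexed by the core nodes)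
and whose edges are the core edges of `J`.  `phys e` is the network edge that represents the edge
`e` of `J`: it joins the ends of `e` if `e` is a forest edge, and the new clusters of the ends of `e`
if `e` is a core edge. -/
structure ClusteredJTree {V N E : Type} {G : SimpleGraph V} (𝒢 : ClusterGraph G N E)
    (j : ℕ) (EJ : Type) where
  J : CapGraph N EJ
  forest : Set EJ
  core : Finset N
  isJTree : J.IsJTree j forest core
  phys : EJ → V × V
  phys_adj : ∀ e, G.Adj (phys e).1 (phys e).2
  phys_injective : EdgewiseInjective phys
  phys_forest : ∀ e ∈ forest, 𝒢.cluster (phys e).1 = J.src e ∧ 𝒢.cluster (phys e).2 = J.tgt e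
  clusters : ClusterGraph G {p // p ∈ core} {e // e ∉ forest}
  clusters_induced : ∀ v, (J.graphOn forest).Reachable (𝒢.cluster v) (clusters.cluster v)
  clusters_src : ∀ e, (clusters.src e : N) = J.src e
  clusters_tgt : ∀ e, (clusters.tgt e : N) = J.tgt e
  clusters_cap : ∀ e, clusters.cap e = J.cap e
  clusters_psi : ∀ e, clusters.psi e = phys e

open Classical in
/-- The distributed representation of `J` and of its cluster graph at node `v`. -/
noncomputable def ClusteredJTree.output {V N E EJ : Type} [Fintype V] {G : SimpleGraph V}
    {𝒢 : ClusterGraph G N E} {j : ℕ} (X : ClusteredJTree 𝒢 j EJ) (ident : V → ℕ) (v : V) :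
    JTreeOutput where
  clusters := X.clusters.view ident v
  jEdge x := (edgeTowards X.phys ident v x).map fun e =>
    { near := 𝒢.clusterId ident (if (X.phys e).1 = v then X.J.src e else X.J.tgt e)
      far := 𝒢.clusterId ident (if (X.phys e).1 = v then X.J.tgt e else X.J.src e)
      isForest := decide (e ∈ X.forest)
      cap := X.J.cap e }

/-!
The proof has three independent ingredients: a `j`-tree that is built from `T` by local rules, a
constant number of broadcasts and convergecasts that evaluate these rules on the network, and a
union bound which shows that the forests that carry them are shallow.

**The `j`-tree.**  Deleting `F` splits `T` into rooted components.  In each component, a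
node is marked if it is, or lies above, the upper end of an edge of `F`.  The *portals* are the tops
of the components, the parents of deleted edges, and the nodes with at least two marked children;
double counting gives at most `3 |F| + 1` of them (`CutTree.card_portal_le`), which is at most `j`
because `4 |F| ≤ j` and `1 ≤ j`.  The marked tree edges decompose into *chains*, each leading from a
portal up to the next one.  In each chain the edge of least `cap_T` is cut, the lowest such edge in
case of a tie.  The resulting *pieces* contain exactly one portal each
(`CutTree.existsUnique_portal`).  The forest of the `j`-tree consists of the remaining tree edges,
with capacity `4 cap_T`; all other edges that join different pieces become core edges between the
portals of these pieces.

To compare the `j`-tree with `H(T,F)`, the ends of the core edges are moved to their portals along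
the tree.  The nodes that are separated from their portals by a given forest edge `g` lie in a region
that is bounded by `g` and at most one cut edge, and this cut edge is not heavier than `g`
(`CutTree.exists_region`).  So the edges that use `g` leave a set whose boundary has capacity at most
`cap_T(g)` plus `2 cap_T` of the cut edge, and the load is at most `3 cap_T(g)`
(`portal_load_le`).  This gives the embedding of `H(T,F)` with factor `1`
(`embeddable_graphH_jGraph`), and an embedding of the `j`-tree into `H(T,F)` with factor `4 + 3 + 1`
(`embeddable_jGraph_graphH`), where the last summand is the load of the tree paths between the ends of
the edges inside a component of `T \ F` (`tree_load`).

**The algorithm.**  A tree edge from a cluster to its parent in `T \ F` is attached to a node of the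
cluster, its *gate*.  Reversing the path from the gate to the leader in each such cluster turns the
cluster trees and the edges of `T \ F` into one rooted forest in `G` (`ClusterGraph.up`).  Without the
parent edges that represent cut edges, it consists of the trees of the new clusters
(`ClusterGraph.final`).  Convergecasts and broadcasts in these forests compute the numbers of marked
children, the minima of the chains, the cut edges, and the identifier, the size and the portal of each
new cluster: twelve numbers per node in total.  Each of them depends on numbers of the node and its
neighbours, so a generic algorithm suffices (`Protocol.algorithm`) in which every node repeatedly
announces all its numbers that are known.  It stops after a number of rounds that is linear in the
depth of the forests (`computes_jTreeProtocol`), and its messages are short because the numbers are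
polynomially bounded (`usesBandwidth_jTreeProtocol`).

**The depth.**  An upward path in the forest has at most `d` edges in its top cluster, and elsewhere
at most as many as there are network nodes in the clusters that it visits (`dist_up_le`).  Let
`L = (c + 1) √n log n`.  The edges of a path in `T` whose clusters have more than `L` nodes in total
all avoid `R` with probability at most `exp (-L / √n) = n ^ (-(c + 1))`, and a union bound over the at
most `n` starting clusters shows that with probability `1 - n ^ (-c)` there is no such path in `T \ R`
(`le_sampleProb_lightPaths`).  Since this event does not involve `F`, it serves all `F ⊇ R`.
-/

/-! ### Forests given by parent functions -/

namespace ParentForest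

open Relation

variable {α : Type}

/-- The parent function `f` is a rooted forest: every iteration ends in a fixed point.  The roots
are the fixed points. -/
def Grounded (f : α → α) : Prop := ∀ x, ∃ i, f (f^[i] x) = f^[i] x

/-- `x` lies in the subtree of `c`. -/
def Below (f : α → α) (x c : α) : Prop := ∃ i, f^[i] x = c

/-- Number of steps from `x` to its root. -/
noncomputable def dist (f : α → α) (x : α) : ℕ := sInf {i | f (f^[i] x) = f^[i] x}

/-- The root of the tree that contains `x`. -/
noncomputable def rootOf (f : α → α) (x : α) : α := f^[dist f x] x

variable {f : α → α}

theorem Below.refl (x : α) : Below f x x := ⟨0, rfl⟩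

theorem Below.head {x c : α} (h : Below f (f x) c) : Below f x c := by
  obtain ⟨i, hi⟩ := h
  exact ⟨i + 1, by simpa using hi⟩

theorem Below.trans {x y z : α} (h : Below f x y) (h' : Below f y z) : Below f x z := by
  obtain ⟨i, rfl⟩ := h
  obtain ⟨k, rfl⟩ := h'
  exact ⟨k + i, Function.iterate_add_apply f k i x⟩

theorem Below.step (x : α) : Below f x (f x) := ⟨1, rfl⟩

theorem below_iff {x c : α} : Below f x c ↔ x = c ∨ Below f (f x) c := by
  constructor
  · rintro ⟨i, hi⟩
    cases i with
    | zero => exact Or.inl hi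
    | succ i => exact Or.inr ⟨i, by simpa using hi⟩
  · rintro (rfl | h)
    · exact Below.refl _
    · exact h.head

theorem Below.total {x a b : α} (ha : Below f x a) (hb : Below f x b) :
    Below f a b ∨ Below f b a := by
  obtain ⟨i, rfl⟩ := ha
  obtain ⟨k, rfl⟩ := hb
  rcases le_total i k with h | h
  · refine Or.inl ⟨k - i, ?_⟩
    rw [← Function.iterate_add_apply, Nat.sub_add_cancel h]
  · refine Or.inr ⟨i - k, ?_⟩
    rw [← Function.iterate_add_apply, Nat.sub_add_cancel h]

theorem Below.eq_of_fixed {x c : α} (hx : f x = x) (h : Below f x c) : c = x := by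
  obtain ⟨i, rfl⟩ := h
  exact Function.iterate_fixed hx i

namespace Grounded

variable (hf : Grounded f)
include hf

theorem dist_spec (x : α) : f (f^[dist f x] x) = f^[dist f x] x := Nat.sInf_mem (hf x)

theorem fixed_rootOf (x : α) : f (rootOf f x) = rootOf f x := hf.dist_spec x

end Grounded

theorem dist_of_fixed {x : α} (hx : f x = x) : dist f x = 0 :=
  Nat.sInf_eq_zero.2 (Or.inl hx)

theorem rootOf_of_fixed {x : α} (hx : f x = x) : rootOf f x = x := by
  simp [rootOf, dist_of_fixed hx]

namespace Grounded

theorem dist_of_not_fixed (hf : Grounded f) {x : α} (hx : f x ≠ x) :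
    dist f x = dist f (f x) + 1 := by
  have h0 : dist f x ≠ 0 := by
    intro h
    have := hf.dist_spec x
    rw [h] at this
    exact hx this
  apply le_antisymm
  · refine Nat.sInf_le ?_
    have := hf.dist_spec (f x)
    simpa [Function.iterate_succ_apply] using this
  · have : dist f (f x) ≤ dist f x - 1 := by
      refine Nat.sInf_le ?_
      have h := hf.dist_spec x
      obtain ⟨m, hm⟩ := Nat.exists_eq_succ_of_ne_zero h0
      rw [hm] at h ⊢
      simpa [Function.iterate_succ_apply] using h
    omega

theorem rootOf_parent (hf : Grounded f) (x : α) : rootOf f (f x) = rootOf f x := by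
  by_cases hx : f x = x
  · rw [hx]
  · rw [rootOf, rootOf, hf.dist_of_not_fixed hx, Function.iterate_succ_apply]

/-- Induction from the roots downwards. -/
theorem induction (hf : Grounded f) {P : α → Prop} (h0 : ∀ x, f x = x → P x)
    (h1 : ∀ x, f x ≠ x → P (f x) → P x) (x : α) : P x := by
  induction h : dist f x generalizing x with
  | zero =>
    by_contra hx
    have : f x ≠ x := fun h' => hx (h0 x h')
    have := hf.dist_of_not_fixed this
    omega
  | succ n ih =>
    by_cases hx : f x = x
    · exact h0 x hx
    · have := hf.dist_of_not_fixed hx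
      exact h1 x hx (ih (f x) (by omega))

theorem below_rootOf (x : α) : Below f x (rootOf f x) := ⟨_, rfl⟩

theorem dist_le_of_below (hf : Grounded f) {x c : α} (h : Below f x c) :
    dist f c ≤ dist f x := by
  obtain ⟨i, rfl⟩ := h
  induction i generalizing x with
  | zero => rfl
  | succ i ih =>
    refine ih.trans ?_
    by_cases hx : f x = x
    · rw [hx]
    · have := hf.dist_of_not_fixed hx; omega

theorem below_antisymm (hf : Grounded f) {x y : α} (h : Below f x y) (h' : Below f y x) :
    x = y := by
  rcases below_iff.1 h with rfl | h
  · rfl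
  · by_cases hx : f x = x
    · rw [hx] at h
      exact (Below.eq_of_fixed hx h).symm
    · have h1 := hf.dist_of_not_fixed hx
      have h2 := hf.dist_le_of_below h
      have h3 := hf.dist_le_of_below h'
      omega

theorem not_parent_below (hf : Grounded f) {x : α} (hx : f x ≠ x) : ¬ Below f (f x) x :=
  fun h => hx (hf.below_antisymm h (Below.step x))

theorem rootOf_eq_of_below (hf : Grounded f) {x c : α} (h : Below f x c) :
    rootOf f x = rootOf f c := by
  obtain ⟨i, rfl⟩ := h
  induction i generalizing x with
  | zero => rfl
  | succ i ih => rw [Function.iterate_succ_apply, ← ih, hf.rootOf_parent]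

theorem below_fixed_iff (hf : Grounded f) {x c : α} (hc : f c = c) :
    Below f x c ↔ rootOf f x = c := by
  constructor
  · intro h
    rw [hf.rootOf_eq_of_below h, rootOf_of_fixed hc]
  · rintro rfl
    exact below_rootOf x

open Classical in
/-- An element below `v` is `v` itself or lies below exactly one child of `v`. -/
theorem indicator_below [Fintype α] (hf : Grounded f) (u v : α) :
    (if Below f u v then 1 else 0 : ℕ) =
      (if u = v then 1 else 0) + ∑ w with f w = v ∧ w ≠ v, if Below f u w then 1 else 0 := by
  revert u
  refine hf.induction ?_ ?_
  · intro u hu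
    have hz : ∀ w ∈ Finset.univ.filter (fun w => f w = v ∧ w ≠ v),
        (if Below f u w then 1 else 0 : ℕ) = 0 := by
      intro w hw
      have hw := (Finset.mem_filter.1 hw).2
      rw [if_neg]
      intro hb
      obtain rfl := Below.eq_of_fixed hu hb
      exact hw.2 (hu.symm.trans hw.1)
    rw [Finset.sum_eq_zero hz, add_zero]
    by_cases h : u = v
    · simp [h, Below.refl]
    · rw [if_neg h, if_neg]
      intro hb
      exact h (Below.eq_of_fixed hu hb).symm
  · intro u hu ih
    have key : ∀ w, (if Below f u w then 1 else 0 : ℕ) =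
        (if w = u then 1 else 0) + if Below f (f u) w then 1 else 0 := by
      intro w
      by_cases hw : w = u
      · subst hw
        simp [Below.refl, hf.not_parent_below hu]
      · have : Below f u w ↔ Below f (f u) w := by
          rw [below_iff]
          simp [Ne.symm hw]
        simp [this, hw]
    rw [key v, ih]
    simp only [key, Finset.sum_add_distrib]
    rw [Finset.sum_ite_eq']
    by_cases h : v = u
    · subst h
      simp [hu]
    · by_cases h2 : f u = v
      · have h3 : u ≠ v := Ne.symm h
        simp [h, h2, h3]
      · have h3 : u ≠ v := Ne.symm h
        simp [h, h2, h3]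

open Classical in
/-- Sum of `l` over the subtree of `v`. -/
noncomputable def subtreeSum [Fintype α] (f : α → α) (l : α → ℕ) (v : α) : ℕ :=
  ∑ u with Below f u v, l u

open Classical in
/-- The recursion that a convergecast evaluates. -/
theorem subtreeSum_eq [Fintype α] (hf : Grounded f) (l : α → ℕ) (v : α) :
    subtreeSum f l v = l v + ∑ w with f w = v ∧ w ≠ v, subtreeSum f l w := by
  have h1 : ∀ w, subtreeSum f l w = ∑ u, (if Below f u w then 1 else 0) * l u := by
    intro w
    simp [subtreeSum, Finset.sum_filter]
  simp only [h1]
  rw [Finset.sum_comm]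
  simp only [← Finset.sum_mul]
  have h2 : l v = ∑ u, (if u = v then 1 else 0) * l u := by simp
  rw [h2, ← Finset.sum_add_distrib]
  refine Finset.sum_congr rfl fun u _ => ?_
  rw [hf.indicator_below u v, add_mul]

open Classical in
theorem subtreeSum_of_fixed [Fintype α] (hf : Grounded f) (l : α → ℕ) {v : α} (hv : f v = v) :
    subtreeSum f l v = ∑ u with rootOf f u = v, l u := by
  simp only [subtreeSum, hf.below_fixed_iff hv]

theorem iterate_injOn (hf : Grounded f) (x : α) :
    Set.InjOn (fun k => f^[k] x) {k | k ≤ dist f x} := by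
  have key : ∀ k ≤ dist f x, dist f (f^[k] x) = dist f x - k := by
    intro k
    induction k with
    | zero => simp
    | succ k ih =>
      intro hk
      have h1 := ih (by omega)
      rw [Function.iterate_succ_apply']
      have : f (f^[k] x) ≠ f^[k] x := by
        intro h
        have := dist_of_fixed h
        omega
      have := hf.dist_of_not_fixed this
      omega
  intro a ha b hb hab
  have h1 := key a ha
  have h2 := key b hb
  simp only at hab
  rw [hab] at h1
  simp only [Set.mem_ofPred_eq] at ha hb
  omega

end Grounded

/-! ### The first ancestor with a given property -/

/-- The first element of `x, f x, f (f x), …` that satisfies `S`. -/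
noncomputable def firstIn (f : α → α) (S : α → Prop) (x : α) : α :=
  f^[sInf {i | S (f^[i] x)}] x

variable {S : α → Prop}

theorem firstIn_of_mem {x : α} (h : S x) : firstIn f S x = x := by
  have : sInf {i | S (f^[i] x)} = 0 := Nat.sInf_eq_zero.2 (Or.inl h)
  simp [firstIn, this]

theorem below_firstIn (x : α) : Below f x (firstIn f S x) := ⟨_, rfl⟩

theorem firstIn_mem (hS : ∀ x, ∃ i, S (f^[i] x)) (x : α) : S (firstIn f S x) :=
  Nat.sInf_mem (hS x)

theorem firstIn_of_not_mem (hS : ∀ x, ∃ i, S (f^[i] x)) {x : α} (h : ¬ S x) :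
    firstIn f S x = firstIn f S (f x) := by
  have h0 : sInf {i | S (f^[i] x)} ≠ 0 := by
    intro h'
    have := firstIn_mem hS x
    rw [firstIn, h'] at this
    exact h this
  have : sInf {i | S (f^[i] x)} = sInf {i | S (f^[i] (f x))} + 1 := by
    apply le_antisymm
    · refine Nat.sInf_le ?_
      have := firstIn_mem hS (f x)
      simpa [Function.iterate_succ_apply, firstIn] using this
    · have : sInf {i | S (f^[i] (f x))} ≤ sInf {i | S (f^[i] x)} - 1 := by
        refine Nat.sInf_le ?_
        have h := firstIn_mem hS x
        rw [firstIn] at h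
        obtain ⟨m, hm⟩ := Nat.exists_eq_succ_of_ne_zero h0
        rw [hm] at h ⊢
        simpa [Function.iterate_succ_apply] using h
      omega
  rw [firstIn, firstIn, this, Function.iterate_succ_apply]

end ParentForest

/-! ### Portals, chains and cuts in a rooted tree -/

/-- A rooted tree given by parent pointers, in which the edges above the nodes in `Top` are deleted
and the edge above `c` has weight `w c`. -/
structure CutTree (N : Type) where
  par : N → N
  root : N
  par_root : par root = root
  reaches : ∀ x, ∃ i, par^[i] x = root
  Top : N → Prop
  top_root : Top root
  w : N → ℕ

namespace CutTree

open ParentForest Relation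

variable {N : Type} (R : CutTree N)

theorem grounded : Grounded R.par := fun x => by
  obtain ⟨i, hi⟩ := R.reaches x
  exact ⟨i, by rw [hi, R.par_root]⟩

theorem fixed_iff {x : N} : R.par x = x ↔ x = R.root := by
  constructor
  · intro h
    obtain ⟨i, hi⟩ := R.reaches x
    rw [← hi, Function.iterate_fixed h]
  · rintro rfl
    exact R.par_root

/-- Upward path all of whose edges survive the deletion. -/
def TopPath : N → N → Prop := ReflTransGen fun x y => R.par x = y ∧ ¬ R.Top x

/-- The part of the component of `c` below `c` contains the parent of a deleted edge. -/
def Marked (c : N) : Prop := ∃ y, R.Top y ∧ y ≠ R.root ∧ R.TopPath (R.par y) c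

theorem TopPath.below {R : CutTree N} {x y : N} (h : R.TopPath x y) : Below R.par x y := by
  induction h with
  | refl => exact Below.refl _
  | tail _ h ih => exact ih.trans (h.1 ▸ Below.step _)

theorem Marked.parent {R : CutTree N} {x : N} (hx : R.Marked x) (hx' : ¬ R.Top x) :
    R.Marked (R.par x) := by
  obtain ⟨y, h1, h2, h3⟩ := hx
  exact ⟨y, h1, h2, h3.tail ⟨rfl, hx'⟩⟩

variable [Fintype N]

open Classical in
/-- The children of `c` whose parent edge is deleted. -/
noncomputable def cutChildren (c : N) : Finset N := {y | R.Top y ∧ y ≠ R.root ∧ R.par y = c}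

open Classical in
/-- The marked children of `c` in the component of `c`. -/
noncomputable def markedChildren (c : N) : Finset N := {y | ¬ R.Top y ∧ R.Marked y ∧ R.par y = c}

/-- Number of branches at `c`; a deleted edge counts twice, so that its parent becomes a portal. -/
noncomputable def cnt (c : N) : ℕ := 2 * (R.cutChildren c).card + (R.markedChildren c).card

/-- The nodes that become core nodes. -/
def Portal (c : N) : Prop := R.Top c ∨ 2 ≤ R.cnt c

/-- A portal that is not the top of its component; it is the lower end of a chain. -/
def LowPortal (p : N) : Prop := R.Portal p ∧ ¬ R.Top p

/-- Upward path that meets no portal after its start.  `Chain p` consists of the lower ends of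
the edges on the path from the portal `p` to the next portal above. -/
def Chain : N → N → Prop := ReflTransGen fun x y => R.par x = y ∧ ¬ R.Portal y

/-- The part of the chain of `c` up to `c`. -/
def low (c : N) : Set N := {x | ∃ p, R.LowPortal p ∧ R.Chain p x ∧ R.Chain x c}

/-- The least weight in the part of the chain of `c` up to `c`. -/
noncomputable def lowMin (c : N) : ℕ := sInf (R.w '' R.low c)

/-- The least weight in the chain of `c`. -/
noncomputable def chainMin (c : N) : ℕ :=
  sInf (R.w '' {x | ∃ p, R.LowPortal p ∧ R.Chain p x ∧ R.Chain p c})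

/-- The parent edge of `c` is the lowest edge of least weight in its chain. -/
def Cut (c : N) : Prop :=
  (∃ p, R.LowPortal p ∧ R.Chain p c) ∧ R.w c = R.chainMin c ∧
    ∀ x ∈ R.low c, x ≠ c → R.chainMin c < R.w x

variable {R}

theorem Chain.below {x y : N} (h : R.Chain x y) : Below R.par x y := by
  induction h with
  | refl => exact Below.refl _
  | tail _ h ih => exact ih.trans (h.1 ▸ Below.step _)

theorem Chain.total {p x y : N} (hx : R.Chain p x) (hy : R.Chain p y) :
    R.Chain x y ∨ R.Chain y x :=
  ReflTransGen.total_of_right_unique (fun _ _ _ h h' => h.1.symm.trans h'.1) hx hy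

theorem marked_iff {c : N} : R.Marked c ↔ 1 ≤ R.cnt c := by
  have h0 : 1 ≤ R.cnt c ↔ (R.cutChildren c).Nonempty ∨ (R.markedChildren c).Nonempty := by
    simp only [cnt, ← Finset.card_pos]
    omega
  rw [h0]
  constructor
  · rintro ⟨y, hy, hy', h⟩
    rcases ReflTransGen.cases_tail h with h | ⟨z, h, h'⟩
    · exact Or.inl ⟨y, by simp [cutChildren, hy, hy', h]⟩
    · exact Or.inr ⟨z, by simpa [markedChildren, h'] using ⟨y, hy, hy', h⟩⟩
  · rintro (⟨y, hy⟩ | ⟨y, hy⟩)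
    · obtain ⟨h1, h2, h3⟩ : R.Top y ∧ y ≠ R.root ∧ R.par y = c := by
        simpa [cutChildren] using hy
      exact ⟨y, h1, h2, h3 ▸ ReflTransGen.refl⟩
    · obtain ⟨h1, ⟨z, hz, hz', h⟩, h3⟩ : ¬ R.Top y ∧ R.Marked y ∧ R.par y = c := by
        simpa [markedChildren] using hy
      exact ⟨z, hz, hz', h.tail ⟨h3, h1⟩⟩

theorem cnt_le_one {c : N} (h : ¬ R.Portal c) : R.cnt c ≤ 1 := by
  by_contra h'
  exact h (Or.inr (by omega))

theorem portal_of_cut_child {y : N} (h : R.Top y) (hy : y ≠ R.root) : 2 ≤ R.cnt (R.par y) := by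
  have : 0 < (R.cutChildren (R.par y)).card :=
    Finset.card_pos.2 ⟨y, by simp [cutChildren, h, hy]⟩
  unfold cnt
  omega

theorem marked_child_unique {c x y : N} (hc : ¬ R.Portal c) (hx : R.par x = c) (hx' : ¬ R.Top x)
    (hxm : R.Marked x) (hy : R.par y = c) (hy' : ¬ R.Top y) (hym : R.Marked y) : x = y := by
  have h := cnt_le_one hc
  have : (R.markedChildren c).card ≤ 1 := by unfold cnt at h; omega
  exact Finset.card_le_one.1 this x (by simp [markedChildren, *]) y (by simp [markedChildren, *])

theorem LowPortal.marked {p : N} (hp : R.LowPortal p) : R.Marked p := by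
  rcases hp.1 with h | h
  · exact absurd h hp.2
  · exact marked_iff.2 (by omega)

theorem Chain.not_top_marked {p c : N} (hp : R.LowPortal p) (h : R.Chain p c) :
    ¬ R.Top c ∧ R.Marked c := by
  induction h with
  | refl => exact ⟨hp.2, hp.marked⟩
  | tail _ h ih => exact ⟨fun ht => h.2 (Or.inl ht), h.1 ▸ ih.2.parent ih.1⟩

/-- Every marked node whose parent edge survives lies on a chain. -/
theorem exists_chain {c : N} (hc : ¬ R.Top c) (hm : R.Marked c) :
    ∃ p, R.LowPortal p ∧ R.Chain p c := by
  obtain ⟨y, hy, hy', h⟩ := hm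
  induction h with
  | refl => exact ⟨_, ⟨Or.inr (portal_of_cut_child hy hy'), hc⟩, ReflTransGen.refl⟩
  | @tail b c _ h ih =>
    by_cases hp : R.Portal c
    · exact ⟨c, ⟨hp, hc⟩, ReflTransGen.refl⟩
    · obtain ⟨p, hp', hch⟩ := ih h.2
      exact ⟨p, hp', hch.tail ⟨h.1, hp⟩⟩

/-- The chains are disjoint: a node that is not a portal has at most one marked child. -/
theorem chain_start_unique {p p' c : N} (hp : R.LowPortal p) (hp' : R.LowPortal p')
    (h : R.Chain p c) (h' : R.Chain p' c) : p = p' := by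
  induction h with
  | refl =>
    rcases ReflTransGen.cases_tail h' with h | ⟨z, _, h⟩
    · exact h
    · exact absurd hp.1 h.2
  | tail h h1 ih =>
    rcases ReflTransGen.cases_tail h' with h2 | ⟨z, h2, h3⟩
    · exact absurd (h2 ▸ hp'.1) h1.2
    · have a := Chain.not_top_marked hp h
      have b := Chain.not_top_marked hp' h2
      have : z = _ := marked_child_unique h1.2 h3.1 b.1 b.2 h1.1 a.1 a.2
      exact ih (this ▸ h2)

theorem low_eq {p c : N} (hp : R.LowPortal p) (h : R.Chain p c) :
    R.low c = {x | R.Chain p x ∧ R.Chain x c} := by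
  ext x
  constructor
  · rintro ⟨p', hp', h1, h2⟩
    obtain rfl := chain_start_unique hp hp' h (h1.trans h2)
    exact ⟨h1, h2⟩
  · rintro ⟨h1, h2⟩
    exact ⟨p, hp, h1, h2⟩

theorem chainMin_eq {p c : N} (hp : R.LowPortal p) (h : R.Chain p c) :
    R.chainMin c = sInf (R.w '' {x | R.Chain p x}) := by
  unfold chainMin
  congr 2
  ext x
  constructor
  · rintro ⟨p', hp', h1, h2⟩
    obtain rfl := chain_start_unique hp hp' h h2
    exact h1
  · intro h1
    exact ⟨p, hp, h1, h⟩

theorem chainMin_le {p c x : N} (hp : R.LowPortal p) (h : R.Chain p c) (hx : R.Chain p x) :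
    R.chainMin c ≤ R.w x := by
  rw [chainMin_eq hp h]
  exact Nat.sInf_le ⟨x, hx, rfl⟩

theorem Cut.not_top {c : N} (h : R.Cut c) : ¬ R.Top c := by
  obtain ⟨⟨p, hp, hc⟩, -⟩ := h
  exact (hc.not_top_marked hp).1

theorem Cut.marked {c : N} (h : R.Cut c) : R.Marked c := by
  obtain ⟨⟨p, hp, hc⟩, -⟩ := h
  exact (hc.not_top_marked hp).2

theorem exists_cut {p : N} (hp : R.LowPortal p) : ∃ c, R.Chain p c ∧ R.Cut c := by
  have hD : ∀ {c}, R.Chain p c → R.chainMin c = R.chainMin p := fun h => by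
    rw [chainMin_eq hp h, chainMin_eq hp ReflTransGen.refl]
  -- going up the chain, all weights exceed the minimum until a cut edge is met
  have key : ∀ c, R.Chain p c → (∃ x, R.Chain p x ∧ R.Cut x) ∨
      ∀ x, R.Chain p x → R.Chain x c → R.chainMin p < R.w x := by
    intro c h
    have step : ∀ c, R.Chain p c → (∀ x, R.Chain p x → R.Chain x c → x ≠ c →
        R.chainMin p < R.w x) → (∃ x, R.Chain p x ∧ R.Cut x) ∨
        ∀ x, R.Chain p x → R.Chain x c → R.chainMin p < R.w x := by
      intro c h hlt
      by_cases hc : R.w c = R.chainMin p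
      · refine Or.inl ⟨c, h, ⟨p, hp, h⟩, hc.trans (hD h).symm, ?_⟩
        intro x hx hxc
        rw [low_eq hp h] at hx
        rw [hD h]
        exact hlt x hx.1 hx.2 hxc
      · refine Or.inr fun x h1 h2 => ?_
        by_cases hxc : x = c
        · subst hxc
          have := chainMin_le hp ReflTransGen.refl h
          omega
        · exact hlt x h1 h2 hxc
    induction h with
    | refl =>
      refine step p ReflTransGen.refl fun x h1 h2 hne => absurd ?_ hne
      exact R.grounded.below_antisymm h2.below h1.below
    | @tail b c h h1 ih =>
      rcases ih with ih | ih
      · exact Or.inl ih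
      · refine step c (h.tail h1) fun x h2 h3 hne => ?_
        rcases ReflTransGen.cases_tail h3 with h4 | ⟨z, h4, h5⟩
        · exact absurd h4.symm hne
        · have a := Chain.not_top_marked hp (h2.trans h4)
          have b' := Chain.not_top_marked hp h
          obtain rfl := marked_child_unique h1.2 h5.1 a.1 a.2 h1.1 b'.1 b'.2
          exact ih x h2 h4
  have hne : (R.w '' {x | R.Chain p x}).Nonempty := ⟨_, p, ReflTransGen.refl, rfl⟩
  obtain ⟨c, hc, hcw⟩ := Nat.sInf_mem hne
  rcases key c hc with h | h
  · exact h
  · have := h c hc ReflTransGen.refl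
    rw [chainMin_eq hp ReflTransGen.refl] at this
    omega

theorem cut_unique {p c c' : N} (hp : R.LowPortal p) (h : R.Chain p c) (h' : R.Chain p c')
    (hc : R.Cut c) (hc' : R.Cut c') : c = c' := by
  by_contra hne
  have hD : R.chainMin c = R.chainMin c' := by rw [chainMin_eq hp h, chainMin_eq hp h']
  rcases Chain.total h h' with h1 | h1
  · have := hc'.2.2 c ⟨p, hp, h, h1⟩ hne
    have := hc.2.1
    omega
  · have := hc.2.2 c' ⟨p, hp, h', h1⟩ (Ne.symm hne)
    have := hc'.2.1
    omega

variable (R) in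
/-- The nodes whose parent edge is deleted or cut: the tops of the pieces. -/
def PieceTop (c : N) : Prop := R.Top c ∨ R.Cut c

variable (R) in
/-- The top of the piece that contains `x`. -/
noncomputable def pieceTop (x : N) : N := firstIn R.par R.PieceTop x

theorem exists_pieceTop (x : N) : ∃ i, R.PieceTop (R.par^[i] x) := by
  obtain ⟨i, hi⟩ := R.reaches x
  exact ⟨i, by rw [hi]; exact Or.inl R.top_root⟩

theorem pieceTop_mem (x : N) : R.PieceTop (R.pieceTop x) := firstIn_mem exists_pieceTop x

theorem below_pieceTop (x : N) : Below R.par x (R.pieceTop x) := below_firstIn x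

theorem pieceTop_of_mem {x : N} (h : R.PieceTop x) : R.pieceTop x = x := firstIn_of_mem h

theorem pieceTop_of_not_mem {x : N} (h : ¬ R.PieceTop x) : R.pieceTop x = R.pieceTop (R.par x) :=
  firstIn_of_not_mem exists_pieceTop h

theorem pieceTop_of_chain {p x c : N} (hp : R.LowPortal p) (hx : R.Chain p x) (hxc : R.Chain x c)
    (hc : R.Cut c) : R.pieceTop x = c := by
  induction hxc using ReflTransGen.head_induction_on with
  | refl => exact pieceTop_of_mem (Or.inr hc)
  | @head a y hay hyc ih =>
    rw [pieceTop_of_not_mem]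
    · rw [hay.1]
      exact ih (hx.tail hay)
    · rintro (h | h)
      · exact (hx.not_top_marked hp).1 h
      · have hp' := hx.tail hay
        obtain rfl := cut_unique hp hx (hp'.trans hyc) h hc
        have : R.par a ≠ a := fun h' => by
          rw [R.fixed_iff] at h'
          exact h.not_top (h' ▸ R.top_root)
        exact R.grounded.not_parent_below this (hay.1 ▸ Chain.below hyc)

/-- Every piece contains exactly one portal: a piece whose parent edge is deleted contains its
top, and a piece whose parent edge was cut contains the lower end of the cut chain. -/
theorem existsUnique_portal (x : N) : ∃! p, R.Portal p ∧ R.pieceTop p = R.pieceTop x := by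
  have hlow : ∀ p, R.LowPortal p → R.Cut (R.pieceTop p) ∧ R.Chain p (R.pieceTop p) := by
    intro p hp
    obtain ⟨c, h, hc⟩ := exists_cut hp
    rw [pieceTop_of_chain hp ReflTransGen.refl h hc]
    exact ⟨hc, h⟩
  have htop : ∀ p, R.Top p → R.pieceTop p = p := fun p h => pieceTop_of_mem (Or.inl h)
  apply existsUnique_of_exists_of_unique
  · rcases pieceTop_mem (R := R) x with h | h
    · exact ⟨_, Or.inl h, htop _ h⟩
    · obtain ⟨p, hp, hch⟩ := h.1
      exact ⟨p, hp.1, pieceTop_of_chain hp ReflTransGen.refl hch h⟩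
  · rintro p p' ⟨h1, h2⟩ ⟨h3, h4⟩
    by_cases ht : R.Top p <;> by_cases ht' : R.Top p'
    · rw [← htop p ht, h2, ← h4, htop p' ht']
    · have := (hlow p' ⟨h3, ht'⟩).1.not_top
      rw [h4, ← h2, htop p ht] at this
      exact absurd ht this
    · have := (hlow p ⟨h1, ht⟩).1.not_top
      rw [h2, ← h4, htop p' ht'] at this
      exact absurd ht' this
    · have a := (hlow p ⟨h1, ht⟩).2
      have b := (hlow p' ⟨h3, ht'⟩).2
      rw [h2] at a
      rw [h4] at b
      exact chain_start_unique ⟨h1, ht⟩ ⟨h3, ht'⟩ a b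

variable (R) in
/-- The portal in the piece of `x`. -/
noncomputable def portal (x : N) : N := (R.existsUnique_portal x).choose

theorem portal_mem (x : N) : R.Portal (R.portal x) := (R.existsUnique_portal x).choose_spec.1.1

theorem pieceTop_portal (x : N) : R.pieceTop (R.portal x) = R.pieceTop x :=
  (R.existsUnique_portal x).choose_spec.1.2

theorem portal_eq {x p : N} (hp : R.Portal p) (h : R.pieceTop p = R.pieceTop x) :
    R.portal x = p :=
  (R.existsUnique_portal x).unique ⟨portal_mem x, pieceTop_portal x⟩ ⟨hp, h⟩

theorem portal_eq_iff {x y : N} : R.portal x = R.portal y ↔ R.pieceTop x = R.pieceTop y := by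
  constructor
  · intro h
    rw [← pieceTop_portal x, h, pieceTop_portal]
  · intro h
    exact portal_eq (portal_mem y) ((pieceTop_portal y).trans h.symm)

theorem portal_of_portal {p : N} (hp : R.Portal p) : R.portal p = p := portal_eq hp rfl

/-! ### Regions of a piece separated from the portal -/

/-- Within a piece the upward path avoids the deleted edges. -/
theorem topPath_of_pieceTop {x c : N} (h : Below R.par x c) (ht : R.pieceTop x = R.pieceTop c) :
    R.TopPath x c := by
  revert h ht
  refine R.grounded.induction (P := fun x => Below R.par x c → R.pieceTop x = R.pieceTop c →
    R.TopPath x c) ?_ ?_ x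
  · intro x hx h _
    rw [Below.eq_of_fixed hx h]
    exact ReflTransGen.refl
  · intro x hx ih h ht
    rcases below_iff.1 h with rfl | h1
    · exact ReflTransGen.refl
    · by_cases hp : R.PieceTop x
      · rw [pieceTop_of_mem hp] at ht
        have : Below R.par c x := ht ▸ below_pieceTop c
        rw [R.grounded.below_antisymm h this]
        exact ReflTransGen.refl
      · rw [pieceTop_of_not_mem hp] at ht
        exact (ih h1 ht).head ⟨rfl, fun h => hp (Or.inl h)⟩

theorem pieceTop_eq_of_between {y c : N} (h : Below R.par y c)
    (hc : Below R.par c (R.pieceTop y)) : R.pieceTop c = R.pieceTop y := by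
  revert h hc
  refine R.grounded.induction (P := fun y => Below R.par y c → Below R.par c (R.pieceTop y) →
    R.pieceTop c = R.pieceTop y) ?_ ?_ y
  · intro x hx h _
    rw [Below.eq_of_fixed hx h]
  · intro x hx ih h ht
    by_cases hp : R.PieceTop x
    · rw [pieceTop_of_mem hp] at ht
      rw [R.grounded.below_antisymm h ht]
    · rcases below_iff.1 h with rfl | h1
      · rfl
      · rw [pieceTop_of_not_mem hp] at ht ⊢
        exact ih h1 ht

theorem pieceTop_mono {x t : N} (h : Below R.par x t) (ht : R.PieceTop t) :
    Below R.par (R.pieceTop x) t := by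
  rcases (below_pieceTop x).total h with h1 | h1
  · exact h1
  · have := pieceTop_eq_of_between h h1
    rw [pieceTop_of_mem ht] at this
    exact this ▸ Below.refl _

/-- An edge that separates two nodes of one piece belongs to that piece. -/
theorem pieceTop_of_separated {c y z : N} (hy : Below R.par y c) (hz : ¬ Below R.par z c)
    (h : R.pieceTop y = R.pieceTop z) : R.pieceTop c = R.pieceTop y := by
  rcases hy.total (below_pieceTop y) with h1 | h1
  · exact pieceTop_eq_of_between hy h1
  · exact absurd ((h ▸ below_pieceTop z).trans h1) hz

/-- Nodes in one piece are not separated by a deleted or cut edge. -/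
theorem below_iff_of_pieceTop {c x y : N} (hc : R.PieceTop c) (h : R.pieceTop x = R.pieceTop y) :
    Below R.par x c ↔ Below R.par y c := by
  have key : ∀ {x y}, R.pieceTop x = R.pieceTop y → Below R.par x c → Below R.par y c := by
    intro x y h hx
    by_contra hy
    have := pieceTop_of_separated hx hy h
    rw [pieceTop_of_mem hc] at this
    exact hy (this ▸ h ▸ below_pieceTop y)
  exact ⟨key h, key h.symm⟩

/-- A marked node below a chain lies below the start of the chain or on the chain. -/
theorem descend {p u z : N} (hp : R.LowPortal p) (hu : R.Chain p u) (hz : R.Marked z)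
    (h : R.TopPath z u) : Below R.par z p ∨ (R.Chain p z ∧ R.Chain z u) := by
  induction hu generalizing z with
  | refl => exact Or.inl h.below
  | @tail b u hb hbu ih =>
    rcases ReflTransGen.cases_tail h with h1 | ⟨y, h1, h2⟩
    · subst h1
      exact Or.inr ⟨hb.tail hbu, ReflTransGen.refl⟩
    · have hym : R.Marked y := by
        obtain ⟨q, h3, h4, h5⟩ := hz
        exact ⟨q, h3, h4, h5.trans h1⟩
      have a := Chain.not_top_marked hp hb
      obtain rfl := marked_child_unique hbu.2 h2.1 h2.2 hym hbu.1 a.1 a.2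
      rcases ih hz h1 with h3 | ⟨h3, h4⟩
      · exact Or.inl h3
      · exact Or.inr ⟨h3, h4.tail hbu⟩

/-- Between two nodes of a chain that enclose no further cut there is only one piece. -/
theorem pieceTop_of_region {p l u t : N} (hp : R.LowPortal p) (hl : R.Chain p l)
    (hlu : R.Chain l u) (hcut : ∀ r, R.Chain l r → R.Chain r u → R.Cut r → r = l ∨ r = u)
    (htu : Below R.par t u) (htl : ¬ Below R.par t l) : R.pieceTop t = R.pieceTop u := by
  revert htu htl
  refine R.grounded.induction (P := fun t => Below R.par t u → ¬ Below R.par t l →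
    R.pieceTop t = R.pieceTop u) ?_ ?_ t
  · intro x hx h _
    rw [Below.eq_of_fixed hx h]
  · intro t ht ih htu htl
    rcases below_iff.1 htu with rfl | h1
    · rfl
    have ih := ih h1 fun h => htl h.head
    by_cases htQ : R.PieceTop t
    · exfalso
      have hpath := topPath_of_pieceTop h1 ih
      have hpu := hl.trans hlu
      rcases htQ with hT | hC
      · have hroot : t ≠ R.root := fun h => ht (R.fixed_iff.2 h)
        have hpt := portal_of_cut_child hT hroot
        rcases descend hp hpu ⟨t, hT, hroot, ReflTransGen.refl⟩ hpath with h | ⟨h, _⟩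
        · exact htl ((h.trans hl.below).head)
        · rcases ReflTransGen.cases_tail h with h2 | ⟨z, _, h2⟩
          · exact htl (Below.trans (h2 ▸ Below.step t) hl.below)
          · exact h2.2 (Or.inr hpt)
      · have hpath' : R.TopPath t u := hpath.head ⟨rfl, hC.not_top⟩
        rcases descend hp hpu hC.marked hpath' with h | ⟨h, h'⟩
        · exact htl (h.trans hl.below)
        · rcases Chain.total hl h with h2 | h2
          · rcases hcut t h2 h' hC with rfl | rfl
            · exact htl (Below.refl _)
            · exact R.grounded.not_parent_below ht h1
          · exact htl h2.below
    · rw [pieceTop_of_not_mem htQ, ih]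

/-- Below an unmarked node no edge is deleted or cut. -/
theorem pieceTop_of_unmarked {c t : N} (hc : ¬ R.Marked c) (h : Below R.par t c) :
    R.pieceTop t = R.pieceTop c := by
  revert h
  refine R.grounded.induction (P := fun t => Below R.par t c → R.pieceTop t = R.pieceTop c)
    ?_ ?_ t
  · intro x hx h
    rw [Below.eq_of_fixed hx h]
  · intro t ht ih h
    rcases below_iff.1 h with rfl | h1
    · rfl
    have ih := ih h1
    have hpath := topPath_of_pieceTop h1 ih
    rw [pieceTop_of_not_mem, ih]
    rintro (hT | hC)
    · exact hc ⟨t, hT, fun h => ht (R.fixed_iff.2 h), hpath⟩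
    · obtain ⟨y, h2, h3, h4⟩ := hC.marked
      exact hc ⟨y, h2, h3, (h4.tail ⟨rfl, hC.not_top⟩).trans hpath⟩

/-- The nodes `x` that a surviving edge, above `c`, separates from their portals all lie in a set
that belongs to a single piece and is delimited by this edge and at most one cut edge, which is not
heavier. -/
theorem exists_region {c : N} (hc : ¬ R.PieceTop c) : ∃ S : Set N,
    (∀ x ∈ S, R.pieceTop x = R.pieceTop c) ∧
    (∀ x, ¬ (Below R.par x c ↔ Below R.par (R.portal x) c) → x ∈ S) ∧
    (S = {x | Below R.par x c} ∨
      ∃ b, R.Cut b ∧ R.w b ≤ R.w c ∧ S = {x | ¬ (Below R.par x c ↔ Below R.par x b)}) := by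
  have hcT : ¬ R.Top c := fun h => hc (Or.inl h)
  -- an edge that separates `x` from its portal belongs to their common piece
  have hsep : ∀ x, ¬ (Below R.par x c ↔ Below R.par (R.portal x) c) →
      R.pieceTop c = R.pieceTop x := by
    intro x hx
    by_cases h : Below R.par x c
    · exact pieceTop_of_separated h (fun h' => hx (by simp [h, h'])) (pieceTop_portal x).symm
    · have h' : Below R.par (R.portal x) c := by
        by_contra h'
        exact hx (by simp [h, h'])
      rw [pieceTop_of_separated h' h (pieceTop_portal x), pieceTop_portal]
  -- a portal below `c` in the piece of `c` makes `c` marked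
  have hport : ∀ q, R.Portal q → Below R.par q c → R.pieceTop q = R.pieceTop c →
      R.LowPortal q ∧ R.TopPath q c := by
    intro q hq hqc hqt
    have hpath := topPath_of_pieceTop hqc hqt
    refine ⟨⟨hq, fun hT => ?_⟩, hpath⟩
    rw [pieceTop_of_mem (Or.inl hT)] at hqt
    have := R.grounded.below_antisymm hqc (hqt ▸ below_pieceTop c)
    exact hcT (this ▸ hT)
  by_cases hm : R.Marked c
  · obtain ⟨p, hp, hpc⟩ := exists_chain hcT hm
    obtain ⟨b, hpb, hb⟩ := exists_cut hp
    have hw : R.w b ≤ R.w c := by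
      rw [hb.2.1]
      exact chainMin_le hp hpb hpc
    have hne : b ≠ c := fun h => hc (Or.inr (h ▸ hb))
    have honly : ∀ r, R.Chain p r → R.Cut r → r = b := fun r h1 h2 => cut_unique hp h1 hpb h2 hb
    refine ⟨_, ?_, ?_, Or.inr ⟨b, hb, hw, rfl⟩⟩
    · intro x hx
      rcases Chain.total hpc hpb with hcb | hbc
      · have hx' : Below R.par x b ∧ ¬ Below R.par x c := by
          have : Below R.par x c → Below R.par x b := fun h => h.trans hcb.below
          simp only [Set.mem_ofPred_eq] at hx
          tauto
        rw [pieceTop_of_region hp hpc hcb (fun r h1 _ h3 => Or.inr (honly r (hpc.trans h1) h3))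
          hx'.1 hx'.2, pieceTop_of_chain hp hpc hcb hb, pieceTop_of_mem (Or.inr hb)]
      · have hx' : Below R.par x c ∧ ¬ Below R.par x b := by
          have : Below R.par x b → Below R.par x c := fun h => h.trans hbc.below
          simp only [Set.mem_ofPred_eq] at hx
          tauto
        exact pieceTop_of_region hp hpb hbc
          (fun r h1 _ h3 => Or.inl (honly r (hpb.trans h1) h3)) hx'.1 hx'.2
    · intro x hx
      have ht := hsep x hx
      rcases Chain.total hpc hpb with hcb | hbc
      · have h1 := pieceTop_of_chain hp hpc hcb hb
        have h2 := pieceTop_of_chain hp ReflTransGen.refl (hpc.trans hcb) hb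
        have h3 : R.portal x = p := portal_eq hp.1 (by rw [h2, ← ht, h1])
        rw [h3] at hx
        have h4 : Below R.par x b := by
          rw [← h1, ht]
          exact below_pieceTop x
        have := hpc.below
        simp only [Set.mem_ofPred_eq]
        tauto
      · have hnb : ∀ y, R.pieceTop y = R.pieceTop c → ¬ Below R.par y b := by
          intro y hy hyb
          have h1 := pieceTop_mono hyb (Or.inr hb)
          rw [hy] at h1
          exact hne (R.grounded.below_antisymm hbc.below ((below_pieceTop c).trans h1))
        have hq : ¬ Below R.par (R.portal x) c := by
          intro hq
          have hqt : R.pieceTop (R.portal x) = R.pieceTop c := (pieceTop_portal x).trans ht.symm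
          obtain ⟨h1, h2⟩ := hport _ (portal_mem x) hq hqt
          rcases descend hp hpc h1.marked h2 with h3 | ⟨h3, _⟩
          · exact hnb _ hqt (h3.trans hpb.below)
          · rcases ReflTransGen.cases_tail h3 with h4 | ⟨z, _, h4⟩
            · exact hnb _ hqt (h4 ▸ hpb.below)
            · exact h4.2 h1.1
        have := hnb x ht.symm
        simp only [Set.mem_ofPred_eq]
        tauto
  · refine ⟨{x | Below R.par x c}, fun x hx => pieceTop_of_unmarked hm hx, fun x hx => ?_,
      Or.inl rfl⟩
    have ht := hsep x hx
    have hq : ¬ Below R.par (R.portal x) c := by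
      intro hq
      obtain ⟨h1, h2⟩ := hport _ (portal_mem x) hq ((pieceTop_portal x).trans ht.symm)
      obtain ⟨y, h3, h4, h5⟩ := h1.marked
      exact hm ⟨y, h3, h4, h5.trans h2⟩
    simp only [Set.mem_ofPred_eq]
    tauto

open Classical in
/-- Double counting of the branches: the portals are at most three times as many as the deleted
edges, plus one. -/
theorem card_portal_le :
    (Finset.univ.filter R.Portal).card ≤
      3 * (Finset.univ.filter fun y => R.Top y ∧ y ≠ R.root).card + 1 := by
  set Fc := Finset.univ.filter fun y => R.Top y ∧ y ≠ R.root
  set Mk := Finset.univ.filter fun y => ¬ R.Top y ∧ R.Marked y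
  set Lp := Finset.univ.filter fun y => R.LowPortal y
  have h1 : ∑ c, R.cnt c = 2 * Fc.card + Mk.card := by
    have a : Fc.card = ∑ c, (R.cutChildren c).card := by
      rw [Finset.card_eq_sum_card_fiberwise (f := R.par) (t := Finset.univ) (by simp)]
      refine Finset.sum_congr rfl fun c _ => ?_
      congr 1
      ext y
      simp [Fc, cutChildren, and_assoc]
    have b : Mk.card = ∑ c, (R.markedChildren c).card := by
      rw [Finset.card_eq_sum_card_fiberwise (f := R.par) (t := Finset.univ) (by simp)]
      refine Finset.sum_congr rfl fun c _ => ?_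
      congr 1
      ext y
      simp [Mk, markedChildren, and_assoc]
    rw [a, b, Finset.mul_sum, ← Finset.sum_add_distrib]
    rfl
  have h2 : Mk.card + Lp.card ≤ ∑ c, R.cnt c := by
    rw [Finset.card_filter, Finset.card_filter, ← Finset.sum_add_distrib]
    refine Finset.sum_le_sum fun c _ => ?_
    by_cases hT : R.Top c
    · simp [hT, LowPortal]
    · have hm := marked_iff (R := R) (c := c)
      by_cases hc : 2 ≤ R.cnt c
      · split_ifs <;> omega
      · have : ¬ R.LowPortal c := fun h => by
          rcases h.1 with h | h
          · exact hT h
          · exact hc h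
        simp only [this, if_false, hm]
        split_ifs <;> omega
  have h3 : Finset.univ.filter R.Portal ⊆ insert R.root (Fc ∪ Lp) := by
    intro p hp
    have hp := (Finset.mem_filter.1 hp).2
    by_cases h : p = R.root
    · simp [h]
    · by_cases hT : R.Top p
      · simp [Fc, h, hT]
      · have hl : p ∈ Lp := Finset.mem_filter.2 ⟨Finset.mem_univ _, hp, hT⟩
        simp [hl]
  have h4 := (Finset.card_le_card h3).trans (Finset.card_insert_le _ _)
  have h5 := Finset.card_union_le Fc Lp
  omega

/-! ### Recursions for the chain minima -/

theorem lowMin_of_portal {c : N} (h : R.LowPortal c) : R.lowMin c = R.w c := by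
  have : R.low c = {c} := by
    ext x
    rw [low_eq h ReflTransGen.refl]
    constructor
    · rintro ⟨h1, h2⟩
      exact R.grounded.below_antisymm h2.below h1.below
    · rintro rfl
      exact ⟨ReflTransGen.refl, ReflTransGen.refl⟩
  simp [lowMin, this]

theorem mem_low_self {c : N} (h : ¬ R.Top c) (hm : R.Marked c) : c ∈ R.low c := by
  obtain ⟨p, hp, hc⟩ := exists_chain h hm
  exact ⟨p, hp, hc, ReflTransGen.refl⟩

theorem low_parent {c : N} (h : ¬ R.Top c) (hm : R.Marked c) (hp : ¬ R.Portal (R.par c)) :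
    R.low (R.par c) = insert (R.par c) (R.low c) := by
  obtain ⟨p, hpp, hpc⟩ := exists_chain h hm
  have hpc' : R.Chain p (R.par c) := hpc.tail ⟨rfl, hp⟩
  rw [low_eq hpp hpc, low_eq hpp hpc']
  ext x
  constructor
  · rintro ⟨h1, h2⟩
    rcases ReflTransGen.cases_tail h2 with h3 | ⟨z, h3, h4⟩
    · exact Or.inl h3.symm
    · have a := Chain.not_top_marked hpp (h1.trans h3)
      obtain rfl := marked_child_unique hp h4.1 a.1 a.2 rfl h hm
      exact Or.inr ⟨h1, h3⟩
  · rintro (rfl | ⟨h1, h2⟩)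
    · exact ⟨hpc', ReflTransGen.refl⟩
    · exact ⟨h1, h2.tail ⟨rfl, hp⟩⟩

/-- Together with `lowMin_of_portal`, this computes the minima up to each node from the bottom of a
chain to its top. -/
theorem lowMin_parent {c : N} (h : ¬ R.Top c) (hm : R.Marked c) (hp : ¬ R.Portal (R.par c)) :
    R.lowMin (R.par c) = min (R.lowMin c) (R.w (R.par c)) := by
  rw [lowMin, low_parent h hm hp, Set.image_insert_eq, csInf_insert (OrderBot.bddBelow _)
    (Set.Nonempty.image _ ⟨c, mem_low_self h hm⟩), min_comm]
  rfl

theorem chainMin_of_portal {c : N} (h : ¬ R.Top c) (hm : R.Marked c) (hp : R.Portal (R.par c)) :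
    R.chainMin c = R.lowMin c := by
  obtain ⟨p, hpp, hpc⟩ := exists_chain h hm
  rw [chainMin_eq hpp hpc, lowMin, low_eq hpp hpc]
  congr 2
  ext x
  refine ⟨fun hx => ⟨hx, ?_⟩, fun hx => hx.1⟩
  rcases Chain.total hpc hx with h1 | h1
  · rcases ReflTransGen.cases_head h1 with rfl | ⟨y, h2, _⟩
    · exact ReflTransGen.refl
    · exact absurd (h2.1 ▸ hp) h2.2
  · exact h1

/-- Together with `chainMin_of_portal`, this carries the minimum of a chain from its top down to all
of its nodes. -/
theorem chainMin_parent {c : N} (h : ¬ R.Top c) (hm : R.Marked c) (hp : ¬ R.Portal (R.par c)) :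
    R.chainMin c = R.chainMin (R.par c) := by
  obtain ⟨p, hpp, hpc⟩ := exists_chain h hm
  rw [chainMin_eq hpp hpc, chainMin_eq hpp (hpc.tail ⟨rfl, hp⟩)]

theorem cut_iff_of_portal {c : N} (h : R.LowPortal c) : R.Cut c ↔ R.w c = R.chainMin c := by
  refine ⟨fun h => h.2.1, fun h' => ⟨⟨c, h, ReflTransGen.refl⟩, h', fun x hx hne => ?_⟩⟩
  rw [low_eq h ReflTransGen.refl] at hx
  exact absurd (R.grounded.below_antisymm hx.2.below hx.1.below) hne

/-- A node of a chain that is not its start can tell from the chain minimum, and from the minimum up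
to its child, whether its parent edge is the one that is cut. -/
theorem cut_parent_iff {c : N} (h : ¬ R.Top c) (hm : R.Marked c) (hp : ¬ R.Portal (R.par c)) :
    R.Cut (R.par c) ↔ R.w (R.par c) = R.chainMin (R.par c) ∧
      R.chainMin (R.par c) < R.lowMin c := by
  obtain ⟨p, hpp, hpc⟩ := exists_chain h hm
  have hroot : R.par c ≠ c := fun h' => h (R.fixed_iff.1 h' ▸ R.top_root)
  constructor
  · intro hC
    refine ⟨hC.2.1, ?_⟩
    obtain ⟨x, hx, hxw⟩ := Nat.sInf_mem (s := R.w '' R.low c) ⟨_, c, mem_low_self h hm, rfl⟩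
    rw [lowMin, ← hxw]
    refine hC.2.2 x (by rw [low_parent h hm hp]; exact Or.inr hx) ?_
    rintro rfl
    obtain ⟨_, _, _, h2⟩ := hx
    exact R.grounded.not_parent_below hroot h2.below
  · rintro ⟨h1, h2⟩
    refine ⟨⟨p, hpp, hpc.tail ⟨rfl, hp⟩⟩, h1, fun x hx hne => ?_⟩
    rw [low_parent h hm hp] at hx
    rcases hx with rfl | hx
    · exact absurd rfl hne
    · exact h2.trans_le (Nat.sInf_le ⟨x, hx, rfl⟩)

end CutTree

/-! ### Tree edges and flows along a spanning tree -/

namespace ParentForest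

variable {α : Type} {f : α → α} {S : α → Prop}

theorem below_firstIn_of_below (hf : Grounded f) (hS : ∀ x, ∃ i, S (f^[i] x)) {x c : α}
    (h : Below f x c) (hc : S c) : Below f (firstIn f S x) c := by
  revert h
  refine hf.induction (P := fun x => Below f x c → Below f (firstIn f S x) c) ?_ ?_ x
  · intro x hx h
    rw [Below.eq_of_fixed hx h] at hc
    rwa [firstIn_of_mem hc]
  · intro x hx ih h
    by_cases hSx : S x
    · rwa [firstIn_of_mem hSx]
    · rw [firstIn_of_not_mem hS hSx]
      rcases below_iff.1 h with rfl | h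
      · exact absurd hc hSx
      · exact ih h

theorem below_iff_of_firstIn (hf : Grounded f) (hS : ∀ x, ∃ i, S (f^[i] x)) {x y c : α}
    (hc : S c) (h : firstIn f S x = firstIn f S y) : Below f x c ↔ Below f y c :=
  ⟨fun hx => (below_firstIn y).trans (h ▸ below_firstIn_of_below hf hS hx hc),
    fun hy => (below_firstIn x).trans (h ▸ below_firstIn_of_below hf hS hy hc)⟩

end ParentForest

namespace CapGraph

open ParentForest

variable {N E : Type}

/-- Connectivity by the edges `x — f x` with `x ∉ S` amounts to having the same first ancestor
in `S`. -/
theorem firstIn_eq_of_reachable {E' : Type} (Γ : CapGraph N E') (A : Set E') {f : N → N}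
    {S : N → Prop} (hS : ∀ x, ∃ i, S (f^[i] x))
    (hA : ∀ e ∈ A, ∃ c, ¬ S c ∧ ((Γ.src e = c ∧ Γ.tgt e = f c) ∨ (Γ.src e = f c ∧ Γ.tgt e = c)))
    {x y : N} (h : (Γ.graphOn A).Reachable x y) : firstIn f S x = firstIn f S y := by
  obtain ⟨p⟩ := h
  induction p with
  | nil => rfl
  | @cons u v _ hadj _ ih =>
    rw [← ih]
    have key : ∀ e ∈ A, firstIn f S (Γ.src e) = firstIn f S (Γ.tgt e) := by
      intro e he
      obtain ⟨c, hc, ⟨h1, h2⟩ | ⟨h1, h2⟩⟩ := hA e he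
      · rw [h1, h2, firstIn_of_not_mem hS hc]
      · rw [h1, h2, ← firstIn_of_not_mem hS hc]
    rcases (SimpleGraph.fromRel_adj _ _ _).1 hadj with ⟨_, ⟨e, he, rfl, rfl⟩ | ⟨e, he, rfl, rfl⟩⟩
    · exact key e he
    · exact (key e he).symm

theorem graphOn_reachable_edge {E' : Type} (Γ : CapGraph N E') {A : Set E'} {e : E'}
    (he : e ∈ A) : (Γ.graphOn A).Reachable (Γ.src e) (Γ.tgt e) :=
  SimpleGraph.Adj.reachable
    ((SimpleGraph.fromRel_adj _ _ _).2 ⟨Γ.src_ne_tgt e, Or.inl ⟨e, he, rfl, rfl⟩⟩)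

/-- The converse holds if every edge `x — f x` with `x ∉ S` belongs to `A`. -/
theorem reachable_iff_firstIn {E' : Type} (Γ : CapGraph N E') (A : Set E') {f : N → N}
    (hf : Grounded f) {S : N → Prop} (hS : ∀ x, ∃ i, S (f^[i] x))
    (hA : ∀ e ∈ A, ∃ c, ¬ S c ∧ ((Γ.src e = c ∧ Γ.tgt e = f c) ∨ (Γ.src e = f c ∧ Γ.tgt e = c)))
    (hA' : ∀ c, ¬ S c → ∃ e ∈ A,
      (Γ.src e = c ∧ Γ.tgt e = f c) ∨ (Γ.src e = f c ∧ Γ.tgt e = c))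
    {x y : N} : (Γ.graphOn A).Reachable x y ↔ firstIn f S x = firstIn f S y := by
  refine ⟨Γ.firstIn_eq_of_reachable A hS hA, fun h => ?_⟩
  have key : ∀ x, (Γ.graphOn A).Reachable x (firstIn f S x) := by
    refine hf.induction ?_ ?_
    · intro x hx
      obtain ⟨i, hi⟩ := hS x
      rw [Function.iterate_fixed hx] at hi
      rw [firstIn_of_mem hi]
    · intro x _ ih
      by_cases hSx : S x
      · rw [firstIn_of_mem hSx]
      · rw [firstIn_of_not_mem hS hSx]
        refine SimpleGraph.Reachable.trans ?_ ih
        obtain ⟨e, he, hends⟩ := hA' x hSx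
        have := Γ.graphOn_reachable_edge he
        rcases hends with ⟨h1, h2⟩ | ⟨h1, h2⟩
        · rwa [h1, h2] at this
        · rw [h1, h2] at this
          exact this.symm
  exact (key x).trans (h ▸ (key y).symm)

open Classical in
theorem netOut_eq_sum [Fintype E] (Γ : CapGraph N E) (g : E → ℝ) (y : N) :
    Γ.netOut g y = ∑ e, g e * ((if y = Γ.src e then 1 else 0) - if y = Γ.tgt e then 1 else 0) := by
  simp only [netOut, Finset.sum_filter, mul_sub, mul_ite, mul_one, mul_zero,
    Finset.sum_sub_distrib, eq_comm (a := y)]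

theorem netOut_add [Fintype E] (Γ : CapGraph N E) (g h : E → ℝ) (y : N) :
    Γ.netOut (fun e => g e + h e) y = Γ.netOut g y + Γ.netOut h y := by
  simp only [netOut_eq_sum, add_mul, Finset.sum_add_distrib]

theorem netOut_sub [Fintype E] (Γ : CapGraph N E) (g h : E → ℝ) (y : N) :
    Γ.netOut (fun e => g e - h e) y = Γ.netOut g y - Γ.netOut h y := by
  simp only [netOut_eq_sum, sub_mul, Finset.sum_sub_distrib]

theorem netOut_const_mul [Fintype E] (Γ : CapGraph N E) (a : ℝ) (g : E → ℝ) (y : N) :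
    Γ.netOut (fun e => a * g e) y = a * Γ.netOut g y := by
  simp only [netOut_eq_sum, mul_assoc, Finset.mul_sum]

open Classical in
theorem netOut_single [Fintype E] [DecidableEq E] (Γ : CapGraph N E) (e₀ : E) (a : ℝ) (y : N) :
    Γ.netOut (fun e => if e = e₀ then a else 0) y =
      a * ((if y = Γ.src e₀ then 1 else 0) - if y = Γ.tgt e₀ then 1 else 0) := by
  simp [netOut_eq_sum]

/-- A flow on `Γ` may be read as a flow on any multigraph that contains the edges it uses. -/
theorem netOut_subtype [Fintype E] (Γ : CapGraph N E) {P : E → Prop} [Fintype {e // P e}]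
    (Γ' : CapGraph N {e // P e}) (g : E → ℝ)
    (hg : ∀ e, g e ≠ 0 → ∃ h : P e, Γ'.src ⟨e, h⟩ = Γ.src e ∧ Γ'.tgt ⟨e, h⟩ = Γ.tgt e) (y : N) :
    Γ'.netOut (fun e => g e) y = Γ.netOut g y := by
  classical
  rw [netOut_eq_sum, netOut_eq_sum]
  have h1 : ∀ e : {e // P e}, g e * ((if y = Γ'.src e then 1 else 0) -
      if y = Γ'.tgt e then 1 else 0) =
      (fun e => g e * ((if y = Γ.src e then 1 else 0) - if y = Γ.tgt e then 1 else 0)) e.1 := by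
    rintro ⟨e, he⟩
    by_cases h0 : g e = 0
    · simp [h0]
    · obtain ⟨h, h2, h3⟩ := hg e h0
      simp only [h2, h3]
  rw [Finset.sum_congr rfl fun e _ => h1 e,
    ← Finset.sum_subtype (Finset.univ.filter P) (by simp)
      (fun e => g e * ((if y = Γ.src e then 1 else 0) - if y = Γ.tgt e then 1 else 0))]
  refine Finset.sum_subset (Finset.filter_subset _ _) fun e _ he => ?_
  have : g e = 0 := by
    by_contra h0
    obtain ⟨h, _⟩ := hg e h0
    simp [h] at he
  simp [this]

theorem sum_subtype_le [Fintype E] {P : E → Prop} [Fintype {e // P e}] {g : E → ℝ}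
    (hg : ∀ e, 0 ≤ g e) : ∑ e : {e // P e}, g e ≤ ∑ e, g e := by
  classical
  rw [← Finset.sum_subtype (Finset.univ.filter P) (by simp) g]
  exact Finset.sum_le_sum_of_subset_of_nonneg (Finset.filter_subset _ _) fun e _ _ => hg e

namespace SpanningTree

variable {Γ : CapGraph N E} (T : Γ.SpanningTree)

theorem grounded : Grounded T.parent := fun x => by
  obtain ⟨i, hi⟩ := T.reaches_root x
  exact ⟨i, by rw [hi, T.parent_root]⟩

variable {T}

theorem parent_eq_iff {x : N} : T.parent x = x ↔ x = T.root := by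
  constructor
  · intro h
    obtain ⟨i, hi⟩ := T.reaches_root x
    rw [← hi, Function.iterate_fixed h]
  · rintro rfl
    exact T.parent_root

theorem ne_root_of_parentEdge {c : N} {e : E} (h : T.parentEdge c = some e) : c ≠ T.root := by
  rintro rfl
  simp [T.parentEdge_root] at h

theorem ends_of_parentEdge {c : N} {e : E} (h : T.parentEdge c = some e) :
    (Γ.src e = c ∧ Γ.tgt e = T.parent c) ∨ (Γ.src e = T.parent c ∧ Γ.tgt e = c) := by
  obtain ⟨e', h1, h2⟩ := T.parentEdge_spec c (ne_root_of_parentEdge h)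
  obtain rfl : e = e' := Option.some.inj (h.symm.trans h1)
  exact h2

theorem parentEdge_inj {c c' : N} {e : E} (h : T.parentEdge c = some e)
    (h' : T.parentEdge c' = some e) : c = c' := by
  have hne := mt parent_eq_iff.1 (ne_root_of_parentEdge h)
  have key : T.parent c = c' → T.parent c' = c → c = c' := by
    rintro rfl h2
    exact absurd ⟨1, h2⟩ (T.grounded.not_parent_below hne)
  rcases ends_of_parentEdge h with ⟨h1, h2⟩ | ⟨h1, h2⟩ <;>
    rcases ends_of_parentEdge h' with ⟨h3, h4⟩ | ⟨h3, h4⟩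
  · exact h1.symm.trans h3
  · exact key (h2.symm.trans h4) (h3.symm.trans h1)
  · exact key (h1.symm.trans h3) (h4.symm.trans h2)
  · exact h2.symm.trans h4

theorem lower_eq {c : N} {e : E} (h : T.parentEdge c = some e) : T.lower e = c := by
  unfold lower
  split_ifs with h1
  · exact parentEdge_inj h1 h
  · rcases ends_of_parentEdge h with ⟨h2, _⟩ | ⟨_, h2⟩
    · exact absurd (h2 ▸ h) h1
    · exact h2

variable [Fintype E]

theorem mem_edges {e : E} : e ∈ T.edges ↔ T.parentEdge (T.lower e) = some e := by
  unfold edges lower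
  simp only [Finset.mem_filter, Finset.mem_univ, true_and]
  split_ifs with h
  · simp [h]
  · simp [h]

theorem mem_edges_of_parentEdge {c : N} {e : E} (h : T.parentEdge c = some e) : e ∈ T.edges :=
  mem_edges.2 ((lower_eq h).symm ▸ h)

theorem edge_ends {e : E} (h : e ∈ T.edges) :
    (Γ.src e = T.lower e ∧ Γ.tgt e = T.parent (T.lower e)) ∨
      (Γ.src e = T.parent (T.lower e) ∧ Γ.tgt e = T.lower e) :=
  ends_of_parentEdge (mem_edges.1 h)

theorem lower_inj {e e' : E} (h : e ∈ T.edges) (h' : e' ∈ T.edges) (heq : T.lower e = T.lower e') :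
    e = e' :=
  Option.some.inj ((mem_edges.1 h).symm.trans (heq ▸ mem_edges.1 h'))

theorem exists_parentEdge {c : N} (hc : c ≠ T.root) :
    ∃ e ∈ T.edges, T.parentEdge c = some e ∧ T.lower e = c := by
  obtain ⟨e, he, -⟩ := T.parentEdge_spec c hc
  exact ⟨e, mem_edges_of_parentEdge he, he, lower_eq he⟩

/-- The edge `g` has exactly one end in the subtree of `c`. -/
def Crosses (T : Γ.SpanningTree) (c : N) (g : E) : Prop :=
  ¬ (Below T.parent (Γ.src g) c ↔ Below T.parent (Γ.tgt g) c)

omit [Fintype E] in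
theorem mem_subtree {x c : N} : x ∈ T.subtree c ↔ Below T.parent x c := Iff.rfl

open Classical in
theorem capT_eq (e : E) :
    (T.capT e : ℝ) = ∑ g, if T.Crosses (T.lower e) g then (Γ.cap g : ℝ) else 0 := by
  simp only [capT, mem_subtree, Finset.sum_filter, Nat.cast_sum, Nat.cast_ite, Nat.cast_zero]
  exact Finset.sum_congr rfl fun g _ => if_congr Iff.rfl rfl rfl

/-- The only tree edge with exactly one end in the subtree of `c` is the parent edge of `c`. -/
theorem crosses_tree_edge {e : E} (h : e ∈ T.edges) {c : N} :
    T.Crosses c e ↔ c = T.lower e := by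
  have hne : T.parent (T.lower e) ≠ T.lower e :=
    mt parent_eq_iff.1 (ne_root_of_parentEdge (mem_edges.1 h))
  have key : ¬ (Below T.parent (T.lower e) c ↔ Below T.parent (T.parent (T.lower e)) c) ↔
      c = T.lower e := by
    rw [below_iff (x := T.lower e)]
    constructor
    · intro h
      by_contra hc
      exact h (by simp [Ne.symm hc])
    · intro hc
      have := T.grounded.not_parent_below hne
      simp only [hc, true_or, true_iff]
      exact this
  unfold Crosses
  rcases edge_ends h with ⟨h1, h2⟩ | ⟨h1, h2⟩
  · rw [h1, h2, key]
  · rw [h1, h2, ← key]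
    exact not_congr Iff.comm

open Classical in
/-- One unit of flow from `x` to the root of the tree. -/
noncomputable def rootFlow (T : Γ.SpanningTree) (x : N) (e : E) : ℝ :=
  if e ∈ T.edges ∧ Below T.parent x (T.lower e) then
    (if Γ.src e = T.lower e then 1 else -1) else 0

open Classical in
theorem netOut_rootFlow (x y : N) : Γ.netOut (T.rootFlow x) y =
    (if y = x then 1 else 0) - if y = T.root then 1 else 0 := by
  revert x
  refine T.grounded.induction ?_ ?_
  · intro x hx
    have hr := parent_eq_iff.1 hx
    have : T.rootFlow x = fun e => 0 * 0 := by
      funext e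
      rw [rootFlow, if_neg, mul_zero]
      rintro ⟨h1, h2⟩
      have := Below.eq_of_fixed hx h2
      exact ne_root_of_parentEdge (mem_edges.1 h1) (this.trans hr)
    rw [this, netOut_const_mul, hr]
    simp
  · intro x hx ih
    obtain ⟨e₀, he₀, h1, h2⟩ := exists_parentEdge (mt parent_eq_iff.2 hx)
    have : T.rootFlow x = fun e => T.rootFlow (T.parent x) e +
        if e = e₀ then (if Γ.src e₀ = x then 1 else -1) else 0 := by
      funext e
      by_cases he : e = e₀
      · subst he
        simp [rootFlow, he₀, h2, Below.refl, T.grounded.not_parent_below hx]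
      · have : ∀ h : e ∈ T.edges, x ≠ T.lower e := fun h h' =>
          he (lower_inj h he₀ (h'.symm.trans h2.symm))
        simp only [rootFlow, he, if_false, add_zero]
        refine if_congr ?_ rfl rfl
        rw [and_congr_right_iff]
        intro h
        rw [below_iff]
        simp [this h]
    rw [this, netOut_add, ih, netOut_single]
    have hne := Γ.src_ne_tgt e₀
    rcases ends_of_parentEdge h1 with ⟨h3, h4⟩ | ⟨h3, h4⟩
    · rw [h3, h4]
      simp
    · rw [h3, h4]
      rw [h3, h4] at hne
      simp only [hne, if_false]
      ring

open Classical in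
/-- The difference of the two flows is the unit flow along the tree path from `x` to `y`: it uses
exactly the tree edges that separate `x` from `y`. -/
theorem abs_rootFlow_sub {e : E} (he : e ∈ T.edges) (x y : N) :
    |T.rootFlow x e - T.rootFlow y e| =
      if (Below T.parent x (T.lower e) ↔ Below T.parent y (T.lower e)) then 0 else 1 := by
  by_cases h1 : Below T.parent x (T.lower e) <;> by_cases h2 : Below T.parent y (T.lower e) <;>
    by_cases h3 : Γ.src e = T.lower e <;> simp [rootFlow, he, h1, h2, h3]

theorem rootFlow_of_not_mem {e : E} (he : e ∉ T.edges) (x : N) : T.rootFlow x e = 0 := by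
  simp [rootFlow, he]

/-! ### The `j`-tree -/

open Classical in
/-- The tree `T` with the edges of `F` deleted and the edges weighted by `cap_T`. -/
noncomputable def cutTree (T : Γ.SpanningTree) (F : Finset E) : CutTree N where
  par := T.parent
  root := T.root
  par_root := T.parent_root
  reaches := T.reaches_root
  Top c := c = T.root ∨ ∃ e ∈ F, T.parentEdge c = some e
  top_root := Or.inl rfl
  w c := match T.parentEdge c with
    | some e => T.capT e
    | none => 0

variable {F : Finset E}

theorem cutTree_w {e : E} (he : e ∈ T.edges) : (T.cutTree F).w (T.lower e) = T.capT e := by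
  simp [cutTree, mem_edges.1 he]

theorem top_lower_iff {e : E} (he : e ∈ T.edges) : (T.cutTree F).Top (T.lower e) ↔ e ∈ F := by
  have h := mem_edges.1 he
  constructor
  · rintro (h1 | ⟨e', h1, h2⟩)
    · exact absurd h1 (ne_root_of_parentEdge h)
    · obtain rfl := Option.some.inj (h2.symm.trans h)
      exact h1
  · intro h1
    exact Or.inr ⟨e, h1, h⟩

open Classical in
theorem card_top (hF : F ⊆ T.edges) [Fintype N] :
    (Finset.univ.filter fun y => (T.cutTree F).Top y ∧ y ≠ (T.cutTree F).root).card = F.card := by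
  symm
  refine Finset.card_bij (fun e _ => T.lower e) ?_ ?_ ?_
  · intro e he
    simp only [Finset.mem_filter, Finset.mem_univ, true_and]
    exact ⟨(top_lower_iff (hF he)).2 he, ne_root_of_parentEdge (mem_edges.1 (hF he))⟩
  · intro e he e' he' h
    exact lower_inj (hF he) (hF he') h
  · intro y hy
    simp only [Finset.mem_filter, Finset.mem_univ, true_and] at hy
    obtain ⟨h1 | ⟨e, h1, h2⟩, h3⟩ := hy
    · exact absurd h1 h3
    · exact ⟨e, h1, lower_eq h2⟩

theorem exists_top (x : N) : ∃ i, (T.cutTree F).Top (T.parent^[i] x) := by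
  obtain ⟨i, hi⟩ := T.reaches_root x
  exact ⟨i, by rw [hi]; exact Or.inl rfl⟩

theorem reachable_iff_top {x y : N} :
    (Γ.graphOn {g | g ∈ T.edges ∧ g ∉ F}).Reachable x y ↔
      firstIn T.parent (T.cutTree F).Top x = firstIn T.parent (T.cutTree F).Top y := by
  refine Γ.reachable_iff_firstIn _ T.grounded exists_top ?_ ?_
  · rintro e ⟨he, heF⟩
    exact ⟨T.lower e, mt (top_lower_iff he).1 heF, edge_ends he⟩
  · intro c hc
    obtain ⟨e, he, h1, rfl⟩ := exists_parentEdge fun h => hc (Or.inl h)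
    exact ⟨e, ⟨he, mt (top_lower_iff he).2 hc⟩, ends_of_parentEdge h1⟩

variable [Fintype N]

/-- The tree edges that are neither in `F` nor cut: the forest edges of the `j`-tree. -/
def Kept (T : Γ.SpanningTree) (F : Finset E) (e : E) : Prop :=
  e ∈ T.edges ∧ ¬ (T.cutTree F).PieceTop (T.lower e)

/-- The ends of the edge lie in different pieces. -/
def Core (T : Γ.SpanningTree) (F : Finset E) (e : E) : Prop :=
  (T.cutTree F).pieceTop (Γ.src e) ≠ (T.cutTree F).pieceTop (Γ.tgt e)

theorem Kept.not_core {e : E} (h : T.Kept F e) : ¬ T.Core F e := by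
  have := CutTree.pieceTop_of_not_mem h.2
  rw [Core, not_not]
  rcases edge_ends h.1 with ⟨h1, h2⟩ | ⟨h1, h2⟩
  · rw [h1, h2]; exact this
  · rw [h1, h2]; exact this.symm

/-- The tree edges that are deleted or cut connect different pieces. -/
theorem core_of_pieceTop {e : E} (he : e ∈ T.edges) (h : (T.cutTree F).PieceTop (T.lower e)) :
    T.Core F e := by
  have hne : T.parent (T.lower e) ≠ T.lower e :=
    mt parent_eq_iff.1 (ne_root_of_parentEdge (mem_edges.1 he))
  have key : (T.cutTree F).pieceTop (T.lower e) ≠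
      (T.cutTree F).pieceTop (T.parent (T.lower e)) := by
    rw [CutTree.pieceTop_of_mem h]
    intro h'
    have := CutTree.below_pieceTop (R := T.cutTree F) (T.parent (T.lower e))
    rw [← h'] at this
    exact T.grounded.not_parent_below hne this
  rw [Core]
  rcases edge_ends he with ⟨h1, h2⟩ | ⟨h1, h2⟩
  · rw [h1, h2]; exact key
  · rw [h1, h2]; exact key.symm

open Classical in
/-- The capacity of an edge of `H(T,F)`. -/
noncomputable def capH (T : Γ.SpanningTree) (F : Finset E) (e : E) : ℕ :=
  if e ∈ T.edges ∧ e ∉ F then T.capT e else Γ.cap e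

/-- The edges of the `j`-tree. -/
abbrev JEdge (T : Γ.SpanningTree) (F : Finset E) : Type := {e : E // T.Kept F e ∨ T.Core F e}

noncomputable instance : Fintype (T.JEdge F) := Fintype.ofFinite _

open Classical in
/-- The `j`-tree: its forest consists of the kept tree edges, with capacities scaled up so that
they can carry the flow between nodes and portals; every other edge is moved to the portals of the
pieces that it joins. -/
noncomputable def jGraph (T : Γ.SpanningTree) (F : Finset E) : CapGraph N (T.JEdge F) where
  src e := if T.Kept F e then Γ.src e else (T.cutTree F).portal (Γ.src e)
  tgt e := if T.Kept F e then Γ.tgt e else (T.cutTree F).portal (Γ.tgt e)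
  src_ne_tgt e := by
    split_ifs with h
    · exact Γ.src_ne_tgt e
    · rcases e.2 with h' | h'
      · exact absurd h' h
      · exact mt CutTree.portal_eq_iff.1 h'
  cap e := if T.Kept F e then 4 * T.capT e else T.capH F e

/-- The tree components of the `j`-tree are the pieces. -/
theorem reachable_iff_pieceTop {x y : N} :
    ((T.jGraph F).graphOn {e | T.Kept F e.1}).Reachable x y ↔
      (T.cutTree F).pieceTop x = (T.cutTree F).pieceTop y := by
  refine (T.jGraph F).reachable_iff_firstIn _ T.grounded
    (CutTree.exists_pieceTop (R := T.cutTree F)) ?_ ?_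
  · intro e he
    have he : T.Kept F e.1 := he
    refine ⟨T.lower e, he.2, ?_⟩
    simp only [jGraph, he, if_true]
    exact edge_ends he.1
  · intro c hc
    obtain ⟨e, he, h1, rfl⟩ := exists_parentEdge fun h : c = T.root =>
      hc (Or.inl (Or.inl h))
    have hk : T.Kept F e := ⟨he, hc⟩
    refine ⟨⟨e, Or.inl hk⟩, hk, ?_⟩
    simp only [jGraph, hk, if_true]
    exact ends_of_parentEdge h1

open Classical in
/-- The number of portals is at most `3 |F| + 1`, hence at most `j`; if `F` is empty,
this rests on `1 ≤ j`. -/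
theorem isJTree_jGraph (hF : F ⊆ T.edges) {j : ℕ} (hj : 1 ≤ j) (hFj : 4 * F.card ≤ j) :
    (T.jGraph F).IsJTree j {e | T.Kept F e.1} (Finset.univ.filter (T.cutTree F).Portal) where
  card_core_le := by
    have h := CutTree.card_portal_le (R := T.cutTree F)
    rw [card_top hF] at h
    omega
  isForest := by
    intro e he hr
    have hk : T.Kept F e.1 := he
    have hne : T.parent (T.lower e) ≠ T.lower e :=
      mt parent_eq_iff.1 (ne_root_of_parentEdge (mem_edges.1 hk.1))
    have h := (T.jGraph F).firstIn_eq_of_reachable _ (f := T.parent)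
      (S := fun c => (T.cutTree F).PieceTop c ∨ c = T.lower e) (fun x => ?_) ?_ hr
    · have key : firstIn T.parent (fun c => (T.cutTree F).PieceTop c ∨ c = T.lower e)
          (T.lower e) ≠ firstIn T.parent (fun c => (T.cutTree F).PieceTop c ∨ c = T.lower e)
          (T.parent (T.lower e)) := by
        rw [firstIn_of_mem (f := T.parent) (x := T.lower e)
          (S := fun c => (T.cutTree F).PieceTop c ∨ c = T.lower e) (Or.inr rfl)]
        intro h'
        have hb := below_firstIn (f := T.parent)
          (S := fun c => (T.cutTree F).PieceTop c ∨ c = T.lower e) (T.parent (T.lower e))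
        rw [← h'] at hb
        exact T.grounded.not_parent_below hne hb
      simp only [jGraph, hk, if_true] at h
      rcases edge_ends hk.1 with ⟨h1, h2⟩ | ⟨h1, h2⟩
      · rw [h1, h2] at h; exact key h
      · rw [h1, h2] at h; exact key h.symm
    · obtain ⟨i, hi⟩ := CutTree.exists_pieceTop (R := T.cutTree F) x
      exact ⟨i, Or.inl hi⟩
    · rintro g ⟨hg, hge⟩
      have hg : T.Kept F g.1 := hg
      refine ⟨T.lower g, ?_, ?_⟩
      · rintro (h | h)
        · exact hg.2 h
        · exact hge (Subtype.ext (lower_inj hg.1 hk.1 h))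
      · simp only [jGraph, hg, if_true]
        exact edge_ends hg.1
  unique_core := by
    intro x
    obtain ⟨p, hp, hu⟩ := CutTree.existsUnique_portal (R := T.cutTree F) x
    refine ⟨p, ⟨by simpa using hp.1, reachable_iff_pieceTop.2 hp.2.symm⟩, ?_⟩
    rintro q ⟨h1, h2⟩
    exact hu q ⟨by simpa using h1, (reachable_iff_pieceTop.1 h2).symm⟩
  core_edge := by
    intro e he
    have he : ¬ T.Kept F e.1 := he
    simp [jGraph, he, CutTree.portal_mem]
  core_nonempty := ⟨T.root, Finset.mem_filter.2 ⟨Finset.mem_univ _, Or.inl (T.cutTree F).top_root⟩⟩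
  core_connected := by
    have key : ∀ x, ((T.jGraph F).graphOn {e | T.Kept F e.1}ᶜ).Reachable
        ((T.cutTree F).portal x) ((T.cutTree F).portal T.root) := by
      refine T.grounded.induction ?_ ?_
      · intro x hx
        rw [parent_eq_iff.1 hx]
      · intro x hx ih
        by_cases hp : (T.cutTree F).PieceTop x
        · refine SimpleGraph.Reachable.trans ?_ ih
          obtain ⟨e, he, h1, rfl⟩ := exists_parentEdge (mt parent_eq_iff.2 hx)
          have hcore := core_of_pieceTop he hp
          have hk : ¬ T.Kept F e := fun h => h.2 hp
          have hr := (T.jGraph F).graphOn_reachable_edge (A := {e | T.Kept F e.1}ᶜ)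
            (e := ⟨e, Or.inr hcore⟩) hk
          simp only [jGraph, hk, if_false] at hr
          rcases ends_of_parentEdge h1 with ⟨h2, h3⟩ | ⟨h2, h3⟩
          · rwa [h2, h3] at hr
          · rw [h2, h3] at hr; exact hr.symm
        · have := CutTree.pieceTop_of_not_mem hp
          rw [CutTree.portal_eq_iff.2 this]
          exact ih
    intro p hp q hq
    have hp := CutTree.portal_of_portal (Finset.mem_filter.1 hp).2
    have hq := CutTree.portal_of_portal (Finset.mem_filter.1 hq).2
    have h1 := key p
    have h2 := key q
    rw [hp] at h1
    rw [hq] at h2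
    exact h1.trans h2.symm

/-! ### The embeddings -/

/-- One unit of flow from `x` to the portal in its piece. -/
noncomputable def portalFlow (T : Γ.SpanningTree) (F : Finset E) (x : N) (e : E) : ℝ :=
  T.rootFlow x e - T.rootFlow ((T.cutTree F).portal x) e

theorem netOut_portalFlow [DecidableEq N] (x y : N) : Γ.netOut (T.portalFlow F x) y =
    (if y = x then 1 else 0) - if y = (T.cutTree F).portal x then 1 else 0 := by
  have h : T.portalFlow F x =
      fun e => T.rootFlow x e - T.rootFlow ((T.cutTree F).portal x) e := rfl
  rw [h, netOut_sub, netOut_rootFlow, netOut_rootFlow]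
  simp only [sub_sub_sub_cancel_right]
  congr

/-- The flow stays inside the piece. -/
theorem portalFlow_of_not_kept {e : E} (he : ¬ T.Kept F e) (x : N) : T.portalFlow F x e = 0 := by
  by_cases hT : e ∈ T.edges
  · have hp : (T.cutTree F).PieceTop (T.lower e) := by
      by_contra h
      exact he ⟨hT, h⟩
    have h1 : Below T.parent x _ ↔ Below T.parent _ _ := CutTree.below_iff_of_pieceTop hp
      (CutTree.pieceTop_portal (R := T.cutTree F) x).symm
    have h2 := abs_rootFlow_sub hT x ((T.cutTree F).portal x)
    rw [if_pos h1] at h2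
    exact abs_eq_zero.1 h2
  · simp [portalFlow, rootFlow_of_not_mem hT]

open Classical in
/-- Moving all core edges to the portals loads a forest edge with at most three times its capacity
in `H(T,F)`. -/
theorem portal_load_le {g : E} (hg : T.Kept F g) :
    ∑ e, (if T.Core F e then (T.capH F e : ℝ) *
      (|T.portalFlow F (Γ.src e) g| + |T.portalFlow F (Γ.tgt e) g|) else 0) ≤ 3 * T.capT g := by
  obtain ⟨S, hS1, hS2, hS3⟩ := CutTree.exists_region hg.2
  have hflow : ∀ x, |T.portalFlow F x g| ≤ if x ∈ S then 1 else 0 := by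
    intro x
    unfold portalFlow
    rw [abs_rootFlow_sub hg.1]
    by_cases h : x ∈ S
    · rw [if_pos h]
      split_ifs <;> norm_num
    · rw [if_neg h, if_pos]
      by_contra h'
      exact h (hS2 x h')
  -- a core edge has at most one end in the region
  have hends : ∀ e, T.Core F e → |T.portalFlow F (Γ.src e) g| + |T.portalFlow F (Γ.tgt e) g| ≤
      if ¬ (Γ.src e ∈ S ↔ Γ.tgt e ∈ S) then 1 else 0 := by
    intro e he
    have h1 := hflow (Γ.src e)
    have h2 := hflow (Γ.tgt e)
    by_cases h3 : Γ.src e ∈ S <;> by_cases h4 : Γ.tgt e ∈ S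
    · exact absurd ((hS1 _ h3).trans (hS1 _ h4).symm) he
    · simp only [h3, h4, if_true, if_false] at h1 h2
      simp only [h3, h4, iff_false, not_true, not_false_iff, if_true]
      linarith
    · simp only [h3, h4, if_true, if_false] at h1 h2
      simp only [h3, h4, iff_true, not_false_iff, if_true]
      linarith
    · simp only [h3, h4, if_false] at h1 h2
      simp only [h3, h4, not_true, if_false]
      linarith
  -- a tree edge that crosses the lower end of a kept edge is that edge itself
  have hcapH : ∀ e, T.Core F e → T.Crosses (T.lower g) e → T.capH F e = Γ.cap e := by
    intro e he hcr
    rw [capH, if_neg]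
    rintro ⟨h1, h2⟩
    have := lower_inj hg.1 h1 ((crosses_tree_edge h1).1 hcr)
    exact hg.not_core (this ▸ he)
  have hmul : ∀ (P : Prop) {_ : Decidable P} (a : ℝ), 0 ≤ a → a * (if P then 1 else 0) ≤ a := by
    intro P _ a ha
    split_ifs <;> simp [ha]
  have hcap := capT_eq (T := T) g
  rcases hS3 with rfl | ⟨b, hb, hbw, rfl⟩
  · have hle : ∀ e, (if T.Core F e then (T.capH F e : ℝ) *
        (|T.portalFlow F (Γ.src e) g| + |T.portalFlow F (Γ.tgt e) g|) else 0) ≤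
        if T.Crosses (T.lower g) e then (Γ.cap e : ℝ) else 0 := by
      intro e
      by_cases hc : T.Core F e
      · rw [if_pos hc]
        refine (mul_le_mul_of_nonneg_left (hends e hc) (Nat.cast_nonneg _)).trans ?_
        by_cases hcr : T.Crosses (T.lower g) e
        · rw [if_pos hcr, ← hcapH e hc hcr, if_pos, mul_one]
          exact hcr
        · rw [if_neg hcr, if_neg, mul_zero]
          exact hcr
      · rw [if_neg hc]
        split_ifs <;> simp
    have := Finset.sum_le_sum fun e (_ : e ∈ Finset.univ) => hle e
    rw [← hcap] at this
    have h0 : (0 : ℝ) ≤ T.capT g := Nat.cast_nonneg _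
    linarith
  · obtain ⟨eb, heb, hb1, rfl⟩ := exists_parentEdge (T := T) (c := b) fun h : b = T.root =>
      hb.not_top (Or.inl h)
    have hw : (T.capT eb : ℝ) ≤ T.capT g := by
      have : T.capT eb ≤ T.capT g := by
        rw [← cutTree_w (F := F) heb, ← cutTree_w (F := F) hg.1]
        exact hbw
      exact_mod_cast this
    have hle : ∀ e, (if T.Core F e then (T.capH F e : ℝ) *
        (|T.portalFlow F (Γ.src e) g| + |T.portalFlow F (Γ.tgt e) g|) else 0) ≤
        (if T.Crosses (T.lower g) e then (Γ.cap e : ℝ) else 0) +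
        (if T.Crosses (T.lower eb) e then (Γ.cap e : ℝ) else 0) +
        if e = eb then (T.capT eb : ℝ) else 0 := by
      intro e
      have hn1 : (0 : ℝ) ≤ if T.Crosses (T.lower g) e then (Γ.cap e : ℝ) else 0 := by
        split_ifs <;> simp
      have hn2 : (0 : ℝ) ≤ if T.Crosses (T.lower eb) e then (Γ.cap e : ℝ) else 0 := by
        split_ifs <;> simp
      have hn3 : (0 : ℝ) ≤ if e = eb then (T.capT eb : ℝ) else 0 := by split_ifs <;> simp
      by_cases hc : T.Core F e
      · rw [if_pos hc]
        refine (mul_le_mul_of_nonneg_left (hends e hc) (Nat.cast_nonneg _)).trans ?_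
        by_cases hcr : T.Crosses (T.lower g) e
        · rw [hcapH e hc hcr, if_pos hcr]
          refine (hmul _ _ (Nat.cast_nonneg _)).trans ?_
          linarith
        · by_cases hcr' : T.Crosses (T.lower eb) e
          · have h1 : (T.capH F e : ℝ) ≤ (if T.Crosses (T.lower eb) e then (Γ.cap e : ℝ) else 0) +
                if e = eb then (T.capT eb : ℝ) else 0 := by
              rw [if_pos hcr', capH]
              split_ifs with h2 h3 h3
              · subst h3
                have : (0 : ℝ) ≤ Γ.cap e := Nat.cast_nonneg _
                linarith
              · exact absurd (lower_inj h2.1 heb ((crosses_tree_edge h2.1).1 hcr').symm) h3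
              · linarith
              · linarith
            refine (hmul _ _ (Nat.cast_nonneg _)).trans ?_
            linarith
          · rw [if_neg, mul_zero]
            · linarith
            · simp only [Crosses, not_not] at hcr hcr' ⊢
              simp only [Set.mem_ofPred_eq]
              change (¬ (Below T.parent _ _ ↔ Below T.parent _ _) ↔
                ¬ (Below T.parent _ _ ↔ Below T.parent _ _))
              rw [hcr, hcr']
      · rw [if_neg hc]
        linarith
    have hsum := Finset.sum_le_sum fun e (_ : e ∈ Finset.univ) => hle e
    rw [Finset.sum_add_distrib, Finset.sum_add_distrib, ← hcap, ← capT_eq] at hsum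
    rw [Finset.sum_ite_eq' Finset.univ eb] at hsum
    simp only [Finset.mem_univ, if_true] at hsum
    linarith

omit [Fintype N] in
open Classical in
/-- Routing every edge of the cluster graph along the tree loads a tree edge with `cap_T`. -/
theorem tree_load {g : E} (hg : g ∈ T.edges) :
    ∑ e, (Γ.cap e : ℝ) * |T.rootFlow (Γ.src e) g - T.rootFlow (Γ.tgt e) g| = T.capT g := by
  rw [capT_eq]
  refine Finset.sum_congr rfl fun e _ => ?_
  rw [abs_rootFlow_sub hg]
  by_cases h : T.Crosses (T.lower g) e
  · rw [if_pos h, if_neg h, mul_one]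
  · rw [if_neg h, if_pos (not_not.1 h), mul_zero]

open Classical in
/-- The flow that connects the ends of a core edge to their portals. -/
noncomputable def detour (T : Γ.SpanningTree) (F : Finset E) (e g : E) : ℝ :=
  if T.Kept F e then 0 else T.portalFlow F (Γ.src e) g - T.portalFlow F (Γ.tgt e) g

theorem detour_of_not_kept {g : E} (hg : ¬ T.Kept F g) (e : E) : T.detour F e g = 0 := by
  simp [detour, portalFlow_of_not_kept hg]

open Classical in
theorem abs_detour_le {e : E} (he : T.Kept F e ∨ T.Core F e) (g : E) :
    (T.capH F e : ℝ) * |T.detour F e g| ≤ if T.Core F e then (T.capH F e : ℝ) *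
      (|T.portalFlow F (Γ.src e) g| + |T.portalFlow F (Γ.tgt e) g|) else 0 := by
  by_cases hk : T.Kept F e
  · simp [detour, hk, hk.not_core]
  · rw [if_pos (he.resolve_left hk), detour, if_neg hk]
    exact mul_le_mul_of_nonneg_left (abs_sub _ _) (Nat.cast_nonneg _)

open Classical in
theorem netOut_detour (e : T.JEdge F) (y : N) : Γ.netOut (T.detour F e) y =
    ((if y = Γ.src e then 1 else 0) - if y = Γ.tgt e then 1 else 0) -
    ((if y = (T.jGraph F).src e then 1 else 0) - if y = (T.jGraph F).tgt e then 1 else 0) := by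
  by_cases hk : T.Kept F e
  · have : T.detour F e = fun g => 0 * 0 := by
      funext g
      simp [detour, hk]
    rw [this, netOut_const_mul]
    simp [jGraph, hk]
  · have : T.detour F e = fun g => T.portalFlow F (Γ.src e) g - T.portalFlow F (Γ.tgt e) g := by
      funext g
      simp [detour, hk]
    rw [this, netOut_sub, netOut_portalFlow, netOut_portalFlow]
    simp only [jGraph, hk, if_false]
    ring

omit [Fintype N] in
theorem mem_edgesH {e : E} : e ∈ T.edgesH F ↔ (e ∈ T.edges ∧ e ∉ F) ∨
    firstIn T.parent (T.cutTree F).Top (Γ.src e) ≠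
      firstIn T.parent (T.cutTree F).Top (Γ.tgt e) := by
  unfold edgesH
  simp only [Finset.mem_filter, Finset.mem_univ, true_and]
  rw [reachable_iff_top]

/-- Every edge of `H(T,F)` gives rise to an edge of the `j`-tree. -/
theorem kept_or_core_of_mem_edgesH {e : E} (he : e ∈ T.edgesH F) : T.Kept F e ∨ T.Core F e := by
  rcases mem_edgesH.1 he with h | h
  · by_cases hp : (T.cutTree F).PieceTop (T.lower e)
    · exact Or.inr (core_of_pieceTop h.1 hp)
    · exact Or.inl ⟨h.1, hp⟩
  · right
    intro h'
    apply h
    -- the top of a component is a fixed point of the passage to the first top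
    have key : ∀ x, firstIn T.parent (T.cutTree F).Top x =
        firstIn T.parent (T.cutTree F).Top ((T.cutTree F).pieceTop x) := by
      refine T.grounded.induction ?_ ?_
      · intro x hx
        rw [CutTree.pieceTop_of_mem (Or.inl (Or.inl (parent_eq_iff.1 hx)))]
      · intro x hx ih
        by_cases hQ : (T.cutTree F).PieceTop x
        · rw [CutTree.pieceTop_of_mem hQ]
        · rw [CutTree.pieceTop_of_not_mem hQ, firstIn_of_not_mem exists_top fun h => hQ (Or.inl h)]
          exact ih
    rw [key, h', ← key]

theorem mem_edgesH_of_kept {e : E} (he : T.Kept F e) : e ∈ T.edgesH F :=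
  mem_edgesH.2 (Or.inl ⟨he.1, fun h => he.2 (Or.inl ((top_lower_iff he.1).2 h))⟩)

theorem capH_of_kept {e : E} (he : T.Kept F e) : T.capH F e = T.capT e :=
  if_pos ⟨he.1, fun h => he.2 (Or.inl ((top_lower_iff he.1).2 h))⟩

/-- A core edge of `H(T,F)` is routed over its portals.  On a forest edge this adds at most three
times its capacity in `H(T,F)` to its own flow, and the capacity in the `j`-tree is four times as
large. -/
theorem embeddable_graphH_jGraph : (T.graphH F).Embeddable 1 (T.jGraph F) := by
  classical
  have hJ : ∀ e : {e // e ∈ T.edgesH F}, T.Kept F e ∨ T.Core F e :=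
    fun e => kept_or_core_of_mem_edgesH e.2
  refine ⟨fun e g => (T.capH F e : ℝ) * ((if g = ⟨e, hJ e⟩ then 1 else 0) + T.detour F e g),
    fun e y => ?_, fun g => ?_⟩
  · have hd := netOut_detour (T := T) (F := F) ⟨e.1, hJ e⟩ y
    rw [netOut_const_mul, netOut_add, netOut_single, netOut_subtype Γ (T.jGraph F) (T.detour F e),
      hd]
    · change _ = (if y = Γ.src e then (T.capH F e : ℝ) else 0) -
        (if y = Γ.tgt e then (T.capH F e : ℝ) else 0)
      rw [one_mul, add_sub_cancel, mul_sub, mul_ite, mul_ite, mul_one, mul_zero]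
    · intro g hg
      have hk : T.Kept F g := by
        by_contra h
        exact hg (detour_of_not_kept h _)
      exact ⟨Or.inl hk, by simp [jGraph, hk]⟩
  · rw [one_mul]
    have hle : ∀ e : {e // e ∈ T.edgesH F}, |(T.capH F e : ℝ) *
        ((if g = ⟨e, hJ e⟩ then 1 else 0) + T.detour F e g)| ≤
        (if (e : E) = g.1 then (T.capH F e : ℝ) else 0) +
          (T.capH F e : ℝ) * |T.detour F e g| := by
      intro e
      rw [abs_mul, Nat.abs_cast]
      refine (mul_le_mul_of_nonneg_left (abs_add_le _ _) (Nat.cast_nonneg _)).trans ?_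
      rw [mul_add]
      refine add_le_add_left (le_of_eq ?_) _
      have : g = ⟨e, hJ e⟩ ↔ (e : E) = g.1 := by
        rw [Subtype.ext_iff]
        exact eq_comm
      rw [if_congr this rfl rfl]
      split_ifs <;> simp
    refine (Finset.sum_le_sum fun e _ => hle e).trans ?_
    rw [Finset.sum_add_distrib]
    have h1 : ∑ e : {e // e ∈ T.edgesH F}, (if (e : E) = g.1 then (T.capH F e : ℝ) else 0) ≤
        T.capH F g := by
      refine (sum_subtype_le (g := fun e => if e = g.1 then (T.capH F e : ℝ) else 0) fun e => by
        split_ifs <;> simp).trans ?_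
      simp
    by_cases hg : T.Kept F g
    · have h2 : ∑ e : {e // e ∈ T.edgesH F}, (T.capH F e : ℝ) * |T.detour F e g| ≤
          3 * T.capT g := by
        refine (Finset.sum_le_sum fun e _ => abs_detour_le (hJ e) g.1).trans ?_
        refine (sum_subtype_le (g := fun e => if T.Core F e then (T.capH F e : ℝ) *
          (|T.portalFlow F (Γ.src e) g| + |T.portalFlow F (Γ.tgt e) g|) else 0) fun e => ?_).trans
          (portal_load_le hg)
        split_ifs <;> positivity
      rw [capH_of_kept hg] at h1
      simp only [jGraph, hg, if_true]
      push_cast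
      linarith
    · have h2 : ∑ e : {e // e ∈ T.edgesH F}, (T.capH F e : ℝ) * |T.detour F e g| = 0 :=
        Finset.sum_eq_zero fun e _ => by rw [detour_of_not_kept hg]; simp
      simp only [jGraph, hg, if_false]
      linarith

/-- Edges of the `j`-tree that come from edges of `H(T,F)` are routed back over the detours; the
others join two pieces of one component of `T \ F` and are routed along the tree.  The factor is
composed of `4` for the scaled capacity of the edge itself, `3` for the detours, and `1` for the
paths in the tree. -/
theorem embeddable_jGraph_graphH : (T.jGraph F).Embeddable 8 (T.graphH F) := by
  classical
  set R := T.cutTree F with hR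
  set treeFlow : E → E → ℝ := fun e g =>
    T.rootFlow (R.portal (Γ.src e)) g - T.rootFlow (R.portal (Γ.tgt e)) g with htree
  -- an edge inside a component of `T \ F` is routed in that component
  have htree0 : ∀ e ∉ T.edgesH F, ∀ g, ¬ (g ∈ T.edges ∧ g ∉ F) → treeFlow e g = 0 := by
    intro e he g hg
    by_cases hgT : g ∈ T.edges
    · have hgF : g ∈ F := by
        by_contra h
        exact hg ⟨hgT, h⟩
      have htop : R.Top (T.lower g) := (top_lower_iff hgT).2 hgF
      have h1 : firstIn T.parent R.Top (Γ.src e) = firstIn T.parent R.Top (Γ.tgt e) := by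
        by_contra h
        exact he (mem_edgesH.2 (Or.inr h))
      have h2 := below_iff_of_firstIn T.grounded exists_top htop h1
      have h3 := CutTree.below_iff_of_pieceTop (R := R) (Or.inl htop)
        (CutTree.pieceTop_portal (R := R) (Γ.src e))
      have h4 := CutTree.below_iff_of_pieceTop (R := R) (Or.inl htop)
        (CutTree.pieceTop_portal (R := R) (Γ.tgt e))
      refine abs_eq_zero.1 ((abs_rootFlow_sub hgT _ _).trans (if_pos ?_))
      exact h3.trans (h2.trans h4.symm)
    · simp [htree, rootFlow_of_not_mem hgT]
  refine ⟨fun e g => if e.1 ∈ T.edgesH F then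
      ((T.jGraph F).cap e : ℝ) * ((if (g : E) = e.1 then 1 else 0) - T.detour F e g)
    else ((T.jGraph F).cap e : ℝ) * treeFlow e g, fun e y => ?_, fun g => ?_⟩
  · by_cases he : e.1 ∈ T.edgesH F
    · have hs : (fun g : {g // g ∈ T.edgesH F} => (if (g : E) = e.1 then (1 : ℝ) else 0)) =
          fun g => if g = ⟨e.1, he⟩ then 1 else 0 := by
        funext g
        exact if_congr ⟨fun h => Subtype.ext h, fun h => congrArg Subtype.val h⟩ rfl rfl
      have h1 : (T.graphH F).netOut (fun g => if g = ⟨e.1, he⟩ then 1 else 0) y =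
          1 * ((if y = Γ.src e then 1 else 0) - if y = Γ.tgt e then 1 else 0) :=
        netOut_single _ _ _ _
      simp only [he, if_true]
      rw [netOut_const_mul, netOut_sub, hs, h1,
        netOut_subtype Γ (T.graphH F) (T.detour F e), netOut_detour e y]
      · rw [one_mul, sub_sub_cancel, mul_sub, mul_ite, mul_ite, mul_one, mul_zero]
      · intro g hg
        have hk : T.Kept F g := by
          by_contra h
          exact hg (detour_of_not_kept h _)
        exact ⟨mem_edgesH_of_kept hk, rfl, rfl⟩
    · have hk : ¬ T.Kept F e := fun h => he (mem_edgesH_of_kept h)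
      simp only [he, if_false]
      rw [netOut_const_mul, netOut_subtype Γ (T.graphH F) (treeFlow e), htree, netOut_sub,
        netOut_rootFlow, netOut_rootFlow, sub_sub_sub_cancel_right]
      · simp only [jGraph, hk, if_false]
        rw [mul_sub, mul_ite, mul_ite, mul_one, mul_zero]
      · intro g hg
        refine ⟨mem_edgesH.2 (Or.inl ?_), rfl, rfl⟩
        by_contra h
        exact hg (htree0 e he g h)
  · have hcapJ : ∀ e : T.JEdge F, ((T.jGraph F).cap e : ℝ) ≤ 4 * T.capH F e := by
      intro e
      by_cases hk : T.Kept F e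
      · simp [jGraph, hk, capH_of_kept hk]
      · have : (0 : ℝ) ≤ T.capH F e := Nat.cast_nonneg _
        simp only [jGraph, hk, if_false]
        linarith
    set A : E → ℝ := fun e => if e = g.1 then 4 * (T.capH F g : ℝ) else 0
    set B : E → ℝ := fun e => if T.Core F e then (T.capH F e : ℝ) *
      (|T.portalFlow F (Γ.src e) g| + |T.portalFlow F (Γ.tgt e) g|) else 0
    set D : E → ℝ := fun e => if g.1 ∈ T.edges ∧ g.1 ∉ F then
      (Γ.cap e : ℝ) * |T.rootFlow (Γ.src e) g - T.rootFlow (Γ.tgt e) g| else 0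
    have hA0 : ∀ e, 0 ≤ A e := fun e => by simp only [A]; split_ifs <;> positivity
    have hB0 : ∀ e, 0 ≤ B e := fun e => by simp only [B]; split_ifs <;> positivity
    have hD0 : ∀ e, 0 ≤ D e := fun e => by simp only [D]; split_ifs <;> positivity
    have hle : ∀ e : T.JEdge F, |if e.1 ∈ T.edgesH F then
        ((T.jGraph F).cap e : ℝ) * ((if (g : E) = e.1 then 1 else 0) - T.detour F e g)
        else ((T.jGraph F).cap e : ℝ) * treeFlow e g| ≤ A e + B e + D e := by
      intro e
      by_cases he : e.1 ∈ T.edgesH F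
      · rw [if_pos he, abs_mul, Nat.abs_cast]
        refine (mul_le_mul_of_nonneg_left (abs_sub _ _) (Nat.cast_nonneg _)).trans ?_
        rw [mul_add]
        have h1 : ((T.jGraph F).cap e : ℝ) * |(if (g : E) = e.1 then (1 : ℝ) else 0)| ≤ A e := by
          by_cases h : (g : E) = e.1
          · have := hcapJ e
            simp only [A, h, if_true, abs_one, mul_one]
            exact this
          · simp [A, h, Ne.symm h]
        have h2 : ((T.jGraph F).cap e : ℝ) * |T.detour F e g| ≤ B e := by
          refine le_trans (le_of_eq ?_) (abs_detour_le e.2 g.1)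
          by_cases hk : T.Kept F e
          · simp [detour, hk]
          · simp [jGraph, hk]
        have := hD0 e
        linarith
      · have hk : ¬ T.Kept F e := fun h => he (mem_edgesH_of_kept h)
        have hc := e.2.resolve_left hk
        rw [if_neg he, abs_mul, Nat.abs_cast]
        by_cases hg : g.1 ∈ T.edges ∧ g.1 ∉ F
        · have hcap : ((T.jGraph F).cap e : ℝ) = Γ.cap e := by
            have : ¬ (e.1 ∈ T.edges ∧ e.1 ∉ F) := fun h => he (mem_edgesH.2 (Or.inl h))
            simp only [jGraph, hk, if_false, capH, this]
          have hcapH : (T.capH F e : ℝ) = Γ.cap e := by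
            rw [← hcap]
            simp [jGraph, hk]
          have htri : |treeFlow e g| ≤ |T.portalFlow F (Γ.src e) g| +
              |T.portalFlow F (Γ.tgt e) g| +
              |T.rootFlow (Γ.src e) g - T.rootFlow (Γ.tgt e) g| := by
            have : treeFlow e g = -T.portalFlow F (Γ.src e) g + T.portalFlow F (Γ.tgt e) g +
                (T.rootFlow (Γ.src e) g - T.rootFlow (Γ.tgt e) g) := by
              simp only [htree, portalFlow, hR]
              ring
            rw [this]
            refine (abs_add_le _ _).trans (add_le_add_left ((abs_add_le _ _).trans ?_) _)
            rw [abs_neg]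
          have := mul_le_mul_of_nonneg_left htri (Nat.cast_nonneg (α := ℝ) (Γ.cap e.1))
          rw [hcap]
          refine this.trans ?_
          have h1 : B e = (Γ.cap e : ℝ) *
              (|T.portalFlow F (Γ.src e) g| + |T.portalFlow F (Γ.tgt e) g|) := by
            simp only [B, hc, if_true, hcapH]
          have h2 : D e = (Γ.cap e : ℝ) * |T.rootFlow (Γ.src e) g - T.rootFlow (Γ.tgt e) g| := by
            simp only [D]
            rw [if_pos hg]
          have := hA0 e
          rw [h1, h2, mul_add]
          linarith
        · rw [htree0 e he g hg, abs_zero, mul_zero]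
          have := hA0 e
          have := hB0 e
          have := hD0 e
          linarith
    refine (Finset.sum_le_sum fun e _ => hle e).trans
      ((sum_subtype_le (g := fun e => A e + B e + D e) fun e =>
        add_nonneg (add_nonneg (hA0 e) (hB0 e)) (hD0 e)).trans ?_)
    rw [Finset.sum_add_distrib, Finset.sum_add_distrib]
    have hA : ∑ e, A e = 4 * T.capH F g := by simp [A]
    have hB : ∑ e, B e ≤ 3 * T.capH F g := by
      by_cases hk : T.Kept F g
      · rw [capH_of_kept hk]
        exact portal_load_le hk
      · have : ∑ e, B e = 0 := Finset.sum_eq_zero fun e _ => by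
          simp [B, portalFlow_of_not_kept hk]
        rw [this]
        positivity
    have hD : ∑ e, D e ≤ T.capH F g := by
      by_cases hg : g.1 ∈ T.edges ∧ g.1 ∉ F
      · have := tree_load hg.1
        simp only [D, capH]
        rw [if_pos hg]
        simp only [hg, not_false_iff, and_self, if_true]
        exact this.le
      · simp only [D, if_neg hg, Finset.sum_const_zero]
        positivity
    have : ((T.graphH F).cap g : ℝ) = T.capH F g := rfl
    rw [this]
    linarith

end SpanningTree

end CapGraph

/-! ### Event-driven broadcast algorithms -/

/-- A description of an algorithm in which every node computes `numVars` public natural numbers.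
In terms of a table `tab` of the variables of the node and its neighbours, indexed by identifiers,
variable `k` of a node is `value k inp tab`.  It depends on the variables below `k` of the node and
of all its neighbours, and on variable `k` of the neighbours selected by `sel k`. -/
structure Protocol (In Out : Type) where
  numVars : ℕ
  id : In → ℕ
  nbrs : In → Finset ℕ
  sel : ℕ → In → (ℕ → ℕ → ℕ) → ℕ → Prop
  value : ℕ → In → (ℕ → ℕ → ℕ) → ℕ
  result : In → (ℕ → ℕ → ℕ) → Out

namespace Protocol

variable {In Out : Type}

/-- The state of a node: its input, the variables that it knows, and whether it has already
announced all its own variables and may stop. -/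
structure State (In : Type) where
  inp : In
  tab : ℕ → ℕ → Option ℕ
  done : Bool

/-- The known variables, completed by zeros. -/
def total (tab : ℕ → ℕ → Option ℕ) (x k : ℕ) : ℕ := (tab x k).getD 0

open Classical in
/-- Variable `k` of a node, once everything that it depends on is known. -/
noncomputable def rule (P : Protocol In Out) (k : ℕ) (inp : In) (tab : ℕ → ℕ → Option ℕ) :
    Option ℕ :=
  if (∀ x ∈ insert (P.id inp) (P.nbrs inp), ∀ k' < k, (tab x k').isSome) ∧
      ∀ x ∈ P.nbrs inp, P.sel k inp (total tab) x → (tab x k).isSome then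
    some (P.value k inp (total tab))
  else none

/-- The node knows all variables of itself and of its neighbours. -/
def Complete (P : Protocol In Out) (inp : In) (tab : ℕ → ℕ → Option ℕ) : Prop :=
  ∀ x ∈ insert (P.id inp) (P.nbrs inp), ∀ k < P.numVars, (tab x k).isSome

/-- The variables announced by a message. -/
def decodeRow (m k : ℕ) : Option ℕ :=
  (((Encodable.decode m : Option (List (Option ℕ))).getD [])[k]?).join

open Classical in
/-- The algorithm: in every round a node sends all its variables that it knows to all neighbours.
It stops one round after it knows all variables of itself and its neighbours, so that by then the
neighbours have learned its own variables. -/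
noncomputable def algorithm (P : Protocol In Out) : CongestAlgorithm In Out where
  State := State In
  start inp := ⟨inp, fun _ _ => none, false⟩
  send s _ := Encodable.encode ((List.range P.numVars).map (s.tab (P.id s.inp)))
  receive s m :=
    { inp := s.inp
      tab := fun x k => (s.tab x k).orElse fun _ =>
        if x = P.id s.inp then P.rule k s.inp s.tab else decodeRow (m x) k
      done := decide (P.Complete s.inp s.tab) }
  output s := if s.done then some (P.result s.inp (total s.tab)) else none

theorem decodeRow_encode (n : ℕ) (r : ℕ → Option ℕ) {k : ℕ} (hk : k < n) :
    decodeRow (Encodable.encode ((List.range n).map r)) k = r k := by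
  simp [decodeRow, hk]

theorem decodeRow_zero (k : ℕ) : decodeRow 0 k = none := by
  simp [decodeRow]

/-- A list of boundedly many numbers has an encoding of proportional size. -/
theorem encode_le (s : ℕ) (l : List (Option ℕ)) (hl : ∀ a, some a ∈ l → a < 2 ^ s) :
    Encodable.encode l ≤ 2 ^ (4 ^ l.length * (s + 1)) := by
  induction l with
  | nil => simp
  | cons a l ih =>
    have ih := ih fun b hb => hl b (List.mem_cons_of_mem _ hb)
    set u := 4 ^ l.length * (s + 1) with hu
    have h4 : 1 ≤ 4 ^ l.length := Nat.one_le_pow _ _ (by norm_num)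
    have hsu : s + 1 ≤ u := by nlinarith
    have ha : Encodable.encode a ≤ 2 ^ u := by
      cases a with
      | none => simp
      | some a =>
        have := hl a List.mem_cons_self
        have h2 : 2 ^ s ≤ 2 ^ u := Nat.pow_le_pow_right (by norm_num) (by omega)
        simp only [Encodable.encode_some, Encodable.encode_nat]
        omega
    rw [Encodable.encode_list_cons]
    have h1 := Nat.pair_lt_max_add_one_sq (Encodable.encode a) (Encodable.encode l)
    have h2 : max (Encodable.encode a) (Encodable.encode l) + 1 ≤ 2 ^ (u + 1) := by
      have := Nat.one_le_pow u 2 (by norm_num)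
      have := max_le ha ih
      rw [pow_succ]
      omega
    have h3 : (2 ^ (u + 1)) ^ 2 ≤ 2 ^ (4 ^ (l.length + 1) * (s + 1)) := by
      rw [← pow_mul]
      refine Nat.pow_le_pow_right (by norm_num) ?_
      have : 4 ^ (l.length + 1) * (s + 1) = 4 * u := by rw [hu, pow_succ]; ring
      omega
    have h4 := Nat.pow_le_pow_left h2 2
    simp only [List.length_cons]
    exact (Nat.succ_le_of_lt h1).trans (h4.trans h3)

/-- The table `T` holds the intended values of the first `k` variables of `v` and its neighbours. -/
def Agrees {V : Type} (G : SimpleGraph V) (ident : V → ℕ) (val : ℕ → V → ℕ) (v : V) (k : ℕ)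
    (T : ℕ → ℕ → ℕ) : Prop :=
  ∀ w, w = v ∨ G.Adj v w → ∀ k' < k, T (ident w) k' = val k' w

/-- On the given network and input, the variables of the protocol are `val`, and `rank` bounds the
round in which a variable is computed. -/
structure Spec {V : Type} (P : Protocol In Out) (G : SimpleGraph V) (ident : V → ℕ)
    (input : V → In) (val rank : ℕ → V → ℕ) : Prop where
  ident_inj : Function.Injective ident
  id_eq : ∀ v, P.id (input v) = ident v
  mem_nbrs : ∀ v x, x ∈ P.nbrs (input v) ↔ ∃ w, G.Adj v w ∧ ident w = x
  value_eq : ∀ k < P.numVars, ∀ v T, Agrees G ident val v k T →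
    (∀ w, G.Adj v w → P.sel k (input v) T (ident w) → T (ident w) k = val k w) →
    P.value k (input v) T = val k v
  rank_sel : ∀ k < P.numVars, ∀ v T, Agrees G ident val v k T → ∀ w, G.Adj v w →
    P.sel k (input v) T (ident w) → rank k w + 2 ≤ rank k v
  rank_lt : ∀ k < P.numVars, ∀ k' < k, ∀ v w, rank k' w + 2 ≤ rank k v

namespace Spec

variable {V : Type} {P : Protocol In Out} {G : SimpleGraph V} {ident : V → ℕ} {input : V → In}
  {val rank : ℕ → V → ℕ}

theorem inbox_eq (h : Function.Injective ident) (A : CongestAlgorithm In Out) (σ : V → A.State)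
    {v w : V} (hvw : G.Adj v w) :
    A.inbox G ident σ v (ident w) = A.message ident σ w v := by
  have hex : ∃ u, G.Adj v u ∧ ident u = ident w := ⟨w, hvw, rfl⟩
  rw [CongestAlgorithm.inbox, dif_pos hex]
  rw [h hex.choose_spec.2]

/-- A table that contains only intended values, for the node `v`. -/
def Sound (P : Protocol In Out) (G : SimpleGraph V) (ident : V → ℕ) (val : ℕ → V → ℕ) (v : V)
    (tab : ℕ → ℕ → Option ℕ) : Prop :=
  ∀ w, w = v ∨ G.Adj v w → ∀ k < P.numVars, ∀ a, tab (ident w) k = some a → a = val k w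

theorem total_eq {v w : V} {tab : ℕ → ℕ → Option ℕ} (hs : Sound P G ident val v tab)
    (hw : w = v ∨ G.Adj v w) {k : ℕ} (hk : k < P.numVars) (h : (tab (ident w) k).isSome) :
    total tab (ident w) k = val k w := by
  obtain ⟨a, ha⟩ := Option.isSome_iff_exists.1 h
  rw [total, ha, Option.getD_some]
  exact hs w hw k hk a ha

variable (S : P.Spec G ident input val rank)
include S

theorem mem_insert_nbrs (v w : V) (hw : w = v ∨ G.Adj v w) :
    ident w ∈ insert (P.id (input v)) (P.nbrs (input v)) := by
  rw [Finset.mem_insert, S.id_eq, S.mem_nbrs]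
  rcases hw with rfl | hw
  · exact Or.inl rfl
  · exact Or.inr ⟨w, hw, rfl⟩

theorem forall_insert_nbrs {v : V} {Q : ℕ → Prop} (h : ∀ w, w = v ∨ G.Adj v w → Q (ident w)) :
    ∀ x ∈ insert (P.id (input v)) (P.nbrs (input v)), Q x := by
  intro x hx
  rw [Finset.mem_insert, S.id_eq, S.mem_nbrs] at hx
  rcases hx with rfl | ⟨w, hw, rfl⟩
  · exact h v (Or.inl rfl)
  · exact h w (Or.inr hw)

theorem rule_sound {v : V} {tab : ℕ → ℕ → Option ℕ} (hs : Sound P G ident val v tab) {k : ℕ}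
    (hk : k < P.numVars) {a : ℕ} (ha : P.rule k (input v) tab = some a) : a = val k v := by
  unfold rule at ha
  split_ifs at ha with h
  obtain rfl := Option.some.inj ha
  refine S.value_eq k hk v _ ?_ ?_
  · intro w hw k' hk'
    exact total_eq hs hw (hk'.trans hk) (h.1 _ (S.mem_insert_nbrs v w hw) k' hk')
  · intro w hw hsel
    exact total_eq hs (Or.inr hw) hk (h.2 _ ((S.mem_nbrs v _).2 ⟨w, hw, rfl⟩) hsel)

/-- A variable can be computed once every variable whose rank is lower by two is known: it takes one
round to compute that variable and one to announce it. -/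
theorem rule_isSome {v : V} {tab : ℕ → ℕ → Option ℕ} (hs : Sound P G ident val v tab) {k : ℕ}
    (hk : k < P.numVars) (h : ∀ w, w = v ∨ G.Adj v w → ∀ k' < P.numVars,
      rank k' w + 2 ≤ rank k v → (tab (ident w) k').isSome) :
    (P.rule k (input v) tab).isSome := by
  have h1 : ∀ w, w = v ∨ G.Adj v w → ∀ k' < k, (tab (ident w) k').isSome :=
    fun w hw k' hk' => h w hw k' (hk'.trans hk) (S.rank_lt k hk k' hk' v w)
  unfold rule
  rw [if_pos]
  · rfl
  refine ⟨S.forall_insert_nbrs h1, fun x hx hsel => ?_⟩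
  obtain ⟨w, hw, rfl⟩ := (S.mem_nbrs v x).1 hx
  refine h w (Or.inr hw) k hk (S.rank_sel k hk v _ ?_ w hw hsel)
  exact fun w' hw' k' hk' => total_eq hs hw' (hk'.trans hk) (h1 w' hw' k' hk')

/-- The invariants of the execution after `t` rounds. -/
structure Invariant (S : P.Spec G ident input val rank) (σ : V → State In) (t : ℕ) : Prop where
  inp : ∀ v, (σ v).inp = input v
  sound : ∀ v, Sound P G ident val v (σ v).tab
  own : ∀ v, ∀ k < P.numVars, rank k v ≤ t → ((σ v).tab (ident v) k).isSome
  nbr : ∀ v w, G.Adj v w → ∀ k < P.numVars, rank k w + 1 ≤ t →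
    ((σ v).tab (ident w) k).isSome
  complete : ∀ v, (σ v).done → P.Complete (input v) (σ v).tab
  announced : ∀ v w, G.Adj v w → (σ w).done → ∀ k < P.numVars, ((σ v).tab (ident w) k).isSome
  done : ∀ v, (∀ k < P.numVars, ∀ w, rank k w + 2 ≤ t) → (σ v).done

theorem invariant (hrank : ∀ k v, 1 ≤ rank k v) (hK : 0 < P.numVars) (t : ℕ) :
    S.Invariant (P.algorithm.run G ident input t) t := by
  induction t with
  | zero =>
    have hrun : ∀ v, P.algorithm.run G ident input 0 v = ⟨input v, fun _ _ => none, false⟩ :=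
      fun v => rfl
    constructor
    · intro v; rw [hrun]
    · intro v w _ k _ a ha; rw [hrun] at ha; simp at ha
    · intro v k _ h; have := hrank k v; omega
    · intro v w _ k _ h; omega
    · intro v h; rw [hrun] at h; simp at h
    · intro v w _ h; rw [hrun] at h; simp at h
    · intro v h; have := h 0 hK v; omega
  | succ t I =>
    have hstep : P.algorithm.run G ident input (t + 1) =
        P.algorithm.round G ident (P.algorithm.run G ident input t) :=
      Function.iterate_succ_apply' _ _ _
    set σ := P.algorithm.run G ident input t with hσ
    have hout : ∀ v, (P.algorithm.output (σ v)).isSome = (σ v).done := by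
      intro v
      simp only [algorithm]
      cases (σ v).done <;> simp
    have hmsg : ∀ v w, P.algorithm.message ident σ w v = if (σ w).done then 0 else
        Encodable.encode ((List.range P.numVars).map ((σ w).tab (ident w))) := by
      intro v w
      rw [CongestAlgorithm.message, hout]
      simp only [algorithm, I.inp, S.id_eq]
    have hdone : ∀ v, (σ v).done → P.algorithm.run G ident input (t + 1) v = σ v := by
      intro v hv
      rw [hstep, CongestAlgorithm.round, hout, if_pos hv]
    have hnot : ∀ v, ¬ (σ v).done → P.algorithm.run G ident input (t + 1) v =
        P.algorithm.receive (σ v) (P.algorithm.inbox G ident σ v) := by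
      intro v hv
      rw [hstep, CongestAlgorithm.round, hout, if_neg hv]
    -- the new table of a node that has not stopped
    have hown : ∀ v, ¬ (σ v).done → ∀ k, (P.algorithm.run G ident input (t + 1) v).tab
        (ident v) k = ((σ v).tab (ident v) k).orElse fun _ => P.rule k (input v) (σ v).tab := by
      intro v hv k
      rw [hnot v hv]
      simp only [algorithm, I.inp, S.id_eq, if_true]
    have hnbr : ∀ v w, G.Adj v w → ¬ (σ v).done → ∀ k < P.numVars,
        (P.algorithm.run G ident input (t + 1) v).tab (ident w) k =
        ((σ v).tab (ident w) k).orElse fun _ =>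
          if (σ w).done then none else (σ w).tab (ident w) k := by
      intro v w hvw hv k hk
      have hne : ident w ≠ ident v := fun h => hvw.ne (S.ident_inj h).symm
      have h1 : (P.algorithm.run G ident input (t + 1) v).tab (ident w) k =
          ((σ v).tab (ident w) k).orElse fun _ =>
            decodeRow (P.algorithm.inbox G ident σ v (ident w)) k := by
        rw [hnot v hv]
        simp only [algorithm, I.inp, S.id_eq, hne, if_false]
      rw [h1, inbox_eq S.ident_inj P.algorithm σ hvw, hmsg]
      split_ifs
      · rw [decodeRow_zero]
      · rw [decodeRow_encode _ _ hk]
    have hmono : ∀ v w, w = v ∨ G.Adj v w → ∀ k < P.numVars, ((σ v).tab (ident w) k).isSome →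
        ((P.algorithm.run G ident input (t + 1) v).tab (ident w) k).isSome := by
      intro v w hw k hk hsome
      by_cases hv : (σ v).done
      · rwa [hdone v hv]
      · obtain ⟨a, ha⟩ := Option.isSome_iff_exists.1 hsome
        rcases hw with rfl | hw
        · rw [hown w hv, ha]; rfl
        · rw [hnbr v w hw hv k hk, ha]; rfl
    have hcomp : ∀ v, P.Complete (input v) (σ v).tab →
        P.Complete (input v) (P.algorithm.run G ident input (t + 1) v).tab := by
      intro v hv
      exact S.forall_insert_nbrs fun w hw k hk =>
        hmono v w hw k hk (hv _ (S.mem_insert_nbrs v w hw) k hk)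
    have hdone' : ∀ v, (P.algorithm.run G ident input (t + 1) v).done →
        (σ v).done ∨ P.Complete (input v) (σ v).tab := by
      intro v hv
      by_cases h : (σ v).done
      · exact Or.inl h
      · rw [hnot v h] at hv
        simp only [algorithm, I.inp, decide_eq_true_eq] at hv
        exact Or.inr hv
    constructor
    · intro v
      by_cases hv : (σ v).done
      · rw [hdone v hv, I.inp]
      · rw [hnot v hv]
        exact I.inp v
    · intro v w hw k hk a ha
      by_cases hv : (σ v).done
      · rw [hdone v hv] at ha
        exact I.sound v w hw k hk a ha
      · rcases hw with rfl | hw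
        · rw [hown w hv] at ha
          cases h : (σ w).tab (ident w) k with
          | none =>
            rw [h] at ha
            exact S.rule_sound (I.sound w) hk ha
          | some b =>
            rw [h] at ha
            exact I.sound w w (Or.inl rfl) k hk a (h.trans ha)
        · rw [hnbr v w hw hv k hk] at ha
          cases h : (σ v).tab (ident w) k with
          | none =>
            rw [h] at ha
            simp only [Option.orElse_none] at ha
            split_ifs at ha
            exact I.sound w w (Or.inl rfl) k hk a ha
          | some b =>
            rw [h] at ha
            exact I.sound v w (Or.inr hw) k hk a (h.trans ha)
    · intro v k hk ht
      by_cases hv : (σ v).done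
      · rw [hdone v hv]
        exact I.complete v hv _ (S.mem_insert_nbrs v v (Or.inl rfl)) k hk
      · rw [hown v hv]
        cases h : (σ v).tab (ident v) k with
        | some b => rfl
        | none =>
          refine S.rule_isSome (I.sound v) hk fun w hw k' hk' hr => ?_
          rcases hw with rfl | hw
          · exact I.own w k' hk' (by omega)
          · exact I.nbr v w hw k' hk' (by omega)
    · intro v w hvw k hk ht
      by_cases hv : (σ v).done
      · rw [hdone v hv]
        exact I.complete v hv _ (S.mem_insert_nbrs v w (Or.inr hvw)) k hk
      · by_cases hw : (σ w).done
        · exact hmono v w (Or.inr hvw) k hk (I.announced v w hvw hw k hk)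
        · rw [hnbr v w hvw hv k hk, if_neg hw]
          cases h : (σ v).tab (ident w) k with
          | some b => rfl
          | none => exact I.own w k hk (by omega)
    · intro v hv
      rcases hdone' v hv with h | h
      · exact hcomp v (I.complete v h)
      · exact hcomp v h
    · intro v w hvw hw k hk
      rcases hdone' w hw with h | h
      · exact hmono v w (Or.inr hvw) k hk (I.announced v w hvw h k hk)
      · by_cases hv : (σ v).done
        · rw [hdone v hv]
          exact I.complete v hv _ (S.mem_insert_nbrs v w (Or.inr hvw)) k hk
        · by_cases hw' : (σ w).done
          · exact hmono v w (Or.inr hvw) k hk (I.announced v w hvw hw' k hk)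
          · rw [hnbr v w hvw hv k hk, if_neg hw']
            cases h' : (σ v).tab (ident w) k with
            | some b => rfl
            | none => exact h _ (S.mem_insert_nbrs w w (Or.inl rfl)) k hk
    · intro v ht
      by_cases hv : (σ v).done
      · rwa [hdone v hv]
      · rw [hnot v hv]
        simp only [algorithm, I.inp, decide_eq_true_eq]
        refine S.forall_insert_nbrs fun w hw k hk => ?_
        have := ht k hk w
        rcases hw with rfl | hw
        · exact I.own w k hk (by omega)
        · exact I.nbr v w hw k hk (by omega)

/-- All nodes stop with the right output two rounds after the largest rank. -/
theorem computes (hrank : ∀ k v, 1 ≤ rank k v) (hK : 0 < P.numVars) {result : V → Out}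
    (hres : ∀ v T, Agrees G ident val v P.numVars T → P.result (input v) T = result v) {t : ℕ}
    (ht : ∀ k < P.numVars, ∀ v, rank k v + 2 ≤ t) :
    P.algorithm.Computes G ident input result t := by
  intro v
  have I := S.invariant hrank hK t
  have hd := I.done v ht
  have : P.algorithm.output (P.algorithm.run G ident input t v) = some (P.result (input v)
      (total (P.algorithm.run G ident input t v).tab)) := by
    rw [← I.inp v]
    exact if_pos hd
  rw [this, hres]
  intro w hw k hk
  exact total_eq (I.sound v) hw hk (I.complete v hd _ (S.mem_insert_nbrs v w hw) k hk)

/-- The messages are short because the number of variables is a constant. -/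
theorem usesBandwidth (hrank : ∀ k v, 1 ≤ rank k v) (hK : 0 < P.numVars) {s : ℕ}
    (hval : ∀ k < P.numVars, ∀ v, val k v < 2 ^ s) :
    P.algorithm.UsesBandwidth G ident input (4 ^ P.numVars * (s + 1) + 1) := by
  intro t v w _
  have I := S.invariant hrank hK t
  rw [CongestAlgorithm.message]
  split_ifs
  · simp
  · rw [Nat.size_le]
    have h := encode_le s ((List.range P.numVars).map
      ((P.algorithm.run G ident input t v).tab (ident v))) (fun a ha => ?_)
    · simp only [List.length_map, List.length_range] at h
      have h1 : P.algorithm.send (P.algorithm.run G ident input t v) (ident w) =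
          Encodable.encode ((List.range P.numVars).map
            ((P.algorithm.run G ident input t v).tab (ident v))) := by
        rw [← S.id_eq v, ← I.inp v]
        rfl
      rw [h1]
      exact h.trans_lt (Nat.pow_lt_pow_right (by norm_num) (Nat.lt_succ_self _))
    · obtain ⟨k, hk, hka⟩ := List.mem_map.1 ha
      rw [List.mem_range] at hk
      rw [I.sound v v (Or.inl rfl) k hk a hka]
      exact hval k hk v

end Spec

end Protocol

/-! ### Truncated forests -/

namespace ParentForest

variable {α : Type} {f g : α → α}

theorem exists_child_of_below {u v : α} (h : Below f u v) (hne : u ≠ v) :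
    ∃ w, w ≠ v ∧ f w = v ∧ Below f u w := by
  obtain ⟨i, hi⟩ := h
  induction i generalizing u with
  | zero => exact absurd hi hne
  | succ i ih =>
    by_cases hu : f u = v
    · exact ⟨u, hne, hu, Below.refl u⟩
    · obtain ⟨w, h1, h2, h3⟩ := ih hu (by simpa using hi)
      exact ⟨w, h1, h2, h3.head⟩

/-- Removing parent edges turns a forest into a forest. -/
theorem Grounded.truncate (hf : Grounded f) (h : ∀ x, g x = x ∨ g x = f x) : Grounded g := by
  refine hf.induction ?_ ?_
  · intro x hx
    exact ⟨0, (h x).elim id fun h' => h'.trans hx⟩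
  · rintro x _ ⟨i, hi⟩
    rcases h x with h' | h'
    · exact ⟨0, h'⟩
    · exact ⟨i + 1, by rwa [Function.iterate_succ_apply, h']⟩

theorem Grounded.dist_truncate_le (hf : Grounded f) (h : ∀ x, g x = x ∨ g x = f x) (x : α) :
    dist g x ≤ dist f x := by
  revert x
  refine hf.induction ?_ ?_
  · intro x hx
    rw [dist_of_fixed ((h x).elim id fun h' => h'.trans hx)]
    exact Nat.zero_le _
  · intro x hx ih
    by_cases h' : g x = x
    · rw [dist_of_fixed h']
      exact Nat.zero_le _
    · rw [(hf.truncate h).dist_of_not_fixed h', hf.dist_of_not_fixed hx, (h x).resolve_left h']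
      omega

end ParentForest

/-! ### The new clusters in the network -/

namespace ClusterGraph

open ParentForest CapGraph CapGraph.SpanningTree

variable {V N E : Type} {G : SimpleGraph V} (𝒢 : ClusterGraph G N E)

theorem parent_fixed_iff {v : V} : 𝒢.parent v = v ↔ v = 𝒢.leader (𝒢.cluster v) := by
  constructor
  · intro h
    by_contra hv
    exact (𝒢.parent_adj v hv).ne h.symm
  · intro h
    rw [h, 𝒢.parent_leader]

theorem grounded_parent : Grounded 𝒢.parent := fun v => by
  obtain ⟨i, hi⟩ := 𝒢.reaches_leader v
  exact ⟨i, by rw [hi, 𝒢.parent_leader]⟩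

variable {𝒢} in
theorem cluster_of_below {u v : V} (h : Below 𝒢.parent u v) : 𝒢.cluster u = 𝒢.cluster v := by
  obtain ⟨i, rfl⟩ := h
  induction i generalizing u with
  | zero => rfl
  | succ i ih => rw [Function.iterate_succ_apply, ← ih, 𝒢.cluster_parent]

theorem below_leader (v : V) : Below 𝒢.parent v (𝒢.leader (𝒢.cluster v)) := 𝒢.reaches_leader v

theorem dist_parent_le {d : ℕ} (hd : 𝒢.DepthLE d) (v : V) : dist 𝒢.parent v ≤ d := by
  obtain ⟨i, hi, h⟩ := hd v
  refine le_trans (Nat.sInf_le ?_) hi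
  change 𝒢.parent (𝒢.parent^[i] v) = 𝒢.parent^[i] v
  rw [h, 𝒢.parent_leader]

variable (T : 𝒢.toCapGraph.SpanningTree)

open Classical in
/-- The network edge that represents the tree edge from `c` to its parent, directed upwards; for
the root, the leader twice. -/
noncomputable def link (c : N) : V × V :=
  match T.parentEdge c with
  | some e => if 𝒢.src e = c then 𝒢.psi e else (𝒢.psi e).swap
  | none => (𝒢.leader c, 𝒢.leader c)

/-- The node of `c` at which the tree edge to the parent of `c` is attached. -/
noncomputable def gate (c : N) : V := (𝒢.link T c).1

/-- The node of the parent of `c` at which the tree edge from `c` is attached. -/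
noncomputable def gateTo (c : N) : V := (𝒢.link T c).2

variable {𝒢 T}

theorem link_spec {c : N} {e : E} (h : T.parentEdge c = some e) :
    𝒢.psi e = (𝒢.gate T c, 𝒢.gateTo T c) ∧ 𝒢.src e = c ∧ 𝒢.tgt e = T.parent c ∨
    𝒢.psi e = (𝒢.gateTo T c, 𝒢.gate T c) ∧ 𝒢.src e = T.parent c ∧ 𝒢.tgt e = c := by
  have hne := 𝒢.src_ne_tgt e
  rcases ends_of_parentEdge h with ⟨h1, h2⟩ | ⟨h1, h2⟩
  · left
    simp [gate, gateTo, link, h, h1, h2]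
  · right
    have : 𝒢.src e ≠ c := fun h' => hne (h'.trans h2.symm)
    refine ⟨?_, h1, h2⟩
    simp [gate, gateTo, link, h, this]

theorem gate_adj {c : N} (hc : c ≠ T.root) : G.Adj (𝒢.gate T c) (𝒢.gateTo T c) := by
  obtain ⟨e, h, -⟩ := T.parentEdge_spec c hc
  have := 𝒢.psi_adj e
  rcases link_spec h with ⟨h1, -⟩ | ⟨h1, -⟩
  · rwa [h1] at this
  · rw [h1] at this
    exact this.symm

theorem cluster_gate (c : N) : 𝒢.cluster (𝒢.gate T c) = c := by
  by_cases hc : c = T.root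
  · subst hc
    simp [gate, link, T.parentEdge_root, 𝒢.cluster_leader]
  · obtain ⟨e, h, -⟩ := T.parentEdge_spec c hc
    have h1 := 𝒢.cluster_psi_fst e
    have h2 := 𝒢.cluster_psi_snd e
    rcases link_spec h with ⟨h3, h4, -⟩ | ⟨h3, -, h4⟩
    · rw [h3] at h1
      exact h1.trans h4
    · rw [h3] at h2
      exact h2.trans h4

theorem cluster_gateTo {c : N} (hc : c ≠ T.root) : 𝒢.cluster (𝒢.gateTo T c) = T.parent c := by
  obtain ⟨e, h, -⟩ := T.parentEdge_spec c hc
  have h1 := 𝒢.cluster_psi_fst e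
  have h2 := 𝒢.cluster_psi_snd e
  rcases link_spec h with ⟨h3, -, h4⟩ | ⟨h3, h4, -⟩
  · rw [h3] at h2
    exact h2.trans h4
  · rw [h3] at h1
    exact h1.trans h4

variable (𝒢 T) [Fintype E] (F : Finset E)

open Classical in
/-- Parent function of the forest in `G` that is formed by the cluster trees and the edges of
`T \ F`.  In the cluster tree of a cluster that has a parent in `T \ F`, the path from the gate to
the leader is reversed. -/
noncomputable def up (v : V) : V :=
  if (T.cutTree F).Top (𝒢.cluster v) then 𝒢.parent v
  else if v = 𝒢.gate T (𝒢.cluster v) then 𝒢.gateTo T (𝒢.cluster v)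
  else if h : ∃ w, w ≠ v ∧ 𝒢.parent w = v ∧ Below 𝒢.parent (𝒢.gate T (𝒢.cluster v)) w then
    h.choose
  else 𝒢.parent v

/-- The root of the cluster tree after this reorientation. -/
noncomputable def clusterRoot (c : N) : V :=
  open Classical in if (T.cutTree F).Top c then 𝒢.leader c else 𝒢.gate T c

variable {𝒢 T F}

theorem ne_root_of_not_top {c : N} (h : ¬ (T.cutTree F).Top c) : c ≠ T.root :=
  fun h' => h (Or.inl h')

theorem up_of_top {v : V} (h : (T.cutTree F).Top (𝒢.cluster v)) :
    𝒢.up T F v = 𝒢.parent v := if_pos h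

theorem up_gate {c : N} (h : ¬ (T.cutTree F).Top c) : 𝒢.up T F (𝒢.gate T c) = 𝒢.gateTo T c := by
  simp [up, cluster_gate, h]

/-- On the path from the leader to the gate, `up` leads towards the gate. -/
theorem up_of_child {v : V} (h : ¬ (T.cutTree F).Top (𝒢.cluster v))
    (hv : v ≠ 𝒢.gate T (𝒢.cluster v)) (hb : Below 𝒢.parent (𝒢.gate T (𝒢.cluster v)) v) :
    𝒢.up T F v ≠ v ∧ 𝒢.parent (𝒢.up T F v) = v ∧
      Below 𝒢.parent (𝒢.gate T (𝒢.cluster v)) (𝒢.up T F v) := by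
  have hex := exists_child_of_below hb (Ne.symm hv)
  rw [up, if_neg h, if_neg hv, dif_pos hex]
  exact hex.choose_spec

theorem up_of_not_below {v : V} (hb : ¬ Below 𝒢.parent (𝒢.gate T (𝒢.cluster v)) v) :
    𝒢.up T F v = 𝒢.parent v := by
  have hv : v ≠ 𝒢.gate T (𝒢.cluster v) := fun h => hb (h ▸ Below.refl _)
  unfold up
  split_ifs with h1 h3
  · rfl
  · obtain ⟨w, _, h4, h5⟩ := h3
    exact absurd (h5.trans (h4 ▸ Below.step w)) hb
  · rfl

theorem up_inner {v : V} (h : ¬ (T.cutTree F).Top (𝒢.cluster v))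
    (hv : v ≠ 𝒢.gate T (𝒢.cluster v)) :
    𝒢.cluster (𝒢.up T F v) = 𝒢.cluster v ∧ G.Adj v (𝒢.up T F v) := by
  by_cases hb : Below 𝒢.parent (𝒢.gate T (𝒢.cluster v)) v
  · obtain ⟨h1, h2, h3⟩ := up_of_child h hv hb
    have hc : 𝒢.cluster (𝒢.up T F v) = 𝒢.cluster v := by
      rw [← 𝒢.cluster_parent (𝒢.up T F v), h2]
    refine ⟨hc, ?_⟩
    have := 𝒢.parent_adj (𝒢.up T F v) fun h' => h1 (((𝒢.parent_fixed_iff).2 h').symm.trans h2)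
    rw [h2] at this
    exact this.symm
  · rw [up_of_not_below hb]
    refine ⟨𝒢.cluster_parent v, 𝒢.parent_adj v fun h' => hb ?_⟩
    have := 𝒢.below_leader (𝒢.gate T (𝒢.cluster v))
    rw [cluster_gate, ← h'] at this
    exact this

theorem cluster_up (v : V) : 𝒢.cluster (𝒢.up T F v) = 𝒢.cluster v ∨
    (¬ (T.cutTree F).Top (𝒢.cluster v) ∧ v = 𝒢.gate T (𝒢.cluster v) ∧
      𝒢.cluster (𝒢.up T F v) = T.parent (𝒢.cluster v)) := by
  by_cases h : (T.cutTree F).Top (𝒢.cluster v)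
  · exact Or.inl (by rw [up_of_top h, 𝒢.cluster_parent])
  · by_cases hv : v = 𝒢.gate T (𝒢.cluster v)
    · right
      refine ⟨h, hv, ?_⟩
      have h1 := up_gate (𝒢 := 𝒢) h
      rw [← hv] at h1
      rw [h1, cluster_gateTo (ne_root_of_not_top h)]
    · exact Or.inl (up_inner h hv).1

theorem parent_ne_of_not_top {c : N} (h : ¬ (T.cutTree F).Top c) : T.parent c ≠ c :=
  mt parent_eq_iff.1 (ne_root_of_not_top h)

theorem up_fixed_iff {v : V} : 𝒢.up T F v = v ↔
    (T.cutTree F).Top (𝒢.cluster v) ∧ v = 𝒢.leader (𝒢.cluster v) := by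
  by_cases h : (T.cutTree F).Top (𝒢.cluster v)
  · rw [up_of_top h, parent_fixed_iff]
    simp [h]
  · simp only [h, false_and, iff_false]
    intro hf
    by_cases hv : v = 𝒢.gate T (𝒢.cluster v)
    · have h1 := up_gate (𝒢 := 𝒢) h
      rw [← hv, hf] at h1
      have h2 := cluster_gateTo (𝒢 := 𝒢) (ne_root_of_not_top h)
      rw [← h1] at h2
      exact parent_ne_of_not_top h h2.symm
    · exact (up_inner h hv).2.ne hf.symm

theorem up_adj {v : V} (h : 𝒢.up T F v ≠ v) : G.Adj v (𝒢.up T F v) := by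
  by_cases ht : (T.cutTree F).Top (𝒢.cluster v)
  · rw [up_of_top ht] at h ⊢
    exact 𝒢.parent_adj v (mt 𝒢.parent_fixed_iff.2 h)
  · by_cases hv : v = 𝒢.gate T (𝒢.cluster v)
    · have h1 := up_gate (𝒢 := 𝒢) ht
      have h2 := gate_adj (𝒢 := 𝒢) (ne_root_of_not_top ht)
      rw [← hv] at h1 h2
      rwa [h1]
    · exact (up_inner ht hv).2

/-- In a cluster that is not the top of its component, the reoriented cluster tree leads to the
gate. -/
theorem below_gate {v : V} (h : ¬ (T.cutTree F).Top (𝒢.cluster v)) :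
    Below (𝒢.up T F) v (𝒢.gate T (𝒢.cluster v)) := by
  set g := 𝒢.gate T (𝒢.cluster v) with hg
  have hgc : 𝒢.cluster g = 𝒢.cluster v := cluster_gate _
  have hbelow : ∀ n u, Below 𝒢.parent g u → dist 𝒢.parent g - dist 𝒢.parent u = n →
      Below (𝒢.up T F) u g := by
    intro n
    induction n using Nat.strong_induction_on with
    | _ n ih =>
      intro u hu hn
      by_cases hug : u = g
      · exact hug ▸ Below.refl _
      · have hcu : 𝒢.cluster u = 𝒢.cluster v := (cluster_of_below hu).symm.trans hgc
        obtain ⟨h1, h2, h3⟩ := up_of_child (F := F) (T := T) (v := u) (hcu ▸ h)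
          (by rw [hcu]; exact hug) (by rw [hcu]; exact hu)
        rw [hcu, ← hg] at h3
        have h4 := 𝒢.grounded_parent.dist_of_not_fixed (x := 𝒢.up T F u)
          (fun h' => h1 (h'.symm.trans h2))
        rw [h2] at h4
        have h5 := 𝒢.grounded_parent.dist_le_of_below h3
        exact (ih _ (by omega) (𝒢.up T F u) h3 rfl).head
  have key : ∀ u, 𝒢.cluster u = 𝒢.cluster v → Below (𝒢.up T F) u g := by
    refine 𝒢.grounded_parent.induction ?_ ?_
    · intro u hu hcu
      refine hbelow _ u ?_ rfl
      have := 𝒢.below_leader g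
      rwa [hgc, ← hcu, ← 𝒢.parent_fixed_iff.1 hu] at this
    · intro u hu ih hcu
      by_cases hb : Below 𝒢.parent g u
      · exact hbelow _ u hb rfl
      · have h1 : 𝒢.up T F u = 𝒢.parent u := up_of_not_below (by rw [hcu]; exact hb)
        have h2 := ih ((𝒢.cluster_parent u).trans hcu)
        rw [← h1] at h2
        exact h2.head
  exact key v rfl

/-- Every upward path leaves a cluster at its gate, towards the parent in `T \ F`, until it reaches
a top cluster. -/
theorem grounded_up : Grounded (𝒢.up T F) := by
  have htop : ∀ v, (T.cutTree F).Top (𝒢.cluster v) →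
      ∃ r, Below (𝒢.up T F) v r ∧ 𝒢.up T F r = r := by
    refine 𝒢.grounded_parent.induction ?_ ?_
    · intro v hv h
      exact ⟨v, Below.refl v, (up_of_top h).trans hv⟩
    · intro v _ ih h
      obtain ⟨r, h1, h2⟩ := ih (by rwa [𝒢.cluster_parent])
      rw [← up_of_top h] at h1
      exact ⟨r, h1.head, h2⟩
  have key : ∀ c, ∀ v, 𝒢.cluster v = c → ∃ r, Below (𝒢.up T F) v r ∧ 𝒢.up T F r = r := by
    refine T.grounded.induction ?_ ?_
    · intro c hc v hv
      exact htop v (Or.inl (hv.trans (parent_eq_iff.1 hc)))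
    · intro c _ ih v hv
      by_cases h : (T.cutTree F).Top (𝒢.cluster v)
      · exact htop v h
      · obtain ⟨r, h1, h2⟩ := ih (𝒢.gateTo T (𝒢.cluster v))
          (by rw [cluster_gateTo (ne_root_of_not_top h), hv])
        rw [← up_gate h] at h1
        exact ⟨r, (below_gate h).trans h1.head, h2⟩
  intro v
  obtain ⟨r, ⟨i, rfl⟩, h⟩ := key _ v rfl
  exact ⟨i, h⟩

/-- The depth of the forest, in terms of the sizes of the clusters below the top cluster. -/
theorem dist_up_le [Fintype V] {d L : ℕ} (hd : 𝒢.DepthLE d)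
    (hL : ∀ c i, (∀ k < i, ¬ (T.cutTree F).Top (T.parent^[k] c)) →
      ∑ k ∈ Finset.range i, 𝒢.clusterSize (T.parent^[k] c) ≤ L) (v : V) :
    dist (𝒢.up T F) v ≤ d + L := by
  classical
  set f := 𝒢.up T F with hf
  have hgr : Grounded f := grounded_up
  -- in a top cluster the depth is at most `d`
  have htop : ∀ v, (T.cutTree F).Top (𝒢.cluster v) → dist f v = dist 𝒢.parent v := by
    refine 𝒢.grounded_parent.induction ?_ ?_
    · intro v hv h
      rw [dist_of_fixed hv, dist_of_fixed ((up_of_top h).trans hv)]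
    · intro v hv ih h
      have h1 : f v = 𝒢.parent v := up_of_top h
      rw [𝒢.grounded_parent.dist_of_not_fixed hv, hgr.dist_of_not_fixed (h1 ▸ hv), h1,
        ih (by rwa [𝒢.cluster_parent])]
  set c := 𝒢.cluster v with hc
  set i₀ := sInf {i | (T.cutTree F).Top (T.parent^[i] c)} with hi₀
  have hi₀top : (T.cutTree F).Top (T.parent^[i₀] c) := Nat.sInf_mem (exists_top c)
  have hi₀not : ∀ k < i₀, ¬ (T.cutTree F).Top (T.parent^[k] c) :=
    fun k hk => Nat.notMem_of_lt_sInf hk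
  have hcl : ∀ k, ∃ j ≤ i₀, 𝒢.cluster (f^[k] v) = T.parent^[j] c := by
    intro k
    induction k with
    | zero => exact ⟨0, Nat.zero_le _, rfl⟩
    | succ k ih =>
      obtain ⟨j, hj, h⟩ := ih
      rw [Function.iterate_succ_apply']
      rcases cluster_up (T := T) (F := F) (f^[k] v) with h1 | ⟨h1, _, h2⟩
      · exact ⟨j, hj, h1.trans h⟩
      · rw [h] at h1 h2
        have : j ≠ i₀ := fun h' => h1 (h' ▸ hi₀top)
        exact ⟨j + 1, by omega, by rw [Function.iterate_succ_apply']; exact h2⟩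
  have hex : ∃ k, (T.cutTree F).Top (𝒢.cluster (f^[k] v)) := by
    obtain ⟨k, hk⟩ := hgr v
    exact ⟨k, (up_fixed_iff.1 hk).1⟩
  set m := Nat.find hex with hm
  have hmd : m ≤ dist f v := Nat.find_min' hex (up_fixed_iff.1 (hgr.dist_spec v)).1
  -- the nodes before the top cluster are distinct and lie in the clusters below it
  have hmcard : m ≤ ∑ k ∈ Finset.range i₀, 𝒢.clusterSize (T.parent^[k] c) := by
    have h1 : (Finset.range m).card ≤ ((Finset.range i₀).biUnion fun k =>
        Finset.univ.filter fun u => 𝒢.cluster u = T.parent^[k] c).card := by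
      refine Finset.card_le_card_of_injOn (fun k => f^[k] v) ?_ ?_
      · intro k hk
        have hk : k < m := by simpa using hk
        obtain ⟨j, hj, h⟩ := hcl k
        have hnt := Nat.find_min hex hk
        rw [h] at hnt
        have : j ≠ i₀ := fun h' => hnt (h' ▸ hi₀top)
        simp only [Finset.coe_biUnion, Set.mem_iUnion, Finset.mem_coe, Finset.mem_range,
          Finset.mem_filter, Finset.mem_univ, true_and]
        exact ⟨j, by omega, h⟩
      · refine (hgr.iterate_injOn v).mono fun k hk => ?_
        have hk : k < m := by simpa using hk
        exact (by omega : k ≤ dist f v)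
    rw [Finset.card_range] at h1
    refine h1.trans (Finset.card_biUnion_le.trans (le_of_eq ?_))
    refine Finset.sum_congr rfl fun k _ => ?_
    unfold clusterSize
    congr
  have hdist : dist f v ≤ m + dist f (f^[m] v) := by
    refine Nat.sInf_le ?_
    have := hgr.dist_spec (f^[m] v)
    rw [← Function.iterate_add_apply, add_comm] at this
    exact this
  have h1 := htop (f^[m] v) (Nat.find_spec hex)
  have h2 := 𝒢.dist_parent_le hd (f^[m] v)
  have h3 := hL c i₀ hi₀not
  omega

theorem clusterRoot_of_top {c : N} (h : (T.cutTree F).Top c) :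
    𝒢.clusterRoot T F c = 𝒢.leader c := if_pos h

theorem clusterRoot_of_not_top {c : N} (h : ¬ (T.cutTree F).Top c) :
    𝒢.clusterRoot T F c = 𝒢.gate T c := if_neg h

theorem cluster_clusterRoot (c : N) : 𝒢.cluster (𝒢.clusterRoot T F c) = c := by
  unfold clusterRoot
  split_ifs
  · exact 𝒢.cluster_leader c
  · exact cluster_gate c

theorem clusterRoot_inj {c c' : N} (h : 𝒢.clusterRoot T F c = 𝒢.clusterRoot T F c') : c = c' := by
  rw [← cluster_clusterRoot (𝒢 := 𝒢) (T := T) (F := F) c, h, cluster_clusterRoot]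

variable (𝒢 T F)

open Classical in
/-- The forest `up`, restricted to the clusters. -/
noncomputable def inner (v : V) : V :=
  if 𝒢.cluster (𝒢.up T F v) = 𝒢.cluster v then 𝒢.up T F v else v

open Classical in
/-- The forest `up` without the edges that represent cut edges: the new cluster trees. -/
noncomputable def final [Fintype N] (v : V) : V :=
  if (T.cutTree F).Cut (𝒢.cluster v) ∧ v = 𝒢.gate T (𝒢.cluster v) then v else 𝒢.up T F v

variable {𝒢 T F}

theorem inner_or (v : V) : 𝒢.inner T F v = v ∨ 𝒢.inner T F v = 𝒢.up T F v := by
  unfold inner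
  split_ifs
  · exact Or.inr rfl
  · exact Or.inl rfl

theorem grounded_inner : Grounded (𝒢.inner T F) := grounded_up.truncate inner_or

theorem cluster_inner (v : V) : 𝒢.cluster (𝒢.inner T F v) = 𝒢.cluster v := by
  unfold inner
  split_ifs with h
  · exact h
  · rfl

theorem inner_fixed_iff {v : V} :
    𝒢.inner T F v = v ↔ v = 𝒢.clusterRoot T F (𝒢.cluster v) := by
  by_cases h : (T.cutTree F).Top (𝒢.cluster v)
  · have h1 : 𝒢.cluster (𝒢.up T F v) = 𝒢.cluster v := by rw [up_of_top h, 𝒢.cluster_parent]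
    rw [inner, if_pos h1, up_fixed_iff, clusterRoot_of_top h]
    simp [h]
  · rw [clusterRoot_of_not_top h]
    by_cases hv : v = 𝒢.gate T (𝒢.cluster v)
    · simp only [← hv, iff_true]
      rw [inner, if_neg]
      have h1 := up_gate (𝒢 := 𝒢) h
      rw [← hv] at h1
      rw [h1, cluster_gateTo (ne_root_of_not_top h)]
      exact parent_ne_of_not_top h
    · obtain ⟨h1, h2⟩ := up_inner h hv
      rw [inner, if_pos h1]
      simp only [hv, iff_false]
      exact h2.ne.symm

theorem rootOf_inner (v : V) : rootOf (𝒢.inner T F) v = 𝒢.clusterRoot T F (𝒢.cluster v) := by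
  revert v
  refine (grounded_inner (𝒢 := 𝒢) (T := T) (F := F)).induction ?_ ?_
  · intro v hv
    rw [rootOf_of_fixed hv]
    exact inner_fixed_iff.1 hv
  · intro v _ ih
    rw [← grounded_inner.rootOf_parent, ih, cluster_inner]

variable [Fintype N]

theorem final_or (v : V) : 𝒢.final T F v = v ∨ 𝒢.final T F v = 𝒢.up T F v := by
  unfold final
  split_ifs
  · exact Or.inl rfl
  · exact Or.inr rfl

theorem grounded_final : Grounded (𝒢.final T F) := grounded_up.truncate final_or

theorem final_fixed_iff {v : V} : 𝒢.final T F v = v ↔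
    (T.cutTree F).PieceTop (𝒢.cluster v) ∧ v = 𝒢.clusterRoot T F (𝒢.cluster v) := by
  by_cases h : (T.cutTree F).Top (𝒢.cluster v)
  · rw [final, if_neg fun h' => h'.1.not_top h, up_fixed_iff, clusterRoot_of_top h]
    simp [h, CutTree.PieceTop]
  · rw [clusterRoot_of_not_top h]
    have hup : 𝒢.up T F v ≠ v := fun h' => h (up_fixed_iff.1 h').1
    simp only [CutTree.PieceTop, h, false_or]
    unfold final
    split_ifs with h'
    · simp only [true_iff]
      exact h'
    · simp only [hup, false_iff]
      exact h'

theorem pieceTop_cluster_final (v : V) : (T.cutTree F).pieceTop (𝒢.cluster (𝒢.final T F v)) =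
    (T.cutTree F).pieceTop (𝒢.cluster v) := by
  rcases final_or (𝒢 := 𝒢) (T := T) (F := F) v with h | h
  · rw [h]
  · rw [h]
    rcases cluster_up (𝒢 := 𝒢) (T := T) (F := F) v with h1 | ⟨h1, h2, h3⟩
    · rw [h1]
    · have hc : ¬ (T.cutTree F).Cut (𝒢.cluster v) := by
        intro hc
        have : 𝒢.final T F v = v := by
          rw [final, if_pos ⟨hc, h2⟩]
        exact h1 (up_fixed_iff.1 (h.symm.trans this)).1
      rw [h3, CutTree.pieceTop_of_not_mem (x := 𝒢.cluster v) (fun h' => h'.elim h1 hc)]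
      rfl

/-- The trees of the forest `final` are the pieces. -/
theorem rootOf_final (v : V) : rootOf (𝒢.final T F) v =
    𝒢.clusterRoot T F ((T.cutTree F).pieceTop (𝒢.cluster v)) := by
  revert v
  refine (grounded_final (𝒢 := 𝒢) (T := T) (F := F)).induction ?_ ?_
  · intro v hv
    obtain ⟨h1, h2⟩ := final_fixed_iff.1 hv
    rw [rootOf_of_fixed hv, CutTree.pieceTop_of_mem h1]
    exact h2
  · intro v _ ih
    rw [← grounded_final.rootOf_parent, ih, pieceTop_cluster_final]

theorem portal_cluster_root (x : N) :
    (T.cutTree F).portal (𝒢.cluster (𝒢.clusterRoot T F ((T.cutTree F).pieceTop x))) =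
      (T.cutTree F).portal x := by
  rw [cluster_clusterRoot, CutTree.portal_eq_iff, CutTree.pieceTop_of_mem (CutTree.pieceTop_mem x)]

variable (𝒢 T F)

open Classical in
/-- The core nodes of the `j`-tree. -/
noncomputable def coreNodes : Finset N := Finset.univ.filter (T.cutTree F).Portal

variable {𝒢 T F} in
theorem portal_mem_coreNodes (x : N) : (T.cutTree F).portal x ∈ 𝒢.coreNodes T F := by
  simp [coreNodes, CutTree.portal_mem]

open Classical in
/-- The new cluster graph. -/
noncomputable def newClusters :
    ClusterGraph G {p // p ∈ 𝒢.coreNodes T F} {e : T.JEdge F // e ∉ {e | T.Kept F e.1}} where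
  src e := ⟨(T.cutTree F).portal (𝒢.src e.1.1), portal_mem_coreNodes _⟩
  tgt e := ⟨(T.cutTree F).portal (𝒢.tgt e.1.1), portal_mem_coreNodes _⟩
  src_ne_tgt e h := (e.1.2.resolve_left e.2) (CutTree.portal_eq_iff.1 (Subtype.ext_iff.1 h))
  cap e := T.capH F e.1.1
  cluster v := ⟨(T.cutTree F).portal (𝒢.cluster v), portal_mem_coreNodes _⟩
  leader p := 𝒢.clusterRoot T F ((T.cutTree F).pieceTop p)
  cluster_leader p := Subtype.ext <| by
    change (T.cutTree F).portal _ = p.1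
    rw [portal_cluster_root]
    exact CutTree.portal_of_portal (Finset.mem_filter.1 p.2).2
  parent := 𝒢.final T F
  parent_leader p := by
    rw [final_fixed_iff, cluster_clusterRoot]
    exact ⟨CutTree.pieceTop_mem _, rfl⟩
  parent_adj v hv := by
    have h1 : 𝒢.final T F v ≠ v := by
      intro h
      apply hv
      change v = 𝒢.clusterRoot T F ((T.cutTree F).pieceTop ((T.cutTree F).portal (𝒢.cluster v)))
      rw [CutTree.pieceTop_portal, ← rootOf_final, rootOf_of_fixed h]
    have h2 := (final_or v).resolve_left h1
    rw [h2] at h1 ⊢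
    exact up_adj h1
  cluster_parent v := Subtype.ext (CutTree.portal_eq_iff.2 (pieceTop_cluster_final v))
  reaches_leader v := by
    refine ⟨dist (𝒢.final T F) v, ?_⟩
    change rootOf (𝒢.final T F) v =
      𝒢.clusterRoot T F ((T.cutTree F).pieceTop ((T.cutTree F).portal (𝒢.cluster v)))
    rw [rootOf_final, CutTree.pieceTop_portal]
  psi e := 𝒢.psi e.1.1
  psi_adj e := 𝒢.psi_adj _
  cluster_psi_fst e := Subtype.ext (congrArg (T.cutTree F).portal (𝒢.cluster_psi_fst _))
  cluster_psi_snd e := Subtype.ext (congrArg (T.cutTree F).portal (𝒢.cluster_psi_snd _))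

/-- The `j`-tree with its representation on the network: every edge keeps its representative. -/
noncomputable def clusteredJTree (hpsi : EdgewiseInjective 𝒢.psi) (hF : F ⊆ T.edges) {j : ℕ}
    (hj : 1 ≤ j) (hFj : 4 * F.card ≤ j) : ClusteredJTree 𝒢 j (T.JEdge F) where
  J := T.jGraph F
  forest := {e | T.Kept F e.1}
  core := 𝒢.coreNodes T F
  isJTree := isJTree_jGraph hF hj hFj
  phys e := 𝒢.psi e.1
  phys_adj e := 𝒢.psi_adj e.1
  phys_injective e e' h := Subtype.ext (hpsi _ _ h)
  phys_forest e he := by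
    have he : T.Kept F e.1 := he
    simp only [jGraph, he, if_true]
    exact ⟨𝒢.cluster_psi_fst _, 𝒢.cluster_psi_snd _⟩
  clusters := 𝒢.newClusters T F
  clusters_induced v := reachable_iff_pieceTop.2 (CutTree.pieceTop_portal _).symm
  clusters_src e := by
    have he : ¬ T.Kept F e.1.1 := e.2
    simp only [jGraph, he, if_false, newClusters]
  clusters_tgt e := by
    have he : ¬ T.Kept F e.1.1 := e.2
    simp only [jGraph, he, if_false, newClusters]
  clusters_cap e := by
    have he : ¬ T.Kept F e.1.1 := e.2
    simp only [jGraph, he, if_false, newClusters]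
  clusters_psi e := rfl

theorem depthLE_newClusters {d' : ℕ} (h : ∀ v, dist (𝒢.up T F) v ≤ d') :
    (𝒢.newClusters T F).DepthLE d' := by
  intro v
  refine ⟨dist (𝒢.final T F) v, (grounded_up.dist_truncate_le final_or v).trans (h v), ?_⟩
  change rootOf (𝒢.final T F) v =
    𝒢.clusterRoot T F ((T.cutTree F).pieceTop ((T.cutTree F).portal (𝒢.cluster v)))
  rw [rootOf_final, CutTree.pieceTop_portal]

end ClusterGraph

/-! ### What the nodes know initially -/

/-- With distinct identifiers and distinct representatives, a node recognizes the edge that is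
represented by a network edge. -/
theorem edgeTowards_eq_some {V E : Type} {psi : E → V × V} {ident : V → ℕ}
    (hid : Function.Injective ident) (hpsi : EdgewiseInjective psi) {v w : V} {e : E} :
    edgeTowards psi ident v (ident w) = some e ↔ psi e = (v, w) ∨ psi e = (w, v) := by
  have huniq : ∀ e e' : E, (psi e = (v, w) ∨ psi e = (w, v)) →
      (psi e' = (v, w) ∨ psi e' = (w, v)) → e = e' := by
    intro e e' h h'
    refine hpsi e e' ?_
    rcases h with h | h <;> rcases h' with h' | h' <;> rw [h, h'] <;> simp [Sym2.eq_swap]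
  unfold edgeTowards
  split_ifs with h
  · obtain ⟨w', h1, h2⟩ := h.choose_spec
    obtain rfl := hid h1
    constructor
    · intro h'
      rw [← Option.some.inj h']
      exact h2
    · intro h'
      rw [huniq _ _ h2 h']
  · simp only [false_iff]
    exact fun h' => h ⟨e, w, rfl, h'⟩

theorem exists_of_edgeTowards {V E : Type} {psi : E → V × V} {ident : V → ℕ} {v : V} {x : ℕ}
    {e : E} (h : edgeTowards psi ident v x = some e) :
    ∃ w, ident w = x ∧ (psi e = (v, w) ∨ psi e = (w, v)) := by
  unfold edgeTowards at h
  split_ifs at h with h1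
  obtain rfl := Option.some.inj h
  exact h1.choose_spec

namespace ClusterGraph

open ParentForest ParentForest.Grounded CapGraph CapGraph.SpanningTree

variable {V N E : Type} [Fintype V] [Fintype E] {G : SimpleGraph V}
  {𝒢 : ClusterGraph G N E} {T : 𝒢.toCapGraph.SpanningTree} {F : Finset E} {ident : V → ℕ}

/-- Assumptions on a network whose nodes know `(𝒢, T, F)`. -/
structure ValidInput (𝒢 : ClusterGraph G N E) (T : 𝒢.toCapGraph.SpanningTree) (F : Finset E)
    (ident : V → ℕ) : Prop where
  ident_inj : Function.Injective ident
  psi_inj : EdgewiseInjective 𝒢.psi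
  subset : F ⊆ T.edges

variable (X : 𝒢.ValidInput T F ident)

theorem mem_nbrs_iff {v : V} {x : ℕ} :
    x ∈ (jTreeInput 𝒢 ident T F v).nbrs ↔ ∃ w, G.Adj v w ∧ ident w = x := by
  simp [jTreeInput]

theorem sum_nbrs (h : Function.Injective ident) (v : V) (p : ℕ → Prop) [DecidablePred p]
    [DecidablePred fun w => G.Adj v w ∧ p (ident w)] (g : ℕ → ℕ) :
    ∑ x ∈ (jTreeInput 𝒢 ident T F v).nbrs with p x, g x =
      ∑ w with G.Adj v w ∧ p (ident w), g (ident w) := by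
  classical
  symm
  refine Finset.sum_bij (fun w _ => ident w) ?_ ?_ ?_ ?_
  · intro w hw
    simp only [Finset.mem_filter, Finset.mem_univ, true_and] at hw
    exact Finset.mem_filter.2 ⟨mem_nbrs_iff.2 ⟨w, hw.1, rfl⟩, hw.2⟩
  · intro w _ w' _ h'
    exact h h'
  · intro x hx
    obtain ⟨h1, h2⟩ := Finset.mem_filter.1 hx
    obtain ⟨w, h3, rfl⟩ := mem_nbrs_iff.1 h1
    exact ⟨w, by simp [h2, h3], rfl⟩
  · intro w _
    rfl

include X in
theorem tree_eq_of_psi {v w : V} {e : E} (h : 𝒢.psi e = (v, w) ∨ 𝒢.psi e = (w, v))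
    (he : e ∈ T.edges) : ∃ t, (jTreeInput 𝒢 ident T F v).tree (ident w) = some t ∧
      (t.isChild = true ↔ T.lower e = 𝒢.cluster v) ∧
      (t.inF = true ↔ (T.cutTree F).Top (T.lower e)) ∧
      t.capT = (T.cutTree F).w (T.lower e) := by
  have h1 := (edgeTowards_eq_some X.ident_inj X.psi_inj).2 h
  classical
  refine ⟨⟨decide (T.lower e = 𝒢.cluster v), decide (e ∈ F), T.capT e⟩, ?_, ?_, ?_, ?_⟩
  · simp only [jTreeInput, h1, Option.bind_some, he, if_true]
  · simp
  · simp [top_lower_iff he]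
  · rw [cutTree_w he]

include X in
/-- The knowledge of a child cluster about the edge to its parent. -/
theorem tree_gate {c : N} (hc : c ≠ T.root) : ∃ t,
    (jTreeInput 𝒢 ident T F (𝒢.gate T c)).tree (ident (𝒢.gateTo T c)) = some t ∧
      t.isChild = true ∧ (t.inF = true ↔ (T.cutTree F).Top c) ∧
      t.capT = (T.cutTree F).w c := by
  obtain ⟨e, he, h1, h2⟩ := exists_parentEdge hc
  obtain ⟨t, h3, h4, h5, h6⟩ := tree_eq_of_psi X (v := 𝒢.gate T c) (w := 𝒢.gateTo T c) (e := e)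
    ((link_spec h1).imp And.left And.left) he
  rw [h2] at h4 h5 h6
  exact ⟨t, h3, h4.2 (cluster_gate c).symm, h5, h6⟩

include X in
/-- The knowledge of a parent cluster about the edge to a child. -/
theorem tree_gateTo {c : N} (hc : c ≠ T.root) : ∃ t,
    (jTreeInput 𝒢 ident T F (𝒢.gateTo T c)).tree (ident (𝒢.gate T c)) = some t ∧
      t.isChild = false ∧ (t.inF = true ↔ (T.cutTree F).Top c) ∧
      t.capT = (T.cutTree F).w c := by
  obtain ⟨e, he, h1, h2⟩ := exists_parentEdge hc
  obtain ⟨t, h3, h4, h5, h6⟩ := tree_eq_of_psi X (v := 𝒢.gateTo T c) (w := 𝒢.gate T c) (e := e)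
    ((link_spec h1).symm.imp And.left And.left) he
  rw [h2] at h4 h5 h6
  refine ⟨t, h3, ?_, h5, h6⟩
  rw [← Bool.not_eq_true, h4, cluster_gateTo hc]
  exact fun h => hc (parent_eq_iff.1 h.symm)

include X in
/-- A network edge that represents a tree edge joins a gate to the node at which it is attached. -/
theorem gates_of_tree {v w : V} {t : TreeEdgeView}
    (h : (jTreeInput 𝒢 ident T F v).tree (ident w) = some t) : ∃ c, c ≠ T.root ∧
      ((v = 𝒢.gate T c ∧ w = 𝒢.gateTo T c ∧ t.isChild = true) ∨
        (v = 𝒢.gateTo T c ∧ w = 𝒢.gate T c ∧ t.isChild = false)) := by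
  simp only [jTreeInput, Option.bind_eq_some_iff] at h
  obtain ⟨e, he, h⟩ := h
  have hT : e ∈ T.edges := by
    by_contra h'
    simp [h'] at h
  have h1 := (edgeTowards_eq_some X.ident_inj X.psi_inj).1 he
  have hpe := mem_edges.1 hT
  have hc := ne_root_of_parentEdge hpe
  refine ⟨T.lower e, hc, ?_⟩
  have hv : (v = 𝒢.gate T (T.lower e) ∧ w = 𝒢.gateTo T (T.lower e)) ∨
      (v = 𝒢.gateTo T (T.lower e) ∧ w = 𝒢.gate T (T.lower e)) := by
    rcases h1 with h1 | h1 <;> rcases link_spec hpe with ⟨h2, -⟩ | ⟨h2, -⟩ <;>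
      rw [h1, Prod.mk.injEq] at h2 <;> simp [h2]
  rcases hv with ⟨rfl, rfl⟩ | ⟨rfl, rfl⟩
  · obtain ⟨t', h2, h3, -⟩ := tree_gate X hc
    left
    simp only [jTreeInput, he, Option.bind_some] at h2
    rw [h] at h2
    obtain rfl := Option.some.inj h2
    exact ⟨rfl, rfl, h3⟩
  · obtain ⟨t', h2, h3, -⟩ := tree_gateTo X hc
    right
    simp only [jTreeInput, he, Option.bind_some] at h2
    rw [h] at h2
    obtain rfl := Option.some.inj h2
    exact ⟨rfl, rfl, h3⟩

include X in
theorem tree_none_of_cluster {v w : V} (h : 𝒢.cluster v = 𝒢.cluster w) :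
    (jTreeInput 𝒢 ident T F v).tree (ident w) = none := by
  rw [Option.eq_none_iff_forall_ne_some]
  intro t ht
  obtain ⟨c, hc, ⟨rfl, rfl, -⟩ | ⟨rfl, rfl, -⟩⟩ := gates_of_tree X ht
  · rw [cluster_gate, cluster_gateTo hc] at h
    exact hc (parent_eq_iff.1 h.symm)
  · rw [cluster_gate, cluster_gateTo hc] at h
    exact hc (parent_eq_iff.1 h)

/-- The node with identifier `x` is the parent of `v` in another cluster, and the edge between them
is not in `F`. -/
def IsUpEdge (inp : JTreeInput) (x : ℕ) : Prop :=
  ∃ t, inp.tree x = some t ∧ t.isChild = true ∧ t.inF = false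

/-- The edge to the node with identifier `x` represents an edge of `F` to a child cluster. -/
def IsCutChildEdge (inp : JTreeInput) (x : ℕ) : Prop :=
  ∃ t, inp.tree x = some t ∧ t.isChild = false ∧ t.inF = true

include X in
theorem isUpEdge_iff {v w : V} : IsUpEdge (jTreeInput 𝒢 ident T F v) (ident w) ↔
    ¬ (T.cutTree F).Top (𝒢.cluster v) ∧ v = 𝒢.gate T (𝒢.cluster v) ∧
      w = 𝒢.gateTo T (𝒢.cluster v) := by
  constructor
  · rintro ⟨t, h1, h2, h3⟩
    obtain ⟨c, hc, ⟨rfl, rfl, -⟩ | ⟨-, -, h4⟩⟩ := gates_of_tree X h1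
    · obtain ⟨t', h4, -, h5, -⟩ := tree_gate X hc
      obtain rfl := Option.some.inj (h1.symm.trans h4)
      rw [cluster_gate, ← h5, h3]
      simp
    · simp [h4] at h2
  · rintro ⟨h1, h2, h3⟩
    obtain ⟨t, h4, h5, h6, -⟩ := tree_gate X (ne_root_of_not_top h1)
    rw [← h2, ← h3] at h4
    exact ⟨t, h4, h5, by rw [← Bool.not_eq_true, h6]; exact h1⟩

include X in
theorem isCutChildEdge_iff {v w : V} : IsCutChildEdge (jTreeInput 𝒢 ident T F v) (ident w) ↔
    ∃ c, ((T.cutTree F).Top c ∧ c ≠ T.root ∧ 𝒢.gateTo T c = v) ∧ 𝒢.gate T c = w := by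
  constructor
  · rintro ⟨t, h1, h2, h3⟩
    obtain ⟨c, hc, ⟨-, -, h4⟩ | ⟨rfl, rfl, -⟩⟩ := gates_of_tree X h1
    · simp [h4] at h2
    · obtain ⟨t', h4, -, h5, -⟩ := tree_gateTo X hc
      obtain rfl := Option.some.inj (h1.symm.trans h4)
      exact ⟨c, ⟨h5.1 h3, hc, rfl⟩, rfl⟩
  · rintro ⟨c, ⟨h1, hc, rfl⟩, rfl⟩
    obtain ⟨t, h4, h5, h6, -⟩ := tree_gateTo X hc
    exact ⟨t, h4, h5, h6.2 h1⟩

/-! ### Convergecasts on the network -/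

variable [Fintype N]

/-- The children in the forest `up` are the children within the cluster and the gates of the
child clusters attached at `v`. -/
theorem sum_up_children [DecidableEq V] (v : V) (h : V → ℕ)
    [DecidablePred fun c => ¬ (T.cutTree F).Top c ∧ 𝒢.gateTo T c = v] :
    ∑ w with 𝒢.up T F w = v ∧ w ≠ v, h w =
      ∑ w with 𝒢.inner T F w = v ∧ w ≠ v, h w +
      ∑ c with ¬ (T.cutTree F).Top c ∧ 𝒢.gateTo T c = v, h (𝒢.gate T c) := by
  classical
  have h1 : ∑ c with ¬ (T.cutTree F).Top c ∧ 𝒢.gateTo T c = v, h (𝒢.gate T c) =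
      ∑ w with (𝒢.up T F w = v ∧ w ≠ v) ∧ 𝒢.cluster w ≠ 𝒢.cluster v, h w := by
    refine Finset.sum_bij (fun c _ => 𝒢.gate T c) ?_ ?_ ?_ (fun _ _ => rfl)
    · intro c hc
      simp only [Finset.mem_filter, Finset.mem_univ, true_and] at hc ⊢
      have hne : 𝒢.cluster (𝒢.gate T c) ≠ 𝒢.cluster v := by
        rw [← hc.2, cluster_gate, cluster_gateTo (ne_root_of_not_top hc.1)]
        exact (parent_ne_of_not_top hc.1).symm
      exact ⟨⟨(up_gate hc.1).trans hc.2, fun h' => hne (congrArg _ h')⟩, hne⟩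
    · intro c _ c' _ h'
      simpa [cluster_gate] using congrArg 𝒢.cluster h'
    · intro w hw
      simp only [Finset.mem_filter, Finset.mem_univ, true_and] at hw
      obtain ⟨⟨h1, _⟩, h3⟩ := hw
      rcases cluster_up (𝒢 := 𝒢) (T := T) (F := F) w with h4 | ⟨h4, h5, -⟩
      · rw [h1] at h4
        exact absurd h4.symm h3
      · refine ⟨𝒢.cluster w, ?_, h5.symm⟩
        have := up_gate (𝒢 := 𝒢) h4
        rw [← h5, h1] at this
        simp [h4, ← this]
  have h2 : Finset.univ.filter (fun w => 𝒢.inner T F w = v ∧ w ≠ v) =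
      Finset.univ.filter (fun w => (𝒢.up T F w = v ∧ w ≠ v) ∧ 𝒢.cluster w = 𝒢.cluster v) := by
    ext w
    simp only [Finset.mem_filter, Finset.mem_univ, true_and]
    unfold inner
    split_ifs with h3
    · constructor
      · rintro ⟨rfl, h4⟩
        exact ⟨⟨rfl, h4⟩, h3.symm⟩
      · exact fun h => h.1
    · constructor
      · rintro ⟨rfl, h4⟩
        exact absurd rfl h4
      · rintro ⟨⟨rfl, _⟩, h5⟩
        exact absurd h5.symm h3
  rw [h1, h2]
  have := Finset.sum_filter_add_sum_filter_not
    (Finset.univ.filter fun w => 𝒢.up T F w = v ∧ w ≠ v) (fun w => 𝒢.cluster w = 𝒢.cluster v) h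
  rw [Finset.filter_filter, Finset.filter_filter] at this
  exact this.symm

variable (𝒢 T F)

open Classical in
/-- Number of branches attached at `u`. -/
noncomputable def localCnt (u : V) : ℕ :=
  2 * (Finset.univ.filter fun c => (T.cutTree F).Top c ∧ c ≠ T.root ∧ 𝒢.gateTo T c = u).card +
    ∑ c with ¬ (T.cutTree F).Top c ∧ 𝒢.gateTo T c = u, if (T.cutTree F).Marked c then 1 else 0

open Classical in
/-- Sum of the chain minima of the marked child clusters attached at `u`. -/
noncomputable def localMin (u : V) : ℕ :=
  ∑ c with ¬ (T.cutTree F).Top c ∧ 𝒢.gateTo T c = u,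
    if (T.cutTree F).Marked c then (T.cutTree F).lowMin c else 0

open Classical in
/-- Sum of the chain minima of the marked child clusters.  It matters only if there is just one of
them. -/
noncomputable def childMin (c : N) : ℕ :=
  ∑ c' ∈ (T.cutTree F).markedChildren c, (T.cutTree F).lowMin c'

open Classical in
/-- What the children of `c` have to know about its chain: `0` if `c` is a portal, and otherwise
the successor of the chain minimum if `c` is marked. -/
noncomputable def chainCode (c : N) : ℕ :=
  if (T.cutTree F).Portal c then 0
  else if (T.cutTree F).Marked c then (T.cutTree F).chainMin c + 1 else 1

variable {𝒢 T F}

omit [Fintype E] in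
/-- Sums over the child clusters, grouped by the nodes of `c` at which they are attached. -/
theorem sum_cluster {g : N → ℕ} {P : N → Prop} (hP : ∀ c, P c → c ≠ T.root) (c : N)
    [DecidablePred fun u => 𝒢.cluster u = c] [∀ u, DecidablePred fun c' => P c' ∧ 𝒢.gateTo T c' = u]
    [DecidablePred fun c' => P c' ∧ T.parent c' = c] :
    ∑ u with 𝒢.cluster u = c, ∑ c' with P c' ∧ 𝒢.gateTo T c' = u, g c' =
      ∑ c' with P c' ∧ T.parent c' = c, g c' := by
  classical
  rw [Finset.sum_comm' (t' := Finset.univ.filter fun c' => P c' ∧ T.parent c' = c)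
    (s' := fun c' => {𝒢.gateTo T c'})]
  · simp
  · intro u c'
    simp only [Finset.mem_filter, Finset.mem_univ, true_and, Finset.mem_singleton]
    constructor
    · rintro ⟨h1, h2, h3⟩
      exact ⟨h3.symm, h2, by rw [← cluster_gateTo (𝒢 := 𝒢) (hP c' h2), h3, h1]⟩
    · rintro ⟨h1, h2, h3⟩
      exact ⟨by rw [h1, cluster_gateTo (hP c' h2), h3], h2, h1.symm⟩

omit [Fintype N] in
theorem subtreeSum_clusterRoot (l : V → ℕ) (c : N) [DecidablePred fun u => 𝒢.cluster u = c] :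
    subtreeSum (𝒢.inner T F) l (𝒢.clusterRoot T F c) = ∑ u with 𝒢.cluster u = c, l u := by
  classical
  have hfix : 𝒢.inner T F (𝒢.clusterRoot T F c) = 𝒢.clusterRoot T F c :=
    inner_fixed_iff.2 (by rw [cluster_clusterRoot])
  rw [grounded_inner.subtreeSum_of_fixed l hfix]
  refine Finset.sum_congr ?_ fun _ _ => rfl
  ext u
  simp only [Finset.mem_filter, Finset.mem_univ, true_and, rootOf_inner]
  exact ⟨clusterRoot_inj, fun h => by rw [h]⟩

theorem subtreeSum_localCnt (c : N) : subtreeSum (𝒢.inner T F) (𝒢.localCnt T F)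
    (𝒢.clusterRoot T F c) = (T.cutTree F).cnt c := by
  classical
  rw [subtreeSum_clusterRoot]
  unfold localCnt
  rw [Finset.sum_add_distrib, ← Finset.mul_sum]
  simp only [Finset.card_eq_sum_ones, ← and_assoc]
  rw [sum_cluster (P := fun c => (T.cutTree F).Top c ∧ c ≠ T.root) (fun c h => h.2),
    sum_cluster (P := fun c => ¬ (T.cutTree F).Top c) (fun c h => ne_root_of_not_top h)]
  rw [CutTree.cnt, CutTree.cutChildren, CutTree.markedChildren, Finset.card_eq_sum_ones,
    Finset.card_eq_sum_ones, ← Finset.sum_filter, Finset.filter_filter]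
  congr 2
  · refine Finset.sum_congr ?_ fun _ _ => rfl
    ext c'
    simp only [Finset.mem_filter, Finset.mem_univ, true_and]
    simp only [cutTree]
    tauto
  · ext c'
    simp only [Finset.mem_filter, Finset.mem_univ, true_and]
    simp only [cutTree]
    tauto

theorem subtreeSum_localMin (c : N) : subtreeSum (𝒢.inner T F) (𝒢.localMin T F)
    (𝒢.clusterRoot T F c) = 𝒢.childMin T F c := by
  classical
  rw [subtreeSum_clusterRoot]
  unfold localMin
  rw [sum_cluster (P := fun c => ¬ (T.cutTree F).Top c) (fun c h => ne_root_of_not_top h)]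
  rw [childMin, CutTree.markedChildren, ← Finset.sum_filter, Finset.filter_filter]
  refine Finset.sum_congr ?_ fun _ _ => rfl
  ext c'
  simp only [Finset.mem_filter, Finset.mem_univ, true_and]
  simp only [cutTree]
  tauto

omit [Fintype V] in
/-- A marked node that is not a portal has exactly one marked child, whose chain it continues. -/
theorem exists_chain_child {c : N} (h : (T.cutTree F).cnt c = 1) :
    ∃ u, ¬ (T.cutTree F).Top u ∧ (T.cutTree F).Marked u ∧ T.parent u = c ∧
      𝒢.childMin T F c = (T.cutTree F).lowMin u := by
  have h1 : ((T.cutTree F).markedChildren c).card = 1 := by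
    unfold CutTree.cnt at h
    omega
  obtain ⟨u, hu⟩ := Finset.card_eq_one.1 h1
  have hmem : u ∈ (T.cutTree F).markedChildren c := by simp [hu]
  simp only [CutTree.markedChildren, Finset.mem_filter] at hmem
  obtain ⟨-, h2, h3, h4⟩ := hmem
  exact ⟨u, h2, h3, h4, by simp [childMin, hu]⟩

/-- The chain minimum up to a node, from the number of branches, the chain minimum below, and the
weight of the parent edge. -/
def lowMinCode (cnt m w : ℕ) : ℕ := if cnt = 1 then min m w else w

omit [Fintype V] in
theorem lowMinCode_eq {c : N} (hc : ¬ (T.cutTree F).Top c) (hm : (T.cutTree F).Marked c) :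
    lowMinCode ((T.cutTree F).cnt c) (𝒢.childMin T F c) ((T.cutTree F).w c) =
      (T.cutTree F).lowMin c := by
  unfold lowMinCode
  split_ifs with h
  · obtain ⟨u, h1, h2, h3, h4⟩ := exists_chain_child (𝒢 := 𝒢) h
    have hp : ¬ (T.cutTree F).Portal ((T.cutTree F).par u) := by
      change ¬ (T.cutTree F).Portal (T.parent u)
      rw [h3]
      rintro (h' | h')
      · exact hc h'
      · omega
    have := CutTree.lowMin_parent h1 h2 hp
    change (T.cutTree F).lowMin (T.parent u) = min _ ((T.cutTree F).w (T.parent u)) at this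
    rw [h3] at this
    rw [h4, this]
  · have := CutTree.marked_iff.1 hm
    exact (CutTree.lowMin_of_portal ⟨Or.inr (by omega), hc⟩).symm

/-- The chain minimum, from the same data and the code of the parent. -/
def chainMinCode (cnt m w y : ℕ) : ℕ := if y = 0 then lowMinCode cnt m w else y - 1

omit [Fintype V] in
theorem chainMinCode_eq {c : N} (hc : ¬ (T.cutTree F).Top c) (hm : (T.cutTree F).Marked c) :
    chainMinCode ((T.cutTree F).cnt c) (𝒢.childMin T F c) ((T.cutTree F).w c)
      (chainCode 𝒢 T F (T.parent c)) = (T.cutTree F).chainMin c := by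
  have hm' : (T.cutTree F).Marked (T.parent c) := hm.parent hc
  unfold chainMinCode chainCode
  by_cases hp : (T.cutTree F).Portal (T.parent c)
  · simp only [hp, if_true]
    rw [lowMinCode_eq hc hm]
    exact (CutTree.chainMin_of_portal hc hm hp).symm
  · simp only [hp, hm', if_true, if_false, Nat.add_eq_zero_iff, one_ne_zero, and_false,
      Nat.add_sub_cancel]
    exact (CutTree.chainMin_parent hc hm hp).symm

/-- Whether the parent edge of a node is cut, from the same data. -/
def CutCode (cnt m w y : ℕ) : Prop :=
  1 ≤ cnt ∧ w = chainMinCode cnt m w y ∧ (2 ≤ cnt ∨ chainMinCode cnt m w y < m)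

omit [Fintype V] in
theorem cutCode_iff {c : N} (hc : ¬ (T.cutTree F).Top c) :
    CutCode ((T.cutTree F).cnt c) (𝒢.childMin T F c) ((T.cutTree F).w c)
      (chainCode 𝒢 T F (T.parent c)) ↔ (T.cutTree F).Cut c := by
  by_cases hm : (T.cutTree F).Marked c
  · have h1 := CutTree.marked_iff.1 hm
    rw [CutCode, chainMinCode_eq hc hm]
    by_cases h2 : 2 ≤ (T.cutTree F).cnt c
    · rw [CutTree.cut_iff_of_portal ⟨Or.inr h2, hc⟩]
      simp [h1, h2]
    · have h0 : (T.cutTree F).cnt c = 1 := by omega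
      obtain ⟨u, h3, h4, h5, h6⟩ := exists_chain_child (𝒢 := 𝒢) h0
      have hp : ¬ (T.cutTree F).Portal ((T.cutTree F).par u) := by
        change ¬ (T.cutTree F).Portal (T.parent u)
        rw [h5]
        rintro (h' | h')
        · exact hc h'
        · exact h2 h'
      have := CutTree.cut_parent_iff h3 h4 hp
      change (T.cutTree F).Cut (T.parent u) ↔ (T.cutTree F).w (T.parent u) =
        (T.cutTree F).chainMin (T.parent u) ∧
        (T.cutTree F).chainMin (T.parent u) < _ at this
      rw [h5] at this
      rw [this, h6]
      simp [h1, h2]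
  · refine ⟨fun h => absurd (CutTree.marked_iff.2 h.1) hm, fun h => absurd h.marked hm⟩

end ClusterGraph

/-! ### The distributed construction of the `j`-tree -/

open Classical in
/-- The sum of `g` over the neighbours whose variable `k` names the node itself, that is, over its
children in the forest that this variable describes. -/
noncomputable def childSum (inp : JTreeInput) (tab : ℕ → ℕ → ℕ) (k : ℕ) (g : ℕ → ℕ) : ℕ :=
  ∑ x ∈ inp.nbrs with tab x k = inp.id, g x

namespace ClusterGraph

open ParentForest ParentForest.Grounded CapGraph CapGraph.SpanningTree

open Classical in
/-- The variables of a node.  They are, in this order: the parent in the cluster tree; whether the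
gate of the cluster is below the node; the parent in the forest `up`; the two convergecasts of
`localCnt` and `localMin` over the clusters, which end at the cluster root with the number of
branches and the chain minimum from below; the chain code of the cluster; the parent in the forest `final`; the
number of nodes and the identifier of the portal below the node in this forest; and the root, the
size and the portal of the new cluster. -/
noncomputable def jTreeValue (k : ℕ) (inp : JTreeInput) (tab : ℕ → ℕ → ℕ) : ℕ :=
  let own := tab inp.id
  match k with
  | 0 => inp.clusters.parent.getD inp.id
  | 1 => (if ∃ x ∈ inp.nbrs, IsUpEdge inp x then 1 else 0) + childSum inp tab 0 (tab · 1)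
  | 2 =>
    if h : ∃ x ∈ inp.nbrs, IsUpEdge inp x then h.choose
    else if h : ∃ x ∈ inp.nbrs, tab x 0 = inp.id ∧ 1 ≤ tab x 1 then h.choose
    else own 0
  | 3 => 2 * (inp.nbrs.filter (IsCutChildEdge inp)).card + childSum inp tab 2 fun x =>
      match inp.tree x with
      | none => tab x 3
      | some _ => if 1 ≤ tab x 3 then 1 else 0
  | 4 => childSum inp tab 2 fun x =>
      match inp.tree x with
      | none => tab x 4
      | some t => if 1 ≤ tab x 3 then lowMinCode (tab x 3) (tab x 4) t.capT else 0
  | 5 =>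
    if own 2 = inp.id then 0 else
      match inp.tree (own 2) with
      | none => tab (own 2) 5
      | some t =>
        if 2 ≤ own 3 then 0 else if own 3 = 0 then 1
        else chainMinCode (own 3) (own 4) t.capT (tab (own 2) 5) + 1
  | 6 =>
    if own 2 = inp.id then inp.id else
      match inp.tree (own 2) with
      | none => own 2
      | some t => if CutCode (own 3) (own 4) t.capT (tab (own 2) 5) then inp.id else own 2
  | 7 => 1 + childSum inp tab 6 (tab · 7)
  | 8 =>
    (if own 2 = inp.id ∨ (inp.tree (own 2) ≠ none ∧ 2 ≤ own 3) then inp.clusters.clusterId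
      else 0) + childSum inp tab 6 (tab · 8)
  | 9 => if own 6 = inp.id then inp.id else tab (own 6) 9
  | 10 => if own 6 = inp.id then own 7 else tab (own 6) 10
  | 11 => if own 6 = inp.id then own 8 else tab (own 6) 11
  | _ => 0

/-- The neighbours whose variable of the same index is needed: convergecasts wait for the children,
broadcasts for the parent. -/
def jTreeSel (k : ℕ) (inp : JTreeInput) (tab : ℕ → ℕ → ℕ) (x : ℕ) : Prop :=
  match k with
  | 1 => tab x 0 = inp.id
  | 3 | 4 => tab x 2 = inp.id
  | 5 => x = tab inp.id 2
  | 7 | 8 => tab x 6 = inp.id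
  | 9 | 10 | 11 => x = tab inp.id 6
  | _ => False

/-- The capacity in `H(T,F)` of the edge to the node with identifier `x`, which has capacity `cap`
in the cluster graph. -/
def coreCap (inp : JTreeInput) (x cap : ℕ) : ℕ :=
  match inp.tree x with
  | some t => if t.inF then cap else t.capT
  | none => cap

open Classical in
/-- The output of a node. -/
noncomputable def jTreeResult (inp : JTreeInput) (tab : ℕ → ℕ → ℕ) : JTreeOutput where
  clusters :=
    { clusterId := tab inp.id 9
      clusterSize := tab inp.id 10
      parent := if tab inp.id 6 = inp.id then none else some (tab inp.id 6)
      edge := fun x => (inp.clusters.edge x).bind fun r =>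
        if tab x 9 = tab inp.id 9 then none else some (tab x 9, coreCap inp x r.2) }
  jEdge x := (inp.clusters.edge x).bind fun r =>
    if (inp.tree x).isSome ∧ (tab x 6 = inp.id ∨ tab inp.id 6 = x) then
      (inp.tree x).map fun t => ⟨inp.clusters.clusterId, r.1, true, 4 * t.capT⟩
    else if tab x 9 = tab inp.id 9 then none
    else some ⟨tab inp.id 11, tab x 11, false, coreCap inp x r.2⟩

/-- The construction of the `j`-tree as a protocol. -/
noncomputable def jTreeProtocol : Protocol JTreeInput JTreeOutput where
  numVars := 12
  id := JTreeInput.id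
  nbrs := JTreeInput.nbrs
  sel := jTreeSel
  value := jTreeValue
  result := jTreeResult

variable {V N E : Type} [Fintype V] [Fintype E] {G : SimpleGraph V}

section Values

variable [Fintype N] (𝒢 : ClusterGraph G N E) (T : 𝒢.toCapGraph.SpanningTree) (F : Finset E)
  (ident : V → ℕ)

open Classical in
/-- Marks the node through which a cluster is connected to its parent in `T \ F`. -/
noncomputable def gateMark (u : V) : ℕ :=
  if ¬ (T.cutTree F).Top (𝒢.cluster u) ∧ u = 𝒢.gate T (𝒢.cluster u) then 1 else 0

open Classical in
/-- The identifier of a portal, stored at the root of its cluster. -/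
noncomputable def portalMark (u : V) : ℕ :=
  if u = 𝒢.clusterRoot T F (𝒢.cluster u) ∧ (T.cutTree F).Portal (𝒢.cluster u) then
    𝒢.clusterId ident (𝒢.cluster u) else 0

/-- The meaning of the variables of the protocol. -/
noncomputable def jTreeVal (k : ℕ) (v : V) : ℕ :=
  match k with
  | 0 => ident (𝒢.parent v)
  | 1 => subtreeSum 𝒢.parent (𝒢.gateMark T F) v
  | 2 => ident (𝒢.up T F v)
  | 3 => subtreeSum (𝒢.inner T F) (𝒢.localCnt T F) v
  | 4 => subtreeSum (𝒢.inner T F) (𝒢.localMin T F) v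
  | 5 => 𝒢.chainCode T F (𝒢.cluster v)
  | 6 => ident (𝒢.final T F v)
  | 7 => subtreeSum (𝒢.final T F) (fun _ => 1) v
  | 8 => subtreeSum (𝒢.final T F) (𝒢.portalMark T F ident) v
  | 9 => ident (rootOf (𝒢.final T F) v)
  | 10 => subtreeSum (𝒢.final T F) (fun _ => 1) (rootOf (𝒢.final T F) v)
  | 11 => subtreeSum (𝒢.final T F) (𝒢.portalMark T F ident) (rootOf (𝒢.final T F) v)
  | _ => 0

end Values

variable {𝒢 : ClusterGraph G N E} {T : 𝒢.toCapGraph.SpanningTree} {F : Finset E} {ident : V → ℕ}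
  {v : V} {tab : ℕ → ℕ → ℕ}

theorem exists_nbrs {P : ℕ → Prop} : (∃ x ∈ (jTreeInput 𝒢 ident T F v).nbrs, P x) ↔
    ∃ w, G.Adj v w ∧ P (ident w) := by
  constructor
  · rintro ⟨x, hx, h⟩
    obtain ⟨w, hw, rfl⟩ := mem_nbrs_iff.1 hx
    exact ⟨w, hw, h⟩
  · rintro ⟨w, hw, h⟩
    exact ⟨_, mem_nbrs_iff.2 ⟨w, hw, rfl⟩, h⟩

/-- `childSum` ranges over the children in the forest that variable `k` describes. -/
theorem childSum_eq [DecidableEq V] (hid : Function.Injective ident) {f : V → V}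
    (hf : ∀ w, f w ≠ w → G.Adj w (f w)) {k : ℕ}
    (hk : ∀ w, G.Adj v w → tab (ident w) k = ident (f w)) {g : ℕ → ℕ} {h : V → ℕ}
    (hg : ∀ w, G.Adj v w → f w = v → g (ident w) = h w) :
    childSum (jTreeInput 𝒢 ident T F v) tab k g = ∑ w with f w = v ∧ w ≠ v, h w := by
  classical
  rw [childSum, sum_nbrs hid]
  refine Finset.sum_congr ?_ ?_
  · ext w
    simp only [Finset.mem_filter, Finset.mem_univ, true_and]
    constructor
    · rintro ⟨h1, h2⟩
      rw [hk w h1] at h2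
      exact ⟨hid h2, h1.ne.symm⟩
    · rintro ⟨h1, h2⟩
      have h3 := (hf w fun h => h2 (h.symm.trans h1)).symm
      rw [h1] at h3
      exact ⟨h3, (hk w h3).trans (congrArg ident h1)⟩
  · intro w hw
    simp only [Finset.mem_filter, Finset.mem_univ, true_and] at hw
    obtain ⟨h1, h2⟩ := hw
    have h3 := (hf w fun h => h2 (h.symm.trans h1)).symm
    rw [h1] at h3
    exact hg w h3 h1

variable (X : 𝒢.ValidInput T F ident)
include X

theorem exists_isUpEdge_iff : (∃ x ∈ (jTreeInput 𝒢 ident T F v).nbrs,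
    IsUpEdge (jTreeInput 𝒢 ident T F v) x) ↔
    ¬ (T.cutTree F).Top (𝒢.cluster v) ∧ v = 𝒢.gate T (𝒢.cluster v) := by
  rw [exists_nbrs]
  constructor
  · rintro ⟨w, -, h⟩
    exact ⟨((isUpEdge_iff X).1 h).1, ((isUpEdge_iff X).1 h).2.1⟩
  · rintro ⟨h1, h2⟩
    refine ⟨𝒢.gateTo T (𝒢.cluster v), ?_, (isUpEdge_iff X).2 ⟨h1, h2, rfl⟩⟩
    have := gate_adj (𝒢 := 𝒢) (ne_root_of_not_top h1)
    rwa [← h2] at this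

omit X in
theorem jTreeValue_parent : jTreeValue 0 (jTreeInput 𝒢 ident T F v) tab = ident (𝒢.parent v) := by
  classical
  change (if v = 𝒢.leader (𝒢.cluster v) then none else some (ident (𝒢.parent v))).getD (ident v) = _
  split_ifs with h
  · rw [𝒢.parent_fixed_iff.2 h]; rfl
  · rfl

theorem jTreeValue_gateMark (h0 : ∀ w, G.Adj v w → tab (ident w) 0 = ident (𝒢.parent w))
    (h1 : ∀ w, G.Adj v w → 𝒢.parent w = v →
      tab (ident w) 1 = subtreeSum 𝒢.parent (𝒢.gateMark T F) w) :
    jTreeValue 1 (jTreeInput 𝒢 ident T F v) tab = subtreeSum 𝒢.parent (𝒢.gateMark T F) v := by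
  classical
  rw [𝒢.grounded_parent.subtreeSum_eq]
  simp only [jTreeValue]
  rw [childSum_eq X.ident_inj (f := 𝒢.parent) (fun w hw => 𝒢.parent_adj w fun h => hw
    (𝒢.parent_fixed_iff.2 h)) h0 h1]
  simp only [exists_isUpEdge_iff X, gateMark]

omit X in
/-- The number of gates below `w` tells whether `w` lies on the path from the leader to the gate. -/
theorem one_le_gateSum {w : V} : 1 ≤ subtreeSum 𝒢.parent (𝒢.gateMark T F) w ↔
    ¬ (T.cutTree F).Top (𝒢.cluster w) ∧ Below 𝒢.parent (𝒢.gate T (𝒢.cluster w)) w := by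
  classical
  rw [subtreeSum, Nat.one_le_iff_ne_zero, Ne, Finset.sum_eq_zero_iff, not_forall]
  constructor
  · rintro ⟨u, hu⟩
    simp only [Finset.mem_filter, Finset.mem_univ, true_and, gateMark, Classical.not_imp] at hu
    obtain ⟨h1, h2⟩ := hu
    have h3 : ¬ (T.cutTree F).Top (𝒢.cluster u) ∧ u = 𝒢.gate T (𝒢.cluster u) := by
      by_contra h
      exact h2 (if_neg h)
    rw [← cluster_of_below h1]
    exact ⟨h3.1, h3.2 ▸ h1⟩
  · rintro ⟨h1, h2⟩
    refine ⟨𝒢.gate T (𝒢.cluster w), ?_⟩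
    simp [gateMark, h2, cluster_gate, h1]

/-- The parent in the forest `up` is the node across the gate edge, or the only child through which
the gate is reached, or the parent in the cluster tree. -/
theorem jTreeValue_up (h0 : tab (ident v) 0 = ident (𝒢.parent v))
    (h0' : ∀ w, G.Adj v w → tab (ident w) 0 = ident (𝒢.parent w))
    (h1 : ∀ w, G.Adj v w → tab (ident w) 1 = subtreeSum 𝒢.parent (𝒢.gateMark T F) w) :
    jTreeValue 2 (jTreeInput 𝒢 ident T F v) tab = ident (𝒢.up T F v) := by
  simp only [jTreeValue]
  split_ifs with h2 h3
  · obtain ⟨h3, h4⟩ := h2.choose_spec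
    obtain ⟨w, -, h5⟩ := mem_nbrs_iff.1 h3
    rw [← h5] at h4 ⊢
    obtain ⟨h6, h7, h8⟩ := (isUpEdge_iff X).1 h4
    have h9 := up_gate (𝒢 := 𝒢) h6
    rw [← h7] at h9
    rw [h8, h9]
  · obtain ⟨h4, h5, h6⟩ := h3.choose_spec
    obtain ⟨w, h7, h8⟩ := mem_nbrs_iff.1 h4
    rw [← h8] at h5 h6 ⊢
    rw [h0' w h7] at h5
    have h5 := X.ident_inj h5
    rw [h1 w h7, one_le_gateSum] at h6
    rw [exists_isUpEdge_iff X] at h2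
    have hcl : 𝒢.cluster w = 𝒢.cluster v := by rw [← h5, 𝒢.cluster_parent]
    rw [hcl] at h6
    have hv : v ≠ 𝒢.gate T (𝒢.cluster v) := fun h => h2 ⟨h6.1, h⟩
    have hwv : Below 𝒢.parent w v := h5 ▸ Below.step w
    obtain ⟨h9, h10, h11⟩ := up_of_child h6.1 hv (h6.2.trans hwv)
    -- the gate is reached through only one child of `v`
    have key : ∀ a b : V, 𝒢.parent a = v → 𝒢.parent b = v → b ≠ v → Below 𝒢.parent a b → a = b := by
      intro a b ha hb hbv hab
      by_contra hne
      have h12 : Below 𝒢.parent v b := by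
        rcases below_iff.1 hab with h | h
        · exact absurd h hne
        · rwa [ha] at h
      exact hbv (𝒢.grounded_parent.below_antisymm (hb ▸ Below.step b) h12)
    congr 1
    rcases h6.2.total h11 with h | h
    · exact key _ _ h5 h10 h9 h
    · exact (key _ _ h10 h5 h7.ne.symm h).symm
  · change tab (ident v) 0 = _
    rw [h0]
    congr 1
    by_cases htop : (T.cutTree F).Top (𝒢.cluster v)
    · exact (up_of_top htop).symm
    rw [exists_isUpEdge_iff X] at h2
    have hv : v ≠ 𝒢.gate T (𝒢.cluster v) := fun h => h2 ⟨htop, h⟩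
    refine (up_of_not_below fun hb => h3 ?_).symm
    obtain ⟨h4, h5, h6⟩ := up_of_child htop hv hb
    obtain ⟨h7, h8⟩ := up_inner htop hv
    rw [exists_nbrs]
    refine ⟨_, h8, by rw [h0' _ h8, h5]; rfl, ?_⟩
    rw [h1 _ h8, one_le_gateSum, h7]
    exact ⟨htop, h6⟩

variable [Fintype N]

/-- The three kinds of nodes in the forest `up`: roots, nodes whose parent lies in the same cluster,
and gates. -/
theorem up_cases (v : V) :
    (𝒢.up T F v = v ∧ (T.cutTree F).Top (𝒢.cluster v) ∧ v = 𝒢.clusterRoot T F (𝒢.cluster v)) ∨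
    (𝒢.up T F v ≠ v ∧ 𝒢.cluster (𝒢.up T F v) = 𝒢.cluster v ∧
      v ≠ 𝒢.clusterRoot T F (𝒢.cluster v) ∧
      ¬ ((T.cutTree F).Cut (𝒢.cluster v) ∧ v = 𝒢.gate T (𝒢.cluster v)) ∧
      (jTreeInput 𝒢 ident T F v).tree (ident (𝒢.up T F v)) = none) ∨
    (𝒢.up T F v ≠ v ∧ ¬ (T.cutTree F).Top (𝒢.cluster v) ∧ v = 𝒢.gate T (𝒢.cluster v) ∧
      v = 𝒢.clusterRoot T F (𝒢.cluster v) ∧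
      𝒢.cluster (𝒢.up T F v) = T.parent (𝒢.cluster v) ∧
      ∃ t, (jTreeInput 𝒢 ident T F v).tree (ident (𝒢.up T F v)) = some t ∧
        t.capT = (T.cutTree F).w (𝒢.cluster v)) := by
  by_cases h1 : 𝒢.up T F v = v
  · left
    have h2 := up_fixed_iff.1 h1
    exact ⟨h1, h2.1, by rw [clusterRoot_of_top h2.1]; exact h2.2⟩
  · right
    by_cases h2 : 𝒢.cluster (𝒢.up T F v) = 𝒢.cluster v
    · left
      have h3 : v ≠ 𝒢.clusterRoot T F (𝒢.cluster v) := by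
        rw [Ne, ← inner_fixed_iff, inner, if_pos h2]
        exact h1
      refine ⟨h1, h2, h3, ?_, tree_none_of_cluster X h2.symm⟩
      rintro ⟨h4, h5⟩
      rw [clusterRoot_of_not_top h4.not_top] at h3
      exact h3 h5
    · right
      obtain ⟨h3, h4, h5⟩ := (cluster_up v).resolve_left h2
      obtain ⟨t, h6, -, -, h7⟩ := tree_gate X (ne_root_of_not_top h3)
      have h8 := up_gate (𝒢 := 𝒢) h3
      rw [← h4] at h8 h6
      rw [← h8] at h6
      exact ⟨h1, h3, h4, by rw [clusterRoot_of_not_top h3]; exact h4, h5, t, h6, h7⟩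

omit [Fintype V] X in
theorem final_adj {w : V} (h : 𝒢.final T F w ≠ w) : G.Adj w (𝒢.final T F w) := by
  have h2 := (final_or w).resolve_left h
  rw [h2] at h ⊢
  exact up_adj h

omit X in
theorem subtreeSum_localCnt_gate {c : N} (h : ¬ (T.cutTree F).Top c) :
    subtreeSum (𝒢.inner T F) (𝒢.localCnt T F) (𝒢.gate T c) = (T.cutTree F).cnt c := by
  rw [← clusterRoot_of_not_top (𝒢 := 𝒢) h, subtreeSum_localCnt]

omit X in
theorem subtreeSum_localMin_gate {c : N} (h : ¬ (T.cutTree F).Top c) :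
    subtreeSum (𝒢.inner T F) (𝒢.localMin T F) (𝒢.gate T c) = 𝒢.childMin T F c := by
  rw [← clusterRoot_of_not_top (𝒢 := 𝒢) h, subtreeSum_localMin]

/-- A sum over the children of a node in the forest `up` in which the gates of child clusters and
the other children contribute differently. -/
theorem childSum_up [DecidableEq V] (h2 : ∀ w, G.Adj v w → tab (ident w) 2 = ident (𝒢.up T F w))
    {g : ℕ → ℕ} {a : V → ℕ} {b : N → ℕ}
    (ha : ∀ w, 𝒢.up T F w = v → w ≠ v →
      (jTreeInput 𝒢 ident T F v).tree (ident w) = none → g (ident w) = a w)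
    (hb : ∀ c t, ¬ (T.cutTree F).Top c → 𝒢.gateTo T c = v → 𝒢.up T F (𝒢.gate T c) = v →
      (jTreeInput 𝒢 ident T F v).tree (ident (𝒢.gate T c)) = some t →
      t.capT = (T.cutTree F).w c → g (ident (𝒢.gate T c)) = b c)
    [DecidablePred fun c => ¬ (T.cutTree F).Top c ∧ 𝒢.gateTo T c = v] :
    childSum (jTreeInput 𝒢 ident T F v) tab 2 g =
      ∑ w with 𝒢.inner T F w = v ∧ w ≠ v, a w +
      ∑ c with ¬ (T.cutTree F).Top c ∧ 𝒢.gateTo T c = v, b c := by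
  classical
  rw [childSum_eq X.ident_inj (fun w hw => up_adj hw) h2 (h := fun w => g (ident w))
    (fun _ _ _ => rfl)]
  rw [sum_up_children]
  congr 1
  · refine Finset.sum_congr rfl fun w hw => ?_
    simp only [Finset.mem_filter, Finset.mem_univ, true_and] at hw
    obtain ⟨h3, h4⟩ := hw
    have h5 : 𝒢.up T F w = v := by
      rcases inner_or (𝒢 := 𝒢) (T := T) (F := F) w with h | h
      · exact absurd (h.symm.trans h3) h4
      · exact h.symm.trans h3
    refine ha w h5 h4 (tree_none_of_cluster X ?_)
    rw [← h3, cluster_inner]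
  · refine Finset.sum_congr rfl fun c hc => ?_
    simp only [Finset.mem_filter, Finset.mem_univ, true_and] at hc
    obtain ⟨t, h3, -, -, h4⟩ := tree_gateTo X (ne_root_of_not_top hc.1)
    rw [hc.2] at h3
    exact hb c t hc.1 hc.2 ((up_gate hc.1).trans hc.2) h3 h4

theorem jTreeValue_cnt (h2 : ∀ w, G.Adj v w → tab (ident w) 2 = ident (𝒢.up T F w))
    (h3 : ∀ w, G.Adj v w → 𝒢.up T F w = v →
      tab (ident w) 3 = subtreeSum (𝒢.inner T F) (𝒢.localCnt T F) w) :
    jTreeValue 3 (jTreeInput 𝒢 ident T F v) tab =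
      subtreeSum (𝒢.inner T F) (𝒢.localCnt T F) v := by
  classical
  have hadj : ∀ w, 𝒢.up T F w = v → w ≠ v → G.Adj v w := by
    rintro w rfl h
    exact (up_adj (Ne.symm h)).symm
  rw [grounded_inner.subtreeSum_eq]
  simp only [jTreeValue]
  rw [childSum_up X h2 (a := subtreeSum (𝒢.inner T F) (𝒢.localCnt T F))
    (b := fun c => if (T.cutTree F).Marked c then 1 else 0)]
  · have hcard : ((jTreeInput 𝒢 ident T F v).nbrs.filter
        (IsCutChildEdge (jTreeInput 𝒢 ident T F v))).card =
        (Finset.univ.filter fun c =>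
          (T.cutTree F).Top c ∧ c ≠ T.root ∧ 𝒢.gateTo T c = v).card := by
      symm
      refine Finset.card_bij (fun c _ => ident (𝒢.gate T c)) ?_ ?_ ?_
      · intro c hc
        simp only [Finset.mem_filter, Finset.mem_univ, true_and] at hc
        refine Finset.mem_filter.2 ⟨mem_nbrs_iff.2 ⟨_, ?_, rfl⟩,
          (isCutChildEdge_iff X).2 ⟨c, hc, rfl⟩⟩
        rw [← hc.2.2]
        exact (gate_adj hc.2.1).symm
      · intro c _ c' _ h
        simpa [cluster_gate] using congrArg 𝒢.cluster (X.ident_inj h)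
      · intro x hx
        obtain ⟨h4, h5⟩ := Finset.mem_filter.1 hx
        obtain ⟨w, -, rfl⟩ := mem_nbrs_iff.1 h4
        obtain ⟨c, h6, h7⟩ := (isCutChildEdge_iff X).1 h5
        exact ⟨c, by simpa using h6, by rw [h7]⟩
    rw [hcard, localCnt]
    omega
  · intro w h4 h5 h6
    simp only [h6]
    exact h3 w (hadj w h4 h5) h4
  · intro c t h4 h5 h6 h7 _
    simp only [h7]
    have h8 : G.Adj v (𝒢.gate T c) := by
      rw [← h5]
      exact (gate_adj (ne_root_of_not_top h4)).symm
    rw [h3 _ h8 h6, subtreeSum_localCnt_gate h4]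
    exact if_congr CutTree.marked_iff.symm rfl rfl

theorem jTreeValue_min (h2 : ∀ w, G.Adj v w → tab (ident w) 2 = ident (𝒢.up T F w))
    (h3 : ∀ w, G.Adj v w → tab (ident w) 3 = subtreeSum (𝒢.inner T F) (𝒢.localCnt T F) w)
    (h4 : ∀ w, G.Adj v w → 𝒢.up T F w = v →
      tab (ident w) 4 = subtreeSum (𝒢.inner T F) (𝒢.localMin T F) w) :
    jTreeValue 4 (jTreeInput 𝒢 ident T F v) tab =
      subtreeSum (𝒢.inner T F) (𝒢.localMin T F) v := by
  classical
  have hadj : ∀ w, 𝒢.up T F w = v → w ≠ v → G.Adj v w := by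
    rintro w rfl h
    exact (up_adj (Ne.symm h)).symm
  rw [grounded_inner.subtreeSum_eq]
  simp only [jTreeValue]
  rw [childSum_up X h2 (a := subtreeSum (𝒢.inner T F) (𝒢.localMin T F))
    (b := fun c => if (T.cutTree F).Marked c then (T.cutTree F).lowMin c else 0)]
  · rw [localMin]
    omega
  · intro w h5 h6 h7
    simp only [h7]
    exact h4 w (hadj w h5 h6) h5
  · intro c t h5 h6 h7 h8 h9
    simp only [h8]
    have h10 : G.Adj v (𝒢.gate T c) := by
      rw [← h6]
      exact (gate_adj (ne_root_of_not_top h5)).symm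
    rw [h3 _ h10, h4 _ h10 h7, subtreeSum_localCnt_gate h5, subtreeSum_localMin_gate h5, h9]
    by_cases h11 : (T.cutTree F).Marked c
    · rw [if_pos (CutTree.marked_iff.1 h11), if_pos h11, lowMinCode_eq h5 h11]
    · rw [if_neg (mt CutTree.marked_iff.2 h11), if_neg h11]

theorem jTreeValue_chainCode (h2 : tab (ident v) 2 = ident (𝒢.up T F v))
    (h3 : tab (ident v) 3 = subtreeSum (𝒢.inner T F) (𝒢.localCnt T F) v)
    (h4 : tab (ident v) 4 = subtreeSum (𝒢.inner T F) (𝒢.localMin T F) v)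
    (h5 : 𝒢.up T F v ≠ v →
      tab (ident (𝒢.up T F v)) 5 = 𝒢.chainCode T F (𝒢.cluster (𝒢.up T F v))) :
    jTreeValue 5 (jTreeInput 𝒢 ident T F v) tab = 𝒢.chainCode T F (𝒢.cluster v) := by
  have hid : (jTreeInput 𝒢 ident T F v).id = ident v := rfl
  simp only [jTreeValue]
  rw [hid, h2, h3, h4]
  have hne := fun h : ident (𝒢.up T F v) = ident v => X.ident_inj h
  rcases up_cases X v with ⟨h6, h7, -⟩ | ⟨h6, h7, -, -, h8⟩ | ⟨h6, h7, h8, -, h9, t, h10, h11⟩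
  · have : (T.cutTree F).Portal (𝒢.cluster v) := Or.inl h7
    rw [if_pos (by rw [h6]), chainCode, if_pos this]
  · simp only [if_neg (mt hne h6), h8]
    rw [h5 h6, h7]
  · have h12 := subtreeSum_localCnt_gate (𝒢 := 𝒢) h7
    have h13 := subtreeSum_localMin_gate (𝒢 := 𝒢) h7
    rw [← h8] at h12 h13
    simp only [if_neg (mt hne h6), h10]
    rw [h5 h6, h12, h13, h9, h11]
    conv_rhs => rw [chainCode]
    by_cases h14 : 2 ≤ (T.cutTree F).cnt (𝒢.cluster v)
    · have : (T.cutTree F).Portal (𝒢.cluster v) := Or.inr h14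
      rw [if_pos h14, if_pos this]
    · have h15 : ¬ (T.cutTree F).Portal (𝒢.cluster v) := by
        rintro (h | h)
        · exact h7 h
        · exact h14 h
      rw [if_neg h14, if_neg h15]
      by_cases h16 : (T.cutTree F).Marked (𝒢.cluster v)
      · have := CutTree.marked_iff.1 h16
        rw [if_neg (by omega), if_pos h16, chainMinCode_eq h7 h16]
      · have : (T.cutTree F).cnt (𝒢.cluster v) = 0 := by
          have := mt CutTree.marked_iff.2 h16
          omega
        rw [if_pos this, if_neg h16]

theorem jTreeValue_final (h2 : tab (ident v) 2 = ident (𝒢.up T F v))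
    (h3 : tab (ident v) 3 = subtreeSum (𝒢.inner T F) (𝒢.localCnt T F) v)
    (h4 : tab (ident v) 4 = subtreeSum (𝒢.inner T F) (𝒢.localMin T F) v)
    (h5 : 𝒢.up T F v ≠ v →
      tab (ident (𝒢.up T F v)) 5 = 𝒢.chainCode T F (𝒢.cluster (𝒢.up T F v))) :
    jTreeValue 6 (jTreeInput 𝒢 ident T F v) tab = ident (𝒢.final T F v) := by
  classical
  have hid : (jTreeInput 𝒢 ident T F v).id = ident v := rfl
  simp only [jTreeValue]
  rw [hid, h2, h3, h4]
  have hne := fun h : ident (𝒢.up T F v) = ident v => X.ident_inj h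
  rcases up_cases X v with ⟨h6, -, -⟩ | ⟨h6, -, -, h7, h8⟩ | ⟨h6, h7, h8, -, h9, t, h10, h11⟩
  · have : 𝒢.final T F v = v := by
      rcases final_or (𝒢 := 𝒢) (T := T) (F := F) v with h | h
      · exact h
      · exact h.trans h6
    rw [if_pos (by rw [h6]), this]
  · simp only [if_neg (mt hne h6), h8]
    rw [final, if_neg h7]
  · have h12 := subtreeSum_localCnt_gate (𝒢 := 𝒢) h7
    have h13 := subtreeSum_localMin_gate (𝒢 := 𝒢) h7
    rw [← h8] at h12 h13
    simp only [if_neg (mt hne h6), h10]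
    rw [h5 h6, h12, h13, h9, h11, final]
    simp only [cutCode_iff h7, ← h8, and_true]
    split_ifs <;> rfl

theorem childSum_final [DecidableEq V]
    (h6 : ∀ w, G.Adj v w → tab (ident w) 6 = ident (𝒢.final T F w)) {k : ℕ} {l : V → ℕ}
    (hk : ∀ w, G.Adj v w → 𝒢.final T F w = v →
      tab (ident w) k = subtreeSum (𝒢.final T F) l w) :
    l v + childSum (jTreeInput 𝒢 ident T F v) tab 6 (tab · k) =
      subtreeSum (𝒢.final T F) l v := by
  classical
  rw [grounded_final.subtreeSum_eq, childSum_eq X.ident_inj (fun w h => final_adj h) h6 hk]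
  congr

theorem jTreeValue_portalMark (h2 : tab (ident v) 2 = ident (𝒢.up T F v))
    (h3 : tab (ident v) 3 = subtreeSum (𝒢.inner T F) (𝒢.localCnt T F) v)
    (h6 : ∀ w, G.Adj v w → tab (ident w) 6 = ident (𝒢.final T F w))
    (h8 : ∀ w, G.Adj v w → 𝒢.final T F w = v →
      tab (ident w) 8 = subtreeSum (𝒢.final T F) (𝒢.portalMark T F ident) w) :
    jTreeValue 8 (jTreeInput 𝒢 ident T F v) tab =
      subtreeSum (𝒢.final T F) (𝒢.portalMark T F ident) v := by
  classical
  rw [← childSum_final X h6 h8]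
  have hid : (jTreeInput 𝒢 ident T F v).id = ident v := rfl
  have hcl : (jTreeInput 𝒢 ident T F v).clusters.clusterId =
    𝒢.clusterId ident (𝒢.cluster v) := rfl
  simp only [jTreeValue, hid, h2, h3, X.ident_inj.eq_iff, hcl, portalMark]
  congr 1
  refine if_congr ?_ rfl rfl
  rcases up_cases X v with ⟨h4, h5, h7⟩ | ⟨h4, -, h5, -, h7⟩ | ⟨h4, h5, h7, h9, -, t, h10, -⟩
  · have : (T.cutTree F).Portal (𝒢.cluster v) := Or.inl h5
    simp [h4, ← h7, this]
  · simp [h4, h5, h7]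
  · have h12 := subtreeSum_localCnt_gate (𝒢 := 𝒢) h5
    rw [← h7] at h12
    rw [h12, h10, ← h9]
    simp only [h4, false_or, Ne, reduceCtorEq, not_false_eq_true, true_and]
    exact ⟨Or.inr, fun h => h.resolve_left h5⟩

omit [Fintype V] in
/-- A broadcast from the roots of the forest `final`. -/
theorem jTreeValue_root {P : V → ℕ} {y z : ℕ}
    (h6 : tab (ident v) 6 = ident (𝒢.final T F v))
    (hy : 𝒢.final T F v = v → y = P v)
    (hz : 𝒢.final T F v ≠ v → z = P (rootOf (𝒢.final T F) (𝒢.final T F v))) :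
    (if tab (ident v) 6 = ident v then y else z) = P (rootOf (𝒢.final T F) v) := by
  rw [h6]
  split_ifs with h
  · have h := X.ident_inj h
    rw [rootOf_of_fixed h, hy h]
  · rw [hz (mt (congrArg ident) h), grounded_final.rootOf_parent]

omit X in
variable (𝒢 T F) in
/-- A bound for the time that variable `k` takes after the variables below `k` are known, if the
depths of the forests do not exceed `H`. -/
noncomputable def jTreeDelay (H k : ℕ) (v : V) : ℕ :=
  match k with
  | 1 => 2 * (H - dist 𝒢.parent v)
  | 3 | 4 | 7 | 8 => 2 * (H - dist (𝒢.up T F) v)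
  | 5 | 9 | 10 | 11 => 2 * dist (𝒢.up T F) v
  | _ => 0

omit X in
variable (𝒢 T F) in
/-- A bound for the time at which variable `k` is known. -/
noncomputable def jTreeRank (H k : ℕ) (v : V) : ℕ := 1 + k * (2 * H + 2) + 𝒢.jTreeDelay T F H k v

omit X [Fintype V] [Fintype N] in
theorem jTreeDelay_le {H : ℕ} (hu : ∀ v, dist (𝒢.up T F) v ≤ H) (k : ℕ) (v : V) :
    𝒢.jTreeDelay T F H k v ≤ 2 * H := by
  have := hu v
  unfold jTreeDelay
  split <;> omega

/-- The protocol computes the intended values.  Convergecasts proceed from the deepest nodes to the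
roots and broadcasts in the opposite direction, and each step along a forest edge takes two units of
rank. -/
theorem jTreeProtocol_spec {H : ℕ} (hp : ∀ v, dist 𝒢.parent v ≤ H)
    (hu : ∀ v, dist (𝒢.up T F) v ≤ H) :
    jTreeProtocol.Spec G ident (jTreeInput 𝒢 ident T F) (𝒢.jTreeVal T F ident)
      (𝒢.jTreeRank T F H) where
  ident_inj := X.ident_inj
  id_eq _ := rfl
  mem_nbrs v x := mem_nbrs_iff (v := v) (x := x) (𝒢 := 𝒢) (T := T) (F := F)
  value_eq k hk v tab hT hsel := by
    replace hk : k < 12 := hk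
    have own : ∀ k' < k, tab (ident v) k' = 𝒢.jTreeVal T F ident k' v :=
      fun k' h => hT v (Or.inl rfl) k' h
    have nbr : ∀ k' < k, ∀ w, G.Adj v w → tab (ident w) k' = 𝒢.jTreeVal T F ident k' w :=
      fun k' h w hw => hT w (Or.inr hw) k' h
    have upv : k = 5 ∨ k = 6 → 𝒢.up T F v ≠ v →
        tab (ident (𝒢.up T F v)) 5 = 𝒢.chainCode T F (𝒢.cluster (𝒢.up T F v)) := by
      rintro (rfl | rfl) h
      · exact hsel _ (up_adj h) (congrArg id (own 2 (by norm_num)).symm)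
      · exact nbr 5 (by norm_num) _ (up_adj h)
    have root : ∀ k', 9 ≤ k' → k' < 12 → k = k' → 𝒢.final T F v ≠ v →
        tab (tab (ident v) 6) k' = 𝒢.jTreeVal T F ident k' (𝒢.final T F v) := by
      rintro k' h1 h2 rfl h
      have h6 : tab (ident v) 6 = ident (𝒢.final T F v) := own 6 (by omega)
      rw [h6]
      refine hsel _ (final_adj h) ?_
      interval_cases k <;> exact h6.symm
    interval_cases k
    · exact jTreeValue_parent (tab := tab)
    · exact jTreeValue_gateMark X (nbr 0 (by norm_num))
        fun w hw h => hsel w hw ((nbr 0 (by norm_num) w hw).trans (congrArg ident h))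
    · exact jTreeValue_up X (own 0 (by norm_num)) (nbr 0 (by norm_num)) (nbr 1 (by norm_num))
    · exact jTreeValue_cnt X (nbr 2 (by norm_num))
        fun w hw h => hsel w hw ((nbr 2 (by norm_num) w hw).trans (congrArg ident h))
    · exact jTreeValue_min X (nbr 2 (by norm_num)) (nbr 3 (by norm_num))
        fun w hw h => hsel w hw ((nbr 2 (by norm_num) w hw).trans (congrArg ident h))
    · exact jTreeValue_chainCode X (own 2 (by norm_num)) (own 3 (by norm_num))
        (own 4 (by norm_num)) (upv (Or.inl rfl))
    · exact jTreeValue_final X (own 2 (by norm_num)) (own 3 (by norm_num))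
        (own 4 (by norm_num)) (upv (Or.inr rfl))
    · classical
      exact childSum_final X (l := fun _ => 1) (nbr 6 (by norm_num))
        fun w hw h => hsel w hw ((nbr 6 (by norm_num) w hw).trans (congrArg ident h))
    · exact jTreeValue_portalMark X (own 2 (by norm_num)) (own 3 (by norm_num))
        (nbr 6 (by norm_num))
        fun w hw h => hsel w hw ((nbr 6 (by norm_num) w hw).trans (congrArg ident h))
    · exact jTreeValue_root X (P := ident) (own 6 (by norm_num)) (fun _ => rfl)
        (root 9 le_rfl (by norm_num) rfl)
    · exact jTreeValue_root X (own 6 (by norm_num)) (fun _ => own 7 (by norm_num))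
        (root 10 (by norm_num) (by norm_num) rfl)
    · exact jTreeValue_root X (own 6 (by norm_num)) (fun _ => own 8 (by norm_num))
        (root 11 (by norm_num) (by norm_num) rfl)
  rank_sel k hk v tab hT w hw hs := by
    replace hk : k < 12 := hk
    have own : ∀ k' < k, tab (ident v) k' = 𝒢.jTreeVal T F ident k' v :=
      fun k' h => hT v (Or.inl rfl) k' h
    have nbr : ∀ k' < k, tab (ident w) k' = 𝒢.jTreeVal T F ident k' w :=
      fun k' h => hT w (Or.inr hw) k' h
    have hup : 𝒢.up T F w = v → dist (𝒢.up T F) w = dist (𝒢.up T F) v + 1 := by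
      rintro rfl
      exact grounded_up.dist_of_not_fixed hw.ne
    have hup' : w = 𝒢.up T F v → dist (𝒢.up T F) v = dist (𝒢.up T F) w + 1 := by
      rintro rfl
      exact grounded_up.dist_of_not_fixed hw.ne.symm
    have hfin : ∀ a b : V, 𝒢.final T F a = b → a ≠ b → 𝒢.up T F a = b := by
      rintro a b rfl h
      exact ((final_or a).resolve_left (Ne.symm h)).symm
    have hpw := hp w
    have huw := hu w
    have huv := hu v
    unfold jTreeRank
    have key : 𝒢.jTreeDelay T F H k w + 2 ≤ 𝒢.jTreeDelay T F H k v := by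
      interval_cases k
      · exact hs.elim
      · have h : 𝒢.parent w = v := X.ident_inj ((nbr 0 (by norm_num)).symm.trans hs)
        have : dist 𝒢.parent w = dist 𝒢.parent v + 1 := by
          subst h
          exact 𝒢.grounded_parent.dist_of_not_fixed hw.ne
        simp only [jTreeDelay]
        omega
      · exact hs.elim
      · have := hup (X.ident_inj ((nbr 2 (by norm_num)).symm.trans hs))
        simp only [jTreeDelay]
        omega
      · have := hup (X.ident_inj ((nbr 2 (by norm_num)).symm.trans hs))
        simp only [jTreeDelay]
        omega
      · have := hup' (X.ident_inj (hs.trans (own 2 (by norm_num))))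
        simp only [jTreeDelay]
        omega
      · exact hs.elim
      · have := hup (hfin _ _ (X.ident_inj ((nbr 6 (by norm_num)).symm.trans hs)) hw.ne.symm)
        simp only [jTreeDelay]
        omega
      · have := hup (hfin _ _ (X.ident_inj ((nbr 6 (by norm_num)).symm.trans hs)) hw.ne.symm)
        simp only [jTreeDelay]
        omega
      all_goals
        have := hup' (hfin _ _ (X.ident_inj (hs.trans (own 6 (by norm_num)))).symm hw.ne).symm
        simp only [jTreeDelay]
        omega
    omega
  rank_lt k hk k' hk' v w := by
    have h1 := jTreeDelay_le hu k' w
    have h2 : (k' + 1) * (2 * H + 2) ≤ k * (2 * H + 2) := Nat.mul_le_mul_right _ hk'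
    unfold jTreeRank
    rw [add_mul] at h2
    omega

end ClusterGraph

namespace ClusterGraph

open ParentForest ParentForest.Grounded CapGraph CapGraph.SpanningTree

/-! ### Correctness of the output -/

variable {V N E : Type} [Fintype V] [Fintype N] [Fintype E] {G : SimpleGraph V}
  {𝒢 : ClusterGraph G N E} {T : 𝒢.toCapGraph.SpanningTree} {F : Finset E} {ident : V → ℕ}
  {v w : V} {tab : ℕ → ℕ → ℕ}

/-- Restricting the edges of a graph restricts the knowledge about the represented edges. -/
theorem edgeTowards_restrict {V E E' : Type} {psi : E → V × V} {ι : E' → E} {ident : V → ℕ}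
    (hid : Function.Injective ident) (hpsi : EdgewiseInjective psi) (hι : Function.Injective ι)
    (v : V) (x : ℕ) (e' : E') :
    edgeTowards (fun e' => psi (ι e')) ident v x = some e' ↔
      edgeTowards psi ident v x = some (ι e') := by
  have hpsi' : EdgewiseInjective fun e' => psi (ι e') := fun e e' h => hι (hpsi _ _ h)
  constructor
  · intro h
    obtain ⟨w, rfl, h'⟩ := exists_of_edgeTowards h
    exact (edgeTowards_eq_some hid hpsi).2 h'
  · intro h
    obtain ⟨w, rfl, h'⟩ := exists_of_edgeTowards h
    exact (edgeTowards_eq_some hid hpsi').2 h'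

omit [Fintype V] in
theorem rootOf_final_eq_iff : rootOf (𝒢.final T F) v = rootOf (𝒢.final T F) w ↔
    (T.cutTree F).pieceTop (𝒢.cluster v) = (T.cutTree F).pieceTop (𝒢.cluster w) := by
  rw [rootOf_final, rootOf_final]
  exact ⟨clusterRoot_inj, fun h => by rw [h]⟩

omit [Fintype V] in
theorem leader_newClusters (v : V) (h : (T.cutTree F).portal (𝒢.cluster v) ∈ 𝒢.coreNodes T F) :
    (𝒢.newClusters T F).leader ⟨(T.cutTree F).portal (𝒢.cluster v), h⟩ =
      rootOf (𝒢.final T F) v := by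
  change 𝒢.clusterRoot T F ((T.cutTree F).pieceTop ((T.cutTree F).portal (𝒢.cluster v))) = _
  rw [rootOf_final, CutTree.pieceTop_portal]

theorem clusterSize_newClusters (v : V) :
    (𝒢.newClusters T F).clusterSize ((𝒢.newClusters T F).cluster v) =
      subtreeSum (𝒢.final T F) (fun _ => 1) (rootOf (𝒢.final T F) v) := by
  classical
  rw [grounded_final.subtreeSum_of_fixed _ (grounded_final.fixed_rootOf v), clusterSize,
    Finset.card_eq_sum_ones]
  refine Finset.sum_congr ?_ fun _ _ => rfl
  ext u
  simp only [Finset.mem_filter, Finset.mem_univ, true_and, rootOf_final_eq_iff]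
  rw [← CutTree.portal_eq_iff]
  exact Subtype.ext_iff

/-- The convergecast of `portalMark` finds the portal of the piece. -/
theorem subtreeSum_portalMark (v : V) :
    subtreeSum (𝒢.final T F) (𝒢.portalMark T F ident) (rootOf (𝒢.final T F) v) =
      𝒢.clusterId ident ((T.cutTree F).portal (𝒢.cluster v)) := by
  classical
  rw [grounded_final.subtreeSum_of_fixed _ (grounded_final.fixed_rootOf v)]
  set p := (T.cutTree F).portal (𝒢.cluster v) with hp
  rw [Finset.sum_eq_single (𝒢.clusterRoot T F p)]
  · simp [portalMark, cluster_clusterRoot, hp, CutTree.portal_mem]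
  · intro u hu hne
    simp only [Finset.mem_filter, Finset.mem_univ, true_and, rootOf_final_eq_iff] at hu
    refine if_neg fun h => hne ?_
    have : p = 𝒢.cluster u := CutTree.portal_eq h.2 hu
    rw [this]
    exact h.1
  · intro h
    refine absurd ?_ h
    simp only [Finset.mem_filter, Finset.mem_univ, true_and, rootOf_final_eq_iff,
      cluster_clusterRoot, hp, CutTree.pieceTop_portal]

omit [Fintype N] in
theorem coreCap_eq {x : ℕ} {e : E} (h : edgeTowards 𝒢.psi ident v x = some e) :
    coreCap (jTreeInput 𝒢 ident T F v) x (𝒢.cap e) = T.capH F e := by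
  classical
  unfold coreCap
  by_cases h1 : e ∈ T.edges
  · by_cases h2 : e ∈ F <;> simp [jTreeInput, h, h1, h2, capH]
  · simp [jTreeInput, h, h1, capH]

omit [Fintype V] in
/-- A tree edge belongs to the forest of the `j`-tree if and only if its representative belongs to
the forest `final`. -/
theorem kept_iff {e : E} (h : 𝒢.psi e = (v, w) ∨ 𝒢.psi e = (w, v)) (he : e ∈ T.edges) :
    T.Kept F e ↔ 𝒢.final T F w = v ∨ 𝒢.final T F v = w := by
  classical
  have hpe := mem_edges.1 he
  have hends : (𝒢.src e = 𝒢.cluster v ∧ 𝒢.tgt e = 𝒢.cluster w) ∨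
      (𝒢.src e = 𝒢.cluster w ∧ 𝒢.tgt e = 𝒢.cluster v) := by
    have h1 := 𝒢.cluster_psi_fst e
    have h2 := 𝒢.cluster_psi_snd e
    rcases h with h | h <;> rw [h] at h1 h2
    · exact Or.inl ⟨h1.symm, h2.symm⟩
    · exact Or.inr ⟨h1.symm, h2.symm⟩
  constructor
  · intro hk
    have htop : ¬ (T.cutTree F).Top (T.lower e) := fun h' => hk.2 (Or.inl h')
    have hcut : ¬ (T.cutTree F).Cut (T.lower e) := fun h' => hk.2 (Or.inr h')
    have h1 : 𝒢.final T F (𝒢.gate T (T.lower e)) = 𝒢.gateTo T (T.lower e) := by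
      rw [final, cluster_gate, if_neg fun h' => hcut h'.1, up_gate htop]
    rcases h with h | h <;> rcases link_spec hpe with ⟨h2, -⟩ | ⟨h2, -⟩ <;>
      rw [h, Prod.mk.injEq] at h2 <;> rw [h2.1, h2.2] <;> simp [h1]
  · intro h1
    refine ⟨he, fun h2 => core_of_pieceTop he h2 ?_⟩
    have h3 : (T.cutTree F).pieceTop (𝒢.cluster v) = (T.cutTree F).pieceTop (𝒢.cluster w) := by
      rcases h1 with rfl | rfl
      · exact pieceTop_cluster_final w
      · exact (pieceTop_cluster_final v).symm
    rcases hends with ⟨h4, h5⟩ | ⟨h4, h5⟩ <;> rw [h4, h5, h3]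

/-- The variables of a node and its neighbours determine the output: forest edges are recognized by
the forest `final`, and core edges by the different roots of the pieces at their ends. -/
theorem jTreeResult_eq (X : 𝒢.ValidInput T F ident) {j : ℕ} (hj : 1 ≤ j) (hFj : 4 * F.card ≤ j)
    (hT : Protocol.Agrees G ident (𝒢.jTreeVal T F ident) v 12 tab) :
    jTreeResult (jTreeInput 𝒢 ident T F v) tab =
      (𝒢.clusteredJTree T F X.psi_inj X.subset hj hFj).output ident v := by
  classical
  have own6 : tab (ident v) 6 = ident (𝒢.final T F v) := hT v (Or.inl rfl) 6 (by norm_num)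
  have own9 : tab (ident v) 9 = ident (rootOf (𝒢.final T F) v) :=
    hT v (Or.inl rfl) 9 (by norm_num)
  have own10 : tab (ident v) 10 = _ := hT v (Or.inl rfl) 10 (by norm_num)
  have own11 : tab (ident v) 11 = 𝒢.clusterId ident ((T.cutTree F).portal (𝒢.cluster v)) :=
    (hT v (Or.inl rfl) 11 (by norm_num)).trans (subtreeSum_portalMark v)
  have nbr6 : ∀ w, G.Adj v w → tab (ident w) 6 = ident (𝒢.final T F w) :=
    fun w hw => hT w (Or.inr hw) 6 (by norm_num)
  have nbr9 : ∀ w, G.Adj v w → tab (ident w) 9 = ident (rootOf (𝒢.final T F) w) :=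
    fun w hw => hT w (Or.inr hw) 9 (by norm_num)
  have nbr11 : ∀ w, G.Adj v w →
      tab (ident w) 11 = 𝒢.clusterId ident ((T.cutTree F).portal (𝒢.cluster w)) :=
    fun w hw => (hT w (Or.inr hw) 11 (by norm_num)).trans (subtreeSum_portalMark w)
  -- What is known about an edge towards a neighbour.
  have hedge : ∀ x e, edgeTowards 𝒢.psi ident v x = some e → ∃ w, ident w = x ∧ G.Adj v w ∧
      (𝒢.psi e = (v, w) ∨ 𝒢.psi e = (w, v)) ∧
      (if (𝒢.psi e).1 = v then 𝒢.tgt e else 𝒢.src e) = 𝒢.cluster w ∧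
      (if (𝒢.psi e).1 = v then 𝒢.src e else 𝒢.tgt e) = 𝒢.cluster v ∧
      (T.Core F e ↔ rootOf (𝒢.final T F) w ≠ rootOf (𝒢.final T F) v) := by
    intro x e h
    obtain ⟨w, rfl, h1⟩ := exists_of_edgeTowards h
    have hadj := 𝒢.psi_adj e
    have h2 := 𝒢.cluster_psi_fst e
    have h3 := 𝒢.cluster_psi_snd e
    refine ⟨w, rfl, ?_⟩
    rw [Ne, rootOf_final_eq_iff, Core]
    rcases h1 with h1 | h1
    · rw [h1] at hadj h2 h3
      simp only [h1, if_true, h2, h3, true_or, true_and]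
      exact ⟨hadj, by rw [← h2, ← h3, Ne, eq_comm]⟩
    · rw [h1] at hadj h2 h3
      have hne : w ≠ v := hadj.ne
      simp only [h1, if_neg hne, h2, h3, or_true, true_and]
      exact ⟨hadj.symm, trivial⟩
  have hleader : ∀ u : V, (𝒢.newClusters T F).clusterId ident
      ⟨(T.cutTree F).portal (𝒢.cluster u), portal_mem_coreNodes _⟩ =
      ident (rootOf (𝒢.final T F) u) := fun u => congrArg ident (leader_newClusters u _)
  have hclusters : (jTreeResult (jTreeInput 𝒢 ident T F v) tab).clusters =
      (𝒢.newClusters T F).view ident v := by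
    unfold view jTreeResult
    rw [ClusterView.mk.injEq]
    refine ⟨?_, ?_, ?_, ?_⟩
    · exact own9.trans (hleader v).symm
    · rw [clusterSize_newClusters]
      exact own10
    · change (if tab (ident v) 6 = ident v then none else some (tab (ident v) 6)) = _
      rw [own6]
      refine if_congr ?_ rfl rfl
      rw [X.ident_inj.eq_iff]
      exact (𝒢.newClusters T F).parent_fixed_iff
    · funext x
      have hres := edgeTowards_restrict (psi := 𝒢.psi)
        (ι := fun e : {e : T.JEdge F // e ∉ {e : T.JEdge F | T.Kept F e.1}} => e.1.1) X.ident_inj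
        X.psi_inj (Subtype.val_injective.comp Subtype.val_injective) v x
      rcases he : edgeTowards 𝒢.psi ident v x with _ | e
      · have h1 : edgeTowards (𝒢.newClusters T F).psi ident v x = none := by
          rw [Option.eq_none_iff_forall_ne_some]
          intro e' h'
          exact absurd (he.symm.trans ((hres e').1 h')) (by simp)
        simp only [jTreeInput, view, he, h1, Option.map_none, Option.bind_none]
      · obtain ⟨w, rfl, hadj, hpsi, hfar, hnear, hcore⟩ := hedge x e he
        have h2 := coreCap_eq (T := T) (F := F) he
        by_cases hc : T.Core F e
        · have h1 : edgeTowards (𝒢.newClusters T F).psi ident v (ident w) =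
              some ⟨⟨e, Or.inr hc⟩, fun h => h.not_core hc⟩ := (hres _).2 he
          rw [h1]
          have h3 : (jTreeInput 𝒢 ident T F v).clusters.edge (ident w) =
              some (𝒢.clusterId ident (𝒢.cluster w), 𝒢.cap e) := by
            simp only [jTreeInput, view, he, Option.map_some, hfar]
          have h4 : tab (ident w) 9 ≠ tab (ident v) 9 := by
            rw [own9, nbr9 w hadj]
            exact fun h => hcore.1 hc (X.ident_inj h)
          have h5 : (if (𝒢.psi e).1 = v then
              (𝒢.newClusters T F).tgt ⟨⟨e, Or.inr hc⟩, fun h => h.not_core hc⟩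
              else (𝒢.newClusters T F).src ⟨⟨e, Or.inr hc⟩, fun h => h.not_core hc⟩) =
              ⟨(T.cutTree F).portal (𝒢.cluster w), portal_mem_coreNodes _⟩ := by
            refine Subtype.ext ?_
            change _ = (T.cutTree F).portal (𝒢.cluster w)
            rw [← hfar]
            split_ifs <;> rfl
          rw [h3]
          change (if tab (ident w) 9 = tab (ident v) 9 then none else
            some (tab (ident w) 9, coreCap (jTreeInput 𝒢 ident T F v) (ident w) (𝒢.cap e))) =
            some ((𝒢.newClusters T F).clusterId ident (if (𝒢.psi e).1 = v then
              (𝒢.newClusters T F).tgt ⟨⟨e, Or.inr hc⟩, fun h => h.not_core hc⟩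
              else (𝒢.newClusters T F).src ⟨⟨e, Or.inr hc⟩, fun h => h.not_core hc⟩),
              T.capH F e)
          rw [if_neg h4, h5, hleader, h2, nbr9 w hadj]
        · have h1 : edgeTowards (𝒢.newClusters T F).psi ident v (ident w) = none := by
            rw [Option.eq_none_iff_forall_ne_some]
            intro e' h'
            have h3 := Option.some.inj (he.symm.trans ((hres e').1 h'))
            exact hc (h3 ▸ e'.1.2.resolve_left e'.2)
          have h4 : tab (ident w) 9 = tab (ident v) 9 := by
            rw [own9, nbr9 w hadj]
            exact congrArg ident (not_ne_iff.1 (mt hcore.2 hc))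
          have h5 : tab (jTreeInput 𝒢 ident T F v).id 9 = tab (ident v) 9 := rfl
          rw [h1]
          simp [h4, h5]
  have hjedge : (jTreeResult (jTreeInput 𝒢 ident T F v) tab).jEdge =
      ((𝒢.clusteredJTree T F X.psi_inj X.subset hj hFj).output ident v).jEdge := by
    funext x
    have hres := edgeTowards_restrict (psi := 𝒢.psi) (ι := fun e : T.JEdge F => e.1) X.ident_inj
      X.psi_inj Subtype.val_injective v x
    change _ = (edgeTowards (fun e : T.JEdge F => 𝒢.psi e.1) ident v x).map fun e =>
      (⟨𝒢.clusterId ident (if (𝒢.psi e.1).1 = v then (T.jGraph F).src e else (T.jGraph F).tgt e),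
        𝒢.clusterId ident (if (𝒢.psi e.1).1 = v then (T.jGraph F).tgt e else (T.jGraph F).src e),
        decide (T.Kept F e.1), (T.jGraph F).cap e⟩ : JEdgeView)
    rcases he : edgeTowards 𝒢.psi ident v x with _ | e
    · have h1 : edgeTowards (fun e : T.JEdge F => 𝒢.psi e.1) ident v x = none := by
        rw [Option.eq_none_iff_forall_ne_some]
        intro e' h'
        exact absurd (he.symm.trans ((hres e').1 h')) (by simp)
      simp only [jTreeResult, jTreeInput, view, he, h1, Option.map_none, Option.bind_none]
    · obtain ⟨w, rfl, hadj, hpsi, hfar, hnear, hcore⟩ := hedge x e he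
      have h2 := coreCap_eq (T := T) (F := F) he
      have h3 : (jTreeInput 𝒢 ident T F v).clusters.edge (ident w) =
          some (𝒢.clusterId ident (𝒢.cluster w), 𝒢.cap e) := by
        simp only [jTreeInput, view, he, Option.map_some, hfar]
      have h4 : ((jTreeInput 𝒢 ident T F v).tree (ident w)).isSome ∧
          (tab (ident w) 6 = ident v ∨ tab (ident v) 6 = ident w) ↔ T.Kept F e := by
        rw [own6, nbr6 w hadj, X.ident_inj.eq_iff, X.ident_inj.eq_iff]
        by_cases h5 : e ∈ T.edges
        · rw [kept_iff hpsi h5]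
          simp [jTreeInput, he, h5]
        · simp [jTreeInput, he, h5, Kept]
      have h5 : (jTreeResult (jTreeInput 𝒢 ident T F v) tab).jEdge (ident w) =
          if T.Kept F e then ((jTreeInput 𝒢 ident T F v).tree (ident w)).map fun t =>
            ⟨𝒢.clusterId ident (𝒢.cluster v), 𝒢.clusterId ident (𝒢.cluster w), true, 4 * t.capT⟩
          else if tab (ident w) 9 = tab (ident v) 9 then none
          else some ⟨tab (ident v) 11, tab (ident w) 11, false,
            coreCap (jTreeInput 𝒢 ident T F v) (ident w) (𝒢.cap e)⟩ := by
        simp only [jTreeResult, h3, Option.bind_some]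
        exact if_congr h4 rfl rfl
      rw [h5]
      by_cases hk : T.Kept F e
      · have h1 : edgeTowards (fun e : T.JEdge F => 𝒢.psi e.1) ident v (ident w) =
            some ⟨e, Or.inl hk⟩ := (hres _).2 he
        have h6 : (jTreeInput 𝒢 ident T F v).tree (ident w) =
            some ⟨decide (T.lower e = 𝒢.cluster v), decide (e ∈ F), T.capT e⟩ := by
          simp only [jTreeInput, he, Option.bind_some, hk.1, if_true]
        rw [h1, h6, if_pos hk]
        simp only [Option.map_some, jGraph, hk, if_true, decide_true, hfar, hnear]
      · rw [if_neg hk]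
        by_cases hc : T.Core F e
        · have h1 : edgeTowards (fun e : T.JEdge F => 𝒢.psi e.1) ident v (ident w) =
              some ⟨e, Or.inr hc⟩ := (hres _).2 he
          have h6 : tab (ident w) 9 ≠ tab (ident v) 9 := by
            rw [own9, nbr9 w hadj]
            exact fun h => hcore.1 hc (X.ident_inj h)
          rw [h1, if_neg h6, own11, nbr11 w hadj, h2, ← hfar, ← hnear]
          simp only [Option.map_some, jGraph, hk, if_false, decide_false]
          split_ifs <;> rfl
        · have h1 : edgeTowards (fun e : T.JEdge F => 𝒢.psi e.1) ident v (ident w) = none := by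
            rw [Option.eq_none_iff_forall_ne_some]
            intro e' h'
            have h6 := Option.some.inj (he.symm.trans ((hres e').1 h'))
            rcases e'.2 with h | h
            · exact hk (h6 ▸ h)
            · exact hc (h6 ▸ h)
          have h6 : tab (ident w) 9 = tab (ident v) 9 := by
            rw [own9, nbr9 w hadj]
            exact congrArg ident (not_ne_iff.1 (mt hcore.2 hc))
          rw [h1, if_pos h6]
          rfl
  exact (JTreeOutput.mk.injEq _ _ _ _).mpr ⟨hclusters, hjedge⟩

end ClusterGraph

namespace ClusterGraph

open ParentForest ParentForest.Grounded CapGraph CapGraph.SpanningTree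

/-! ### Sizes of the variables -/

variable {V N E : Type} [Fintype V] [Fintype E] {G : SimpleGraph V}
  {𝒢 : ClusterGraph G N E} {T : 𝒢.toCapGraph.SpanningTree} {F : Finset E} {ident : V → ℕ}

omit [Fintype E] in
theorem card_clusters_le [Fintype N] (𝒢 : ClusterGraph G N E) :
    Fintype.card N ≤ Fintype.card V :=
  Fintype.card_le_of_surjective 𝒢.cluster fun c => ⟨𝒢.leader c, 𝒢.cluster_leader c⟩

theorem card_edges_le (h : EdgewiseInjective 𝒢.psi) :
    Fintype.card E ≤ Fintype.card V ^ 2 := by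
  have h1 : Function.Injective 𝒢.psi := fun e e' h' => h e e' (by rw [h'])
  have h2 := Fintype.card_le_of_injective _ h1
  rwa [Fintype.card_prod, ← pow_two] at h2

theorem sum_le_card_mul {α : Type} (s : Finset α) [Fintype α] {l : α → ℕ} {b n : ℕ}
    (hl : ∀ u, l u ≤ b) (hn : Fintype.card α ≤ n) : ∑ u ∈ s, l u ≤ n * b := by
  refine (Finset.sum_le_card_nsmul s l b fun u _ => hl u).trans ?_
  rw [smul_eq_mul]
  exact Nat.mul_le_mul_right _ ((Finset.card_le_univ s).trans hn)

/-- A crude polynomial bound for all variables of the protocol. -/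
theorem jTreeVal_le [Fintype N] (X : 𝒢.ValidInput T F ident) {κ : ℕ}
    (hid : ∀ v, ident v ≤ Fintype.card V ^ κ) (hcap : ∀ e, 𝒢.cap e ≤ Fintype.card V ^ κ)
    {k : ℕ} (hk : k < 12) (v : V) :
    𝒢.jTreeVal T F ident k v ≤ 4 * Fintype.card V ^ (κ + 4) := by
  classical
  set n := Fintype.card V with hn
  have hn1 : 1 ≤ n := Fintype.card_pos_iff.2 ⟨v⟩
  have hN : Fintype.card N ≤ n := 𝒢.card_clusters_le
  have mono : ∀ a b : ℕ, a ≤ b → n ^ a ≤ n ^ b := fun a b h => Nat.pow_le_pow_right hn1 h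
  have hpos : 1 ≤ n ^ (κ + 4) := Nat.one_le_pow _ _ hn1
  have hκ : n ^ κ ≤ n ^ (κ + 4) := mono _ _ (by omega)
  have hsum : ∀ (f : V → V) (l : V → ℕ) (u : V) (a : ℕ), (∀ u, l u ≤ n ^ a) → a ≤ κ + 3 →
      subtreeSum f l u ≤ n ^ (κ + 4) := by
    intro f l u a hl ha
    have h1 : subtreeSum f l u ≤ n * n ^ a := sum_le_card_mul _ hl le_rfl
    rw [← pow_succ'] at h1
    exact h1.trans (mono _ _ (by omega))
  have hportal : ∀ u, 𝒢.portalMark T F ident u ≤ n ^ κ := by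
    intro u
    unfold portalMark
    split_ifs
    · exact hid _
    · exact Nat.zero_le _
  have hone : ∀ u : V, (fun _ => 1) u ≤ n ^ 0 := by simp
  have hw : ∀ c, (T.cutTree F).w c ≤ n ^ (κ + 2) := by
    intro c
    change (match T.parentEdge c with
      | some e => T.capT e
      | none => 0) ≤ _
    split
    · unfold capT
      refine (sum_le_card_mul _ hcap (card_edges_le X.psi_inj)).trans ?_
      rw [← pow_add, add_comm]
    · exact Nat.zero_le _
  have hinf : ∀ s : Set N, sInf ((T.cutTree F).w '' s) ≤ n ^ (κ + 2) := by
    intro s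
    rcases s.eq_empty_or_nonempty with rfl | h
    · simp
    · obtain ⟨c, -, hc⟩ := Nat.sInf_mem (h.image (T.cutTree F).w)
      rw [← hc]
      exact hw c
  have h3 : ∀ u, subtreeSum (𝒢.inner T F) (𝒢.localCnt T F) u ≤ 4 * n ^ (κ + 4) := by
    intro u
    have h1 : ∀ u, 𝒢.localCnt T F u ≤ 3 * n := by
      intro u
      have h1 := (Finset.card_le_univ (Finset.univ.filter fun c =>
        (T.cutTree F).Top c ∧ c ≠ T.root ∧ 𝒢.gateTo T c = u)).trans hN
      have h2 := sum_le_card_mul (Finset.univ.filter fun c =>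
        ¬ (T.cutTree F).Top c ∧ 𝒢.gateTo T c = u)
        (l := fun c => if (T.cutTree F).Marked c then 1 else 0) (b := 1)
        (fun c => by split_ifs <;> simp) hN
      unfold localCnt
      omega
    have h2 : subtreeSum (𝒢.inner T F) (𝒢.localCnt T F) u ≤ n * (3 * n) :=
      sum_le_card_mul _ h1 le_rfl
    have h4 : n * n ≤ n ^ (κ + 4) := by
      rw [← pow_two]
      exact mono _ _ (by omega)
    nlinarith
  have h4 : ∀ u, subtreeSum (𝒢.inner T F) (𝒢.localMin T F) u ≤ n ^ (κ + 4) := by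
    refine fun u => hsum _ _ u (κ + 3) (fun u => ?_) le_rfl
    unfold localMin
    refine (sum_le_card_mul _ (b := n ^ (κ + 2)) (fun c => ?_) hN).trans (by rw [← pow_succ'])
    split_ifs
    · exact hinf _
    · exact Nat.zero_le _
  have h5 : ∀ c, 𝒢.chainCode T F c ≤ 4 * n ^ (κ + 4) := by
    intro c
    have h1 : (T.cutTree F).chainMin c ≤ n ^ (κ + 2) := hinf _
    have h2 : n ^ (κ + 2) ≤ n ^ (κ + 4) := mono _ _ (by omega)
    unfold chainCode
    split_ifs <;> omega
  have h1 : subtreeSum 𝒢.parent (𝒢.gateMark T F) v ≤ n ^ (κ + 4) := by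
    refine hsum _ _ v 0 (fun u => ?_) (by omega)
    unfold gateMark
    split_ifs <;> simp
  have h7 : ∀ u, subtreeSum (𝒢.final T F) (fun _ => 1) u ≤ n ^ (κ + 4) :=
    fun u => hsum _ _ u 0 hone (by omega)
  have h8 : ∀ u, subtreeSum (𝒢.final T F) (𝒢.portalMark T F ident) u ≤ n ^ (κ + 4) :=
    fun u => hsum _ _ u κ hportal (by omega)
  have hident : ∀ u, ident u ≤ 4 * n ^ (κ + 4) := fun u => (hid u).trans (by omega)
  interval_cases k
  · exact hident _
  · exact h1.trans (by omega)
  · exact hident _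
  · exact h3 _
  · exact (h4 _).trans (by omega)
  · exact h5 _
  · exact hident _
  · exact (h7 _).trans (by omega)
  · exact (h8 _).trans (by omega)
  · exact hident _
  · exact (h7 _).trans (by omega)
  · exact (h8 _).trans (by omega)

omit [Fintype V] in
theorem one_le_jTreeRank (H k : ℕ) (v : V) : 1 ≤ 𝒢.jTreeRank T F H k v := by
  unfold jTreeRank
  omega

/-- This holds for every `F ⊆ T`: the sizes of the variables do not depend on the depths of the
forests. -/
theorem usesBandwidth_jTreeProtocol [Fintype N] (X : 𝒢.ValidInput T F ident) {κ : ℕ}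
    (hid : ∀ v, ident v ≤ Fintype.card V ^ κ) (hcap : ∀ e, 𝒢.cap e ≤ Fintype.card V ^ κ) :
    jTreeProtocol.algorithm.UsesBandwidth G ident (jTreeInput 𝒢 ident T F)
      ((4 ^ 12 * (κ + 7) + 1) * (Nat.log 2 (Fintype.card V) + 1)) := by
  set L := Nat.log 2 (Fintype.card V) + 1 with hL
  have S := jTreeProtocol_spec X
    (H := (Finset.univ.sup fun v => dist 𝒢.parent v) ⊔ Finset.univ.sup fun v => dist (𝒢.up T F) v)
    (fun v => (Finset.le_sup (f := fun v => dist 𝒢.parent v) (Finset.mem_univ v)).trans le_sup_left)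
    (fun v => (Finset.le_sup (f := fun v => dist (𝒢.up T F) v) (Finset.mem_univ v)).trans
      le_sup_right)
  have h := S.usesBandwidth (s := L * (κ + 6)) (fun k v => one_le_jTreeRank _ k v)
    (by norm_num [jTreeProtocol]) ?_
  · intro t v w hvw
    refine (h t v w hvw).trans ?_
    change 4 ^ 12 * (L * (κ + 6) + 1) + 1 ≤ _
    have : 1 ≤ L := by omega
    nlinarith
  · intro k hk v
    have hn1 : 1 ≤ Fintype.card V := Fintype.card_pos_iff.2 ⟨v⟩
    refine (jTreeVal_le X hid hcap hk v).trans_lt ?_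
    have h1 : Fintype.card V < 2 ^ L := Nat.lt_pow_succ_log_self (by norm_num) _
    have h2 : Fintype.card V ^ (κ + 4) < (2 ^ L) ^ (κ + 4) :=
      Nat.pow_lt_pow_left h1 (by omega)
    have h3 : L * (κ + 6) = 2 * L + L * (κ + 4) := by ring
    have h4 : 4 ≤ 2 ^ (2 * L) := by
      rw [pow_mul]
      exact Nat.le_self_pow (by omega) 4
    rw [h3, pow_add 2, pow_mul 2 L (κ + 4)]
    exact (Nat.mul_lt_mul_of_pos_left h2 (by norm_num)).trans_le (Nat.mul_le_mul_right _ h4)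

/-- The number of rounds is linear in the depth of the forest `up`. -/
theorem computes_jTreeProtocol [Fintype N] (X : 𝒢.ValidInput T F ident) {H : ℕ}
    (hp : ∀ v, dist 𝒢.parent v ≤ H) (hu : ∀ v, dist (𝒢.up T F) v ≤ H) {j : ℕ} (hj : 1 ≤ j)
    (hFj : 4 * F.card ≤ j) :
    jTreeProtocol.algorithm.Computes G ident (jTreeInput 𝒢 ident T F)
      ((𝒢.clusteredJTree T F X.psi_inj X.subset hj hFj).output ident) (24 * H + 27) := by
  refine (jTreeProtocol_spec X hp hu).computes (fun k v => one_le_jTreeRank _ k v)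
    (by norm_num [jTreeProtocol]) (fun v tab hT => jTreeResult_eq X hj hFj hT) ?_
  intro k hk v
  have hk : k < 12 := hk
  have h1 := jTreeDelay_le (𝒢 := 𝒢) hu k v
  have h2 : k * (2 * H + 2) ≤ 11 * (2 * H + 2) := Nat.mul_le_mul_right _ (by omega)
  unfold jTreeRank
  omega

end ClusterGraph

/-! ### The random set of cut edges -/

namespace CapGraph.SpanningTree

variable {N E : Type} [Fintype E] {Γ : CapGraph N E} {T : Γ.SpanningTree} {q : E → ℝ}

open Classical in
/-- The union bound: an event that occurs whenever the random set meets each of the sets `A i`. -/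
theorem one_sub_sum_le_sampleProb {ι : Type} {S : Finset ι} {A : ι → Finset E}
    (hA : ∀ i ∈ S, A i ⊆ T.edges) (h0 : ∀ e, 0 ≤ q e) (h1 : ∀ e, q e ≤ 1)
    {event : Finset E → Prop}
    (h : ∀ R ⊆ T.edges, (∀ i ∈ S, ¬ Disjoint R (A i)) → event R) :
    1 - ∑ i ∈ S, ∏ e ∈ A i, (1 - q e) ≤ T.sampleProb q event := by
  set p : Finset E → ℝ := fun R => (∏ e ∈ R, q e) * ∏ e ∈ T.edges \ R, (1 - q e) with hp
  have hp0 : ∀ R, 0 ≤ p R := fun R => mul_nonneg (Finset.prod_nonneg fun e _ => h0 e)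
    (Finset.prod_nonneg fun e _ => sub_nonneg.2 (h1 e))
  have htotal : ∑ R ∈ T.edges.powerset, p R = 1 := by
    rw [hp, ← Finset.prod_add]
    simp
  have hmiss : ∀ i ∈ S, ∑ R ∈ T.edges.powerset with Disjoint R (A i), p R =
      ∏ e ∈ A i, (1 - q e) := by
    intro i hi
    have hpow : T.edges.powerset.filter (fun R => Disjoint R (A i)) =
        (T.edges \ A i).powerset := by
      ext R
      simp [Finset.subset_sdiff]
    rw [hpow]
    have hone := Finset.prod_add q (fun e => 1 - q e) (T.edges \ A i)
    simp only [add_sub_cancel, Finset.prod_const_one] at hone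
    have hsplit : ∏ e ∈ A i, (1 - q e) = (∏ e ∈ A i, (1 - q e)) *
        ∑ R ∈ (T.edges \ A i).powerset, (∏ e ∈ R, q e) * ∏ e ∈ (T.edges \ A i) \ R, (1 - q e) := by
      rw [← hone, mul_one]
    rw [hsplit, Finset.mul_sum]
    refine Finset.sum_congr rfl fun R hR => ?_
    obtain ⟨h2, h3⟩ := Finset.subset_sdiff.1 (Finset.mem_powerset.1 hR)
    have h4 : T.edges \ R = A i ∪ (T.edges \ A i) \ R := by
      ext e
      have h5 := @hA i hi e
      have h6 : e ∈ A i → e ∉ R := fun h h' => (Finset.disjoint_left.1 h3) h' h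
      simp only [Finset.mem_sdiff, Finset.mem_union]
      tauto
    have h5 : Disjoint (A i) ((T.edges \ A i) \ R) :=
      Finset.disjoint_left.2 fun e h h' => (Finset.mem_sdiff.1 (Finset.mem_sdiff.1 h').1).2 h
    simp only [hp]
    rw [h4, Finset.prod_union h5]
    ring
  have key : ∑ R ∈ T.edges.powerset, p R ≤ T.sampleProb q event +
      ∑ i ∈ S, ∑ R ∈ T.edges.powerset with Disjoint R (A i), p R := by
    unfold sampleProb
    simp only [Finset.sum_filter]
    rw [Finset.sum_comm, ← Finset.sum_add_distrib]
    refine Finset.sum_le_sum fun R hR => ?_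
    have hnn : ∀ i ∈ S, 0 ≤ if Disjoint R (A i) then p R else 0 := by
      intro i _
      split_ifs
      · exact hp0 R
      · exact le_rfl
    by_cases he : event R
    · rw [if_pos he]
      exact le_add_of_nonneg_right (Finset.sum_nonneg hnn)
    · rw [if_neg he, zero_add]
      have : ∃ i ∈ S, Disjoint R (A i) := by
        by_contra! h'
        exact he (h R (Finset.mem_powerset.1 hR) h')
      obtain ⟨i, hi, h2⟩ := this
      have := Finset.single_le_sum hnn hi
      rwa [if_pos h2] at this
  rw [htotal, Finset.sum_congr rfl hmiss] at key
  linarith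

theorem sampleProb_mono (h0 : ∀ e, 0 ≤ q e) (h1 : ∀ e, q e ≤ 1) {P Q : Finset E → Prop}
    (h : ∀ R, P R → Q R) : T.sampleProb q P ≤ T.sampleProb q Q := by
  classical
  unfold sampleProb
  refine Finset.sum_le_sum_of_subset_of_nonneg ?_ ?_
  · intro R hR
    simp only [Finset.mem_filter] at hR ⊢
    exact ⟨hR.1, h R hR.2⟩
  · intro R _ _
    exact mul_nonneg (Finset.prod_nonneg fun e _ => h0 e)
      (Finset.prod_nonneg fun e _ => sub_nonneg.2 (h1 e))

end CapGraph.SpanningTree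

namespace ClusterGraph

open ParentForest ParentForest.Grounded CapGraph CapGraph.SpanningTree

variable {V N E : Type} [Fintype V] [Fintype E] {G : SimpleGraph V}
  {𝒢 : ClusterGraph G N E} {T : 𝒢.toCapGraph.SpanningTree}

omit [Fintype E] in
theorem sampleRate_nonneg (e : E) : 0 ≤ 𝒢.sampleRate T e := by
  unfold sampleRate
  positivity

omit [Fintype E] in
theorem sampleRate_le_one (e : E) : 𝒢.sampleRate T e ≤ 1 := min_le_left _ _

omit [Fintype E] in
theorem one_sub_sampleRate_le (e : E) : 1 - 𝒢.sampleRate T e ≤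
    Real.exp (-((𝒢.clusterSize (T.lower e) : ℝ) / √(Fintype.card V : ℝ))) := by
  unfold sampleRate
  rcases le_total ((𝒢.clusterSize (T.lower e) : ℝ) / √(Fintype.card V : ℝ)) 1 with h | h
  · rw [min_eq_right h]
    exact Real.one_sub_le_exp_neg _
  · rw [min_eq_left h, sub_self]
    exact (Real.exp_pos _).le

/-- No path of `T` towards the root that avoids `R` has more than `L` network nodes in its
clusters. -/
def LightPaths (𝒢 : ClusterGraph G N E) (T : 𝒢.toCapGraph.SpanningTree) (L : ℝ) (R : Finset E) :
    Prop :=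
  ∀ x i, (∀ k < i, T.parent^[k] x ≠ T.root ∧ ∀ e ∈ R, T.parentEdge (T.parent^[k] x) ≠ some e) →
    ∑ k ∈ Finset.range i, (𝒢.clusterSize (T.parent^[k] x) : ℝ) ≤ L

/-- The probability that none of the edges of a path is sampled decays exponentially in the size of
the clusters on the path. -/
theorem exists_path_edges (x : N) (i : ℕ) (h : ∀ k < i, T.parent^[k] x ≠ T.root) :
    ∃ A ⊆ T.edges, (∀ e ∈ A, ∃ k < i, T.parentEdge (T.parent^[k] x) = some e) ∧
      ∏ e ∈ A, (1 - 𝒢.sampleRate T e) ≤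
        Real.exp (-((∑ k ∈ Finset.range i, (𝒢.clusterSize (T.parent^[k] x) : ℝ)) /
          √(Fintype.card V : ℝ))) := by
  classical
  have hex : ∀ k : {k // k ∈ Finset.range i}, ∃ e ∈ T.edges,
      T.parentEdge (T.parent^[k] x) = some e ∧ T.lower e = T.parent^[k] x :=
    fun k => exists_parentEdge (h k (Finset.mem_range.1 k.2))
  choose ed h1 h2 h3 using hex
  refine ⟨Finset.univ.image ed, ?_, ?_, ?_⟩
  · intro e he
    obtain ⟨k, -, rfl⟩ := Finset.mem_image.1 he
    exact h1 k
  · intro e he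
    obtain ⟨k, -, rfl⟩ := Finset.mem_image.1 he
    exact ⟨k, Finset.mem_range.1 k.2, h2 k⟩
  · have hinj : Function.Injective ed := by
      have hle : ∀ k < i, k ≤ dist T.parent x := by
        intro k hk
        by_contra hlt
        refine h k hk ?_
        have hd := T.grounded.dist_spec x
        have h4 : T.parent^[k] x = T.parent^[dist T.parent x] x := by
          obtain ⟨m, rfl⟩ := Nat.exists_eq_add_of_le (not_le.1 hlt).le
          rw [add_comm, Function.iterate_add_apply, Function.iterate_fixed hd]
        rw [h4]
        exact parent_eq_iff.1 hd
      intro k k' hkk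
      refine Subtype.ext (T.grounded.iterate_injOn x (hle k (Finset.mem_range.1 k.2))
        (hle k' (Finset.mem_range.1 k'.2)) ?_)
      change T.parent^[k] x = T.parent^[k'] x
      rw [← h3 k, ← h3 k', hkk]
    rw [Finset.prod_image hinj.injOn, Finset.sum_div, ← Finset.sum_neg_distrib, Real.exp_sum,
      ← Finset.prod_coe_sort (Finset.range i)]
    refine Finset.prod_le_prod (fun k _ => sub_nonneg.2 (sampleRate_le_one (𝒢 := 𝒢) _))
      fun k _ => ?_
    refine (one_sub_sampleRate_le _).trans_eq ?_
    rw [h3 k]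

/-- With high probability, the random set cuts all paths that visit many network nodes. -/
theorem le_sampleProb_lightPaths [Fintype N] {c : ℝ} :
    1 - (Fintype.card V : ℝ) ^ (-c) ≤ T.sampleProb (𝒢.sampleRate T)
      (𝒢.LightPaths T ((c + 1) * √(Fintype.card V : ℝ) * Real.log (Fintype.card V))) := by
  classical
  set n : ℝ := (Fintype.card V : ℝ) with hn
  set L : ℝ := (c + 1) * √n * Real.log n with hL
  have hn1 : 1 ≤ Fintype.card V := Fintype.card_pos_iff.2 ⟨𝒢.leader T.root⟩
  have hn0 : 0 < n := Nat.cast_pos.2 hn1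
  -- A path from `x` is heavy if it is long enough to exceed the bound.
  let heavy : N → ℕ → Prop := fun x i => (∀ k < i, T.parent^[k] x ≠ T.root) ∧
    L < ∑ k ∈ Finset.range i, (𝒢.clusterSize (T.parent^[k] x) : ℝ)
  let S : Finset N := Finset.univ.filter fun x => ∃ i, heavy x i
  have hex : ∀ x, (∃ i, heavy x i) → ∃ A ⊆ T.edges,
      (∀ i, heavy x i → ∀ e ∈ A, ∃ k < i, T.parentEdge (T.parent^[k] x) = some e) ∧
      ∏ e ∈ A, (1 - 𝒢.sampleRate T e) ≤ n ^ (-(c + 1)) := by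
    intro x hx
    -- The shortest heavy path is a part of all others.
    obtain ⟨h1, h2⟩ := Nat.find_spec hx
    obtain ⟨A, h3, h4, h5⟩ := exists_path_edges x _ h1
    refine ⟨A, h3, fun i hi e he => ?_, h5.trans ?_⟩
    · obtain ⟨k, hk, h6⟩ := h4 e he
      exact ⟨k, hk.trans_le (Nat.find_min' hx hi), h6⟩
    · rw [Real.rpow_def_of_pos hn0]
      refine Real.exp_le_exp.2 ?_
      rw [mul_neg, neg_le_neg_iff, le_div_iff₀ (Real.sqrt_pos.2 hn0)]
      refine le_trans (le_of_eq ?_) h2.le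
      rw [hL]
      ring
  choose! A hA1 hA2 hA3 using hex
  have key := one_sub_sum_le_sampleProb (T := T) (S := S) (A := A) (q := 𝒢.sampleRate T)
    (event := 𝒢.LightPaths T L) (fun x hx => hA1 x (Finset.mem_filter.1 hx).2)
    sampleRate_nonneg sampleRate_le_one ?_
  · refine le_trans (sub_le_sub_left ?_ 1) key
    have h1 : ∑ x ∈ S, ∏ e ∈ A x, (1 - 𝒢.sampleRate T e) ≤ S.card • n ^ (-(c + 1)) :=
      Finset.sum_le_card_nsmul _ _ _ fun x hx => hA3 x (Finset.mem_filter.1 hx).2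
    have h2 : (S.card : ℝ) ≤ n :=
      Nat.cast_le.2 ((Finset.card_le_univ S).trans 𝒢.card_clusters_le)
    refine h1.trans ?_
    rw [nsmul_eq_mul]
    refine (mul_le_mul_of_nonneg_right h2 (Real.rpow_nonneg hn0.le _)).trans_eq ?_
    nth_rw 1 [← Real.rpow_one n]
    rw [← Real.rpow_add hn0]
    congr 1
    ring
  · intro R _ hR x i hx
    by_contra hlt
    have hheavy : heavy x i := ⟨fun k hk => (hx k hk).1, not_le.1 hlt⟩
    refine hR x (Finset.mem_filter.2 ⟨Finset.mem_univ _, i, hheavy⟩) ?_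
    rw [Finset.disjoint_left]
    intro e he he'
    obtain ⟨k, hk, h1⟩ := hA2 x ⟨i, hheavy⟩ i hheavy e he'
    exact (hx k hk).2 e he h1

end ClusterGraph

open ClusterGraph CapGraph.SpanningTree in
theorem mainTheorem9 :
    ∃ (A : CongestAlgorithm JTreeInput JTreeOutput) (β : ℝ) (k : ℕ), 1 ≤ β ∧
      ∀ (κ : ℕ) (c : ℝ), 0 < c → ∃ (B : ℕ) (C : ℝ),
        ∀ (V N E : Type) [Fintype V] [Fintype E] (G : SimpleGraph V) (ident : V → ℕ)
          (𝒢 : ClusterGraph G N E) (T : 𝒢.toCapGraph.SpanningTree) (d : ℕ),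
          G.Connected →
          Function.Injective ident →
          (∀ v, ident v ≤ Fintype.card V ^ κ) →
          (∀ e, 1 ≤ 𝒢.cap e ∧ 𝒢.cap e ≤ Fintype.card V ^ κ) →
          EdgewiseInjective 𝒢.psi →
          𝒢.DepthLE d →
          (∀ F ⊆ T.edges, A.UsesBandwidth G ident (jTreeInput 𝒢 ident T F)
            (B * (Nat.log 2 (Fintype.card V) + 1))) ∧
          1 - (Fintype.card V : ℝ) ^ (-c) ≤
            T.sampleProb (𝒢.sampleRate T) fun R =>
              ∀ F : Finset E, R ⊆ F → F ⊆ T.edges →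
                ∀ j : ℕ, 1 ≤ j → (F.card : ℝ) ≤ (j : ℝ) / 4 →
                  ∃ (EJ : Type) (_ : Fintype EJ) (X : ClusteredJTree 𝒢 j EJ) (d' t : ℕ),
                    X.clusters.DepthLE d' ∧
                    (d' : ℝ) ≤ d + C * √(Fintype.card V : ℝ) *
                      (1 + Real.log (Fintype.card V)) ^ k ∧
                    (T.graphH F).Embeddable 1 X.J ∧
                    X.J.Embeddable β (T.graphH F) ∧
                    A.Computes G ident (jTreeInput 𝒢 ident T F) (X.output ident) t ∧
                    (t : ℝ) ≤ C * ((G.diam : ℝ) + d + √(Fintype.card V : ℝ)) *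
                      (1 + Real.log (Fintype.card V)) ^ k := by
  refine ⟨jTreeProtocol.algorithm, 8, 1, by norm_num, fun κ c hc =>
    ⟨4 ^ 12 * (κ + 7) + 1, 24 * (c + 1) + 27, ?_⟩⟩
  intro V N E _ _ G ident 𝒢 T d _ hid hidb hcap hpsi hd
  have : Finite N := Finite.of_surjective 𝒢.cluster fun x => ⟨𝒢.leader x, 𝒢.cluster_leader x⟩
  have : Fintype N := Fintype.ofFinite N
  refine ⟨fun F hF => usesBandwidth_jTreeProtocol ⟨hid, hpsi, hF⟩ hidb fun e => (hcap e).2, ?_⟩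
  refine le_sampleProb_lightPaths.trans (sampleProb_mono sampleRate_nonneg sampleRate_le_one
    fun R hR F hRF hF j hj hFj => ?_)
  set n : ℝ := (Fintype.card V : ℝ) with hn
  have hn1 : 1 ≤ n := by
    rw [hn]
    exact Nat.one_le_cast.2 (Fintype.card_pos_iff.2 ⟨𝒢.leader T.root⟩)
  have hlog : 0 ≤ Real.log n := Real.log_nonneg hn1
  have hsqrt : 1 ≤ √n := Real.one_le_sqrt.2 hn1
  -- With high probability a path of `T \ F` visits at most `L` network nodes.  All forests then have
  -- depth at most `d + L`, which bounds both the new clusters and the running time; the diameter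
  -- contributes only a nonnegative term.
  set L : ℝ := (c + 1) * √n * Real.log n with hL
  have hL0 : 0 ≤ L := by positivity
  have hfloor : (⌊L⌋₊ : ℝ) ≤ L := Nat.floor_le hL0
  have hu : ∀ v, ParentForest.dist (𝒢.up T F) v ≤ d + ⌊L⌋₊ := by
    refine dist_up_le hd fun x i hx => Nat.le_floor ?_
    push_cast
    exact hR x i fun k hk => ⟨ne_root_of_not_top (hx k hk),
      fun e he h => hx k hk (Or.inr ⟨e, hRF he, h⟩)⟩
  have hp : ∀ v, ParentForest.dist 𝒢.parent v ≤ d + ⌊L⌋₊ :=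
    fun v => (𝒢.dist_parent_le hd v).trans (Nat.le_add_right _ _)
  have hFj' : 4 * F.card ≤ j := by
    have : (4 * F.card : ℝ) ≤ j := by linarith
    exact_mod_cast this
  have hsl : √n * Real.log n ≤ √n * (1 + Real.log n) := by nlinarith
  have hs1 : 1 ≤ √n * (1 + Real.log n) := by nlinarith
  have hL1 : L ≤ (c + 1) * (√n * (1 + Real.log n)) := by
    rw [hL, mul_assoc]
    exact mul_le_mul_of_nonneg_left hsl (by linarith)
  have X : 𝒢.ValidInput T F ident := ⟨hid, hpsi, hF⟩
  refine ⟨T.JEdge F, inferInstance, 𝒢.clusteredJTree T F hpsi hF hj hFj', d + ⌊L⌋₊,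
    24 * (d + ⌊L⌋₊) + 27, depthLE_newClusters 𝒢 T F hu, ?_, embeddable_graphH_jGraph,
    embeddable_jGraph_graphH, computes_jTreeProtocol X hp hu hj hFj', ?_⟩
  · push_cast
    rw [pow_one]
    nlinarith
  · push_cast
    rw [pow_one]
    have hdiam : 0 ≤ (G.diam : ℝ) * (1 + Real.log n) := by positivity
    have hdd : (d : ℝ) ≤ d * (1 + Real.log n) :=
      le_mul_of_one_le_right (Nat.cast_nonneg d) (by linarith)
    have hC : 27 ≤ 24 * (c + 1) + 27 := by linarith
    have h1 : 24 * (d : ℝ) ≤ (24 * (c + 1) + 27) * (d * (1 + Real.log n)) := by nlinarith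
    have h2 : 0 ≤ (24 * (c + 1) + 27) * ((G.diam : ℝ) * (1 + Real.log n)) := by positivity
    have h3 : 24 * (⌊L⌋₊ : ℝ) + 27 ≤ (24 * (c + 1) + 27) * (√n * (1 + Real.log n)) := by nlinarith
    calc 24 * ((d : ℝ) + ⌊L⌋₊) + 27 ≤ (24 * (c + 1) + 27) * ((G.diam : ℝ) * (1 + Real.log n)) +
          (24 * (c + 1) + 27) * (d * (1 + Real.log n)) +
          (24 * (c + 1) + 27) * (√n * (1 + Real.log n)) := by linarith
      _ = (24 * (c + 1) + 27) * ((G.diam : ℝ) + d + √n) * (1 + Real.log n) := by ring
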